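/- Assume the Elliott--Halberstam Conjecture in the following form: for any fixed real numbers $A>0$ and $\epsilon>0$, $$\sum_{d\leqslant x^{1-\epsilon}}\ \sup_{2\leqslant y\leqslant x}\left|\pi(y;d,1)-\frac{\mathrm{li}\,y}{\varphi(d)}\right|\ll_{A,\epsilon}\frac{x}{(\log x)^A}\qquad(x\to\infty),$$ where $d$ runs over positive integers, $y$ over real numbers, $\pi(y;d,1)$ is the number of primes $p\leqslant y$ with $p\equiv 1\pmod d$, $\varphi$ is Euler's totient function, and $\mathrm{li}\,y=\int_2^y\frac{dt}{\log t}$. Then $$\sum_{p,q\leqslant x}\frac{1}{[p-1,q-1]}\sim 2\,\frac{\zeta(2)\zeta(3)}{\zeta(6)}\log x\qquad\text{as } x\to\infty,$$ where the sum is over all ordered pairs of primes $p,q$ with $p\leqslant x$ and $q\leqslant x$, $[a,b]$ denotes the least common multiple of $a$ and $b$, and $\zeta$ is the Riemann zeta function. -/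

import Mathlib

open Filter Asymptotics

noncomputable section

/-- `π(y; d, a)`: the number of primes `p ≤ y` with `p ≡ a (mod d)`. -/
def primeCountingAP (y : ℝ) (d a : ℕ) : ℕ :=
  ((Nat.primesLE ⌊y⌋₊).filter fun p => p ≡ a [MOD d]).card

/-- The logarithmic integral `li y = ∫_2^y dt / log t`. -/
def li (y : ℝ) : ℝ :=
  ∫ t in (2 : ℝ)..y, 1 / Real.log t

/-- `sup_{2 ≤ y ≤ x} |π(y; d, 1) - li y / φ(d)|`. For `x ≥ 2` and `d ≥ 1` this is the supremum of a
nonempty bounded set of reals. The lower bound `2 ≤ y` is there because `li` diverges at `1`. -/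
def maxDiscrepancy (x : ℝ) (d : ℕ) : ℝ :=
  ⨆ y : Set.Icc (2 : ℝ) x, |(primeCountingAP y d 1 : ℝ) - li y / (Nat.totient d : ℝ)|

/-- The Elliott–Halberstam Conjecture (for the residue class `1`): for all fixed `A, ε > 0`,
`∑_{d ≤ x^{1-ε}} max_{y ≤ x} |π(y; d, 1) - li y / φ(d)| ≪_{A, ε} x / (log x)^A`. -/
def ElliottHalberstam : Prop :=
  ∀ A ε : ℝ, 0 < A → 0 < ε →
    (fun x : ℝ => ∑ d ∈ Finset.Icc 1 ⌊x ^ (1 - ε)⌋₊, maxDiscrepancy x d)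
      =O[atTop] fun x : ℝ => x / Real.log x ^ A

/-- `∑_{p, q ≤ x} 1 / [p - 1, q - 1]`, over ordered pairs of primes. -/
def lcmSum (x : ℝ) : ℝ :=
  ∑ p ∈ Nat.primesLE ⌊x⌋₊, ∑ q ∈ Nat.primesLE ⌊x⌋₊, 1 / (Nat.lcm (p - 1) (q - 1) : ℝ)

end

/-!
Since `1/[a, b] = (a, b)/(ab)` and `n = ∑_{d ∣ n} φ(d)`, the sum over `p, q ≤ x` equals
`∑_d φ(d) S_d²`, where `S_d` is the sum of `1/(p-1)` over the primes `p ≤ x`, `p ≡ 1 (mod d)`. Take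
`x = 2^J`, split `S_d` over the blocks `2^j < p ≤ 2^(j+1)`, and call a block far from `d` if
`d ≤ 2^(j(1-ε))`.

On a far block, the Elliott–Halberstam conjecture and partial summation replace the sum of
`1/(p-1)` by `log ((j+1)/j)/φ(d)`, with errors summable over `j`. The mean square of this model is
`∑_{i,j} L_i L_j G(min(i, j))`, where `L_j = log ((j+1)/j)` and `G(m) = ∑ 1/φ(d)` over
`d ≤ 2^(m(1-ε))`. Now `G(m)` is asymptotic to `(1-ε) c m log 2`, where
`c = ζ(2)ζ(3)/ζ(6) = ∏_p (1 + 1/(p(p-1)))`, and `∑_{i,j<J} L_i L_j min(i, j)` is asymptotic to `2J`.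

The blocks that are not far contribute a mean square of only `O(εJ)`. There `p = dk + 1` with a
small cofactor `k`; opening the square leads to the `d` for which `dk + 1` and `dl + 1` are both
prime, and these are counted by Selberg's sieve. The Brun–Titchmarsh inequality for each single `d`
would lose a factor `(log log x)²` here.

By the triangle inequality in the `φ`-weighted `ℓ²` norm, letting `ε → 0` gives the asymptotics for
`x = 2^J`, and monotonicity extends it to all `x`.
-/

section SelbergSieve

open Finset BoundingSieve
open scoped ArithmeticFunction.Moebius

theorem sum_moebius_divisors_filter_dvd {f : ℕ} (hf : Squarefree f) (l : ℕ) :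
    ∑ d ∈ f.divisors with l ∣ d, μ d = if l = f then μ l else 0 := by
  by_cases hlf : l ∣ f
  · obtain ⟨m, rfl⟩ := hlf
    have hl : 0 < l := Nat.pos_of_ne_zero (left_ne_zero_of_mul hf.ne_zero)
    have hm : m ≠ 0 := right_ne_zero_of_mul hf.ne_zero
    have hcop : l.Coprime m := (Nat.squarefree_mul_iff.mp hf).1
    have himage : {d ∈ (l * m).divisors | l ∣ d} = m.divisors.image (l * ·) := by
      ext d
      simp only [mem_filter, Nat.mem_divisors, mem_image]
      constructor
      · rintro ⟨⟨hdvd, -⟩, c, rfl⟩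
        exact ⟨c, ⟨(Nat.mul_dvd_mul_iff_left hl).mp hdvd, hm⟩, rfl⟩
      · rintro ⟨c, ⟨hc, -⟩, rfl⟩
        exact ⟨⟨mul_dvd_mul_left l hc, hf.ne_zero⟩, dvd_mul_right _ _⟩
    have hmoebius : ∀ c ∈ m.divisors, μ (l * c) = μ l * μ c := fun c hc =>
      ArithmeticFunction.isMultiplicative_moebius.map_mul_of_coprime
        (hcop.coprime_dvd_right (Nat.dvd_of_mem_divisors hc))
    rw [himage, sum_image fun a _ b _ hab => Nat.eq_of_mul_eq_mul_left hl hab,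
      sum_congr rfl hmoebius, ← mul_sum, ← ArithmeticFunction.coe_mul_zeta_apply,
      ArithmeticFunction.moebius_mul_coe_zeta, ArithmeticFunction.one_apply]
    simp only [mul_ite, mul_one, mul_zero, left_eq_mul₀ hl.ne']
  · rw [if_neg (by rintro rfl; exact hlf dvd_rfl)]
    refine sum_eq_zero fun d hd => absurd ?_ hlf
    rw [mem_filter] at hd
    exact hd.2.trans (Nat.dvd_of_mem_divisors hd.1)

theorem lambdaSquared_eq_sum_lcm_eq (w : ℕ → ℝ) {P d : ℕ} (hP : P ≠ 0) (hd : d ∣ P) :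
    lambdaSquared w d =
      ∑ x ∈ P.divisors ×ˢ P.divisors with x.1.lcm x.2 = d, w x.1 * w x.2 := by
  rw [lambdaSquared, ← sum_product', ← sum_filter]
  refine sum_congr ?_ fun _ _ => rfl
  ext ⟨a, b⟩
  simp only [mem_filter, mem_product, Nat.mem_divisors]
  constructor
  · rintro ⟨⟨⟨ha, -⟩, hb, -⟩, rfl⟩
    exact ⟨⟨⟨ha.trans hd, hP⟩, hb.trans hd, hP⟩, rfl⟩
  · rintro ⟨-, rfl⟩
    have hlcm : a.lcm b ≠ 0 := ne_zero_of_dvd_ne_zero hP hd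
    exact ⟨⟨⟨Nat.dvd_lcm_left a b, hlcm⟩, Nat.dvd_lcm_right a b, hlcm⟩, rfl⟩

theorem errSum_lambdaSquared_le (s : BoundingSieve) (w : ℕ → ℝ) :
    s.errSum (lambdaSquared w) ≤ ∑ x ∈ s.prodPrimes.divisors ×ˢ s.prodPrimes.divisors,
      |w x.1| * |w x.2| * |s.rem (x.1.lcm x.2)| := by
  have hlcm : ∀ x ∈ s.prodPrimes.divisors ×ˢ s.prodPrimes.divisors,
      x.1.lcm x.2 ∈ s.prodPrimes.divisors := fun x hx => by
    simp only [mem_product, Nat.mem_divisors] at hx ⊢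
    exact ⟨Nat.lcm_dvd hx.1.1 hx.2.1, hx.1.2⟩
  rw [← sum_fiberwise_of_maps_to hlcm]
  refine sum_le_sum fun d hd => ?_
  rw [lambdaSquared_eq_sum_lcm_eq w prodPrimes_ne_zero (Nat.dvd_of_mem_divisors hd)]
  calc |∑ x ∈ s.prodPrimes.divisors ×ˢ s.prodPrimes.divisors with x.1.lcm x.2 = d,
        w x.1 * w x.2| * |s.rem d|
      ≤ (∑ x ∈ s.prodPrimes.divisors ×ˢ s.prodPrimes.divisors with x.1.lcm x.2 = d,
        |w x.1| * |w x.2|) * |s.rem d| := by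
        gcongr
        exact (abs_sum_le_sum_abs _ _).trans_eq (sum_congr rfl fun _ _ => abs_mul _ _)
    _ = _ := by
        rw [sum_mul]
        exact sum_congr rfl fun x hx => by rw [(mem_filter.mp hx).2]

variable (s : SelbergSieve)

/-- The squarefree moduli on which the Selberg weights of the sieve `s` are supported: the divisors
`d` of the sifting product with `d ^ 2` at most the level, so that least common multiples of two
moduli stay below the level. -/
noncomputable def sieveModuli : Finset ℕ := {d ∈ s.prodPrimes.divisors | (d : ℝ) ^ 2 ≤ s.level}

/-- The sum `∑ g(l)` of the Selberg terms over the sieve moduli; its inverse is the density in the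
main term of the Selberg sieve. -/
noncomputable def selbergSum : ℝ := ∑ l ∈ sieveModuli s, s.selbergTerms l

/-- The weights minimising the quadratic form `BoundingSieve.mainSum (lambdaSquared w)` among all
`w` supported on the sieve moduli with `w 1 = 1`. -/
noncomputable def selbergWeight (d : ℕ) : ℝ :=
  μ d * (s.nu d)⁻¹ * (∑ f ∈ sieveModuli s with d ∣ f, s.selbergTerms f) / selbergSum s

variable {s}

theorem mem_sieveModuli {d : ℕ} :
    d ∈ sieveModuli s ↔ d ∣ s.prodPrimes ∧ (d : ℝ) ^ 2 ≤ s.level := by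
  simp only [sieveModuli, mem_filter, Nat.mem_divisors, prodPrimes_ne_zero, ne_eq,
    not_false_eq_true, and_true]

theorem selbergTerms_pos_of_mem_sieveModuli {l : ℕ} (hl : l ∈ sieveModuli s) :
    0 < s.selbergTerms l :=
  selbergTerms_pos (mem_sieveModuli.mp hl).1

variable (s)

theorem selbergSum_pos : 0 < selbergSum s :=
  sum_pos (fun _ => selbergTerms_pos_of_mem_sieveModuli)
    ⟨1, mem_sieveModuli.mpr ⟨one_dvd _, by simpa using s.one_le_level⟩⟩

theorem selbergWeight_one : selbergWeight s 1 = 1 := by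
  have hfilter : {f ∈ sieveModuli s | 1 ∣ f} = sieveModuli s :=
    filter_true_of_mem fun f _ => one_dvd f
  rw [selbergWeight, hfilter, ← selbergSum, ArithmeticFunction.moebius_apply_one,
    s.nu_mult.map_one, Int.cast_one, inv_one, one_mul, one_mul, div_self (selbergSum_pos s).ne']

variable {s}

theorem selbergWeight_eq_zero {d : ℕ} (hd : d ∣ s.prodPrimes) (hmem : d ∉ sieveModuli s) :
    selbergWeight s d = 0 := by
  have hempty : {f ∈ sieveModuli s | d ∣ f} = ∅ := by
    refine filter_eq_empty_iff.mpr fun f hf hdf => hmem (mem_sieveModuli.mpr ⟨hd, ?_⟩)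
    obtain ⟨hfP, hflevel⟩ := mem_sieveModuli.mp hf
    have hdf : d ≤ f :=
      Nat.le_of_dvd (Nat.pos_of_ne_zero (ne_zero_of_dvd_ne_zero prodPrimes_ne_zero hfP)) hdf
    exact le_trans (by gcongr) hflevel
  rw [selbergWeight, hempty, sum_empty, mul_zero, zero_div]

theorem abs_selbergWeight_le {d : ℕ} (hd : d ∣ s.prodPrimes) :
    |selbergWeight s d| ≤ (s.nu d)⁻¹ := by
  have hS := selbergSum_pos s
  have hnu : 0 < (s.nu d)⁻¹ := inv_pos.mpr (nu_pos_of_dvd_prodPrimes hd)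
  have hsum_nonneg : 0 ≤ ∑ f ∈ sieveModuli s with d ∣ f, s.selbergTerms f :=
    sum_nonneg fun f hf => (selbergTerms_pos_of_mem_sieveModuli (mem_filter.mp hf).1).le
  have hsum_le : ∑ f ∈ sieveModuli s with d ∣ f, s.selbergTerms f ≤ selbergSum s :=
    sum_le_sum_of_subset_of_nonneg (filter_subset _ _) fun f hf _ =>
      (selbergTerms_pos_of_mem_sieveModuli hf).le
  have hmoebius : |(μ d : ℝ)| ≤ 1 := by exact_mod_cast ArithmeticFunction.abs_moebius_le_one
  rw [selbergWeight, abs_div, abs_mul, abs_mul, abs_of_pos hS, abs_of_nonneg hsum_nonneg,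
    abs_of_pos hnu, div_le_iff₀ hS]
  calc |(μ d : ℝ)| * (s.nu d)⁻¹ * ∑ f ∈ sieveModuli s with d ∣ f, s.selbergTerms f
      ≤ 1 * (s.nu d)⁻¹ * selbergSum s := by gcongr
    _ = (s.nu d)⁻¹ * selbergSum s := by rw [one_mul]

variable (s)

theorem sum_nu_mul_selbergWeight (l : ℕ) :
    ∑ d ∈ s.prodPrimes.divisors with l ∣ d, s.nu d * selbergWeight s d =
      if l ∈ sieveModuli s then μ l * s.selbergTerms l / selbergSum s else 0 := by
  have hterm : ∀ d ∈ {d ∈ s.prodPrimes.divisors | l ∣ d}, s.nu d * selbergWeight s d =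
      ∑ f ∈ sieveModuli s with d ∣ f, μ d * s.selbergTerms f / selbergSum s := fun d hd => by
    have hnu : s.nu d ≠ 0 := nu_ne_zero (Nat.dvd_of_mem_divisors (mem_filter.mp hd).1)
    rw [selbergWeight, ← sum_div, ← mul_sum]
    field_simp
  have hswap : ∀ d f, d ∈ {d ∈ s.prodPrimes.divisors | l ∣ d} ∧ f ∈ {f ∈ sieveModuli s | d ∣ f} ↔
      d ∈ {d ∈ f.divisors | l ∣ d} ∧ f ∈ sieveModuli s := fun d f => by
    simp only [mem_filter, Nat.mem_divisors, mem_sieveModuli]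
    constructor
    · rintro ⟨⟨⟨-, hP⟩, hl⟩, ⟨hf, hflevel⟩, hdf⟩
      exact ⟨⟨⟨hdf, ne_zero_of_dvd_ne_zero hP hf⟩, hl⟩, hf, hflevel⟩
    · rintro ⟨⟨⟨hdf, -⟩, hl⟩, hf, hflevel⟩
      exact ⟨⟨⟨hdf.trans hf, prodPrimes_ne_zero⟩, hl⟩, ⟨hf, hflevel⟩, hdf⟩
  have hinner : ∀ f ∈ sieveModuli s,
      ∑ d ∈ f.divisors with l ∣ d, μ d * s.selbergTerms f / selbergSum s =
        if l = f then μ l * s.selbergTerms l / selbergSum s else 0 := fun f hf => by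
    have hsq : Squarefree f := squarefree_of_dvd_prodPrimes (mem_sieveModuli.mp hf).1
    rw [← sum_div, ← sum_mul, ← Int.cast_sum, sum_moebius_divisors_filter_dvd hsq]
    split_ifs with hlf
    · rw [hlf]
    · simp
  rw [sum_congr rfl hterm, sum_comm' hswap, sum_congr rfl hinner, sum_ite_eq]

theorem mainSum_selbergWeight :
    s.mainSum (lambdaSquared (selbergWeight s)) = (selbergSum s)⁻¹ := by
  have hS := (selbergSum_pos s).ne'
  have hterm : ∀ l ∈ s.prodPrimes.divisors, (s.selbergTerms l)⁻¹ *
      (∑ d ∈ s.prodPrimes.divisors, if l ∣ d then s.nu d * selbergWeight s d else 0) ^ 2 =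
        if l ∈ sieveModuli s then s.selbergTerms l / selbergSum s ^ 2 else 0 := fun l hl => by
    have hlP := Nat.dvd_of_mem_divisors hl
    have hmoebius : (μ l : ℝ) ^ 2 = 1 := by
      exact_mod_cast ArithmeticFunction.moebius_sq_eq_one_of_squarefree
        (squarefree_of_dvd_prodPrimes hlP)
    have hg := (selbergTerms_pos hlP).ne'
    rw [← sum_filter, sum_nu_mul_selbergWeight]
    split_ifs
    · rw [div_pow, mul_pow, hmoebius]
      field_simp
    · simp
  have hsub : sieveModuli s ⊆ s.prodPrimes.divisors := filter_subset _ _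
  rw [mainSum_lambdaSquared_eq_sum_mul_sum_sq, sum_congr rfl hterm, sum_ite_mem,
    inter_eq_right.mpr hsub, ← sum_div, ← selbergSum]
  field_simp

theorem siftedSum_le_div_selbergSum_add :
    s.siftedSum ≤ s.totalMass / selbergSum s + ∑ x ∈ sieveModuli s ×ˢ sieveModuli s,
      (s.nu x.1)⁻¹ * (s.nu x.2)⁻¹ * |s.rem (x.1.lcm x.2)| := by
  have hsieve := siftedSum_le_mainSum_errSum_of_upperMoebius (s := s.toBoundingSieve) _
    (upperMoebius_lambdaSquared (selbergWeight s) (selbergWeight_one s))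
  rw [mainSum_selbergWeight, ← div_eq_mul_inv] at hsieve
  have hsub : sieveModuli s ⊆ s.prodPrimes.divisors := filter_subset _ _
  have hsupport : ∀ d ∈ s.prodPrimes.divisors, d ∉ sieveModuli s → selbergWeight s d = 0 :=
    fun d hd => selbergWeight_eq_zero (Nat.dvd_of_mem_divisors hd)
  refine hsieve.trans (add_le_add_right ((errSum_lambdaSquared_le _ _).trans ?_) _)
  rw [← sum_subset (product_subset_product hsub hsub)]
  · refine sum_le_sum fun x hx => ?_
    rw [mem_product] at hx
    have hfst := (mem_sieveModuli.mp hx.1).1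
    have hnu : 0 < s.nu x.1 := nu_pos_of_dvd_prodPrimes hfst
    gcongr
    exacts [abs_selbergWeight_le hfst, abs_selbergWeight_le (mem_sieveModuli.mp hx.2).1]
  · intro x hx hmem
    rw [mem_product] at hx hmem
    rcases not_and_or.mp hmem with h | h
    · rw [hsupport _ hx.1 h, abs_zero, zero_mul, zero_mul]
    · rw [hsupport _ hx.2 h, abs_zero, mul_zero, zero_mul]

end SelbergSieve

section SelbergSumLowerBound

open Finset BoundingSieve UniqueFactorizationMonoid
open scoped ArithmeticFunction.Omega

theorem sum_le_prod_inv_one_sub {f : ℕ →* ℝ} (hf : ∀ n, 0 ≤ f n)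
    (hf_lt : ∀ p, p.Prime → f p < 1) {S T : Finset ℕ} (hT : ∀ m ∈ T, m ∈ Nat.factoredNumbers S) :
    ∑ m ∈ T, f m ≤ ∏ p ∈ S with p.Prime, (1 - f p)⁻¹ := by
  classical
  have hnorm : ∀ {p : ℕ}, p.Prime → ‖f p‖ < 1 := fun hp => by
    rw [Real.norm_of_nonneg (hf _)]
    exact hf_lt _ hp
  rw [← sum_subtype_of_mem f hT]
  exact sum_le_hasSum _ (fun m _ => hf m)
    (EulerProduct.summable_and_hasSum_factoredNumbers_prod_filter_prime_geometric hnorm S).2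

theorem sum_filter_radical_eq_le {f : ℕ →* ℝ} (hf : ∀ n, 0 ≤ f n)
    (hf_lt : ∀ p, p.Prime → f p < 1) {T : Finset ℕ} (hT : ∀ m ∈ T, m ≠ 0) (l : ℕ) :
    ∑ m ∈ T with radical m = l, f m ≤ f l * ∏ p ∈ l.primeFactors, (1 - f p)⁻¹ := by
  have hdvd : ∀ m ∈ {m ∈ T | radical m = l}, l ∣ m := fun m hm => by
    rw [← (mem_filter.mp hm).2]
    exact radical_dvd_self
  have hinj : Set.InjOn (· / l) ({m ∈ T | radical m = l} : Finset ℕ) := fun a ha b hb hab =>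
    (Nat.div_left_inj (hdvd a ha) (hdvd b hb)).mp hab
  have hfactored : ∀ c ∈ {m ∈ T | radical m = l}.image (· / l),
      c ∈ Nat.factoredNumbers l.primeFactors := by
    intro c hc
    obtain ⟨m, hm, rfl⟩ := mem_image.mp hc
    obtain ⟨hmT, hrad⟩ := mem_filter.mp hm
    have hm0 := hT m hmT
    rw [Nat.mem_factoredNumbers_iff_primeFactors_subset, ← hrad, Nat.primeFactors_radical, hrad]
    exact ⟨(Nat.div_pos (Nat.le_of_dvd (Nat.pos_of_ne_zero hm0) (hdvd m hm))
      (hrad ▸ Nat.radical_pos m)).ne',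
      Nat.primeFactors_mono (Nat.div_dvd_of_dvd (hdvd m hm)) hm0⟩
  calc ∑ m ∈ T with radical m = l, f m = ∑ m ∈ T with radical m = l, f l * f (m / l) :=
        sum_congr rfl fun m hm => by rw [← map_mul, Nat.mul_div_cancel' (hdvd m hm)]
    _ = f l * ∑ c ∈ {m ∈ T | radical m = l}.image (· / l), f c := by
        rw [← mul_sum, sum_image hinj]
    _ ≤ f l * ∏ p ∈ l.primeFactors with p.Prime, (1 - f p)⁻¹ :=
        mul_le_mul_of_nonneg_left (sum_le_prod_inv_one_sub hf hf_lt hfactored) (hf l)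
    _ = f l * ∏ p ∈ l.primeFactors, (1 - f p)⁻¹ := by
        rw [filter_true_of_mem fun p => Nat.prime_of_mem_primeFactors]

theorem mul_prod_inv_one_sub_le_selbergTerms {s : BoundingSieve} {f : ℕ →* ℝ}
    (hf : ∀ n, 0 ≤ f n) (hf_le : ∀ p, p.Prime → p ∣ s.prodPrimes → f p ≤ s.nu p) {l : ℕ}
    (hl : l ∣ s.prodPrimes) :
    f l * ∏ p ∈ l.primeFactors, (1 - f p)⁻¹ ≤ s.selbergTerms l := by
  have hle : ∀ p ∈ l.primeFactors, f p ≤ s.nu p ∧ s.nu p < 1 := fun p hp => by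
    have hprime := Nat.prime_of_mem_primeFactors hp
    have hdvd := (Nat.dvd_of_mem_primeFactors hp).trans hl
    exact ⟨hf_le p hprime hdvd, s.nu_lt_one_of_prime p hprime hdvd⟩
  have hf_eq : f l = ∏ p ∈ l.primeFactors, f p := by
    rw [← map_prod, Nat.prod_primeFactors_of_squarefree (squarefree_of_dvd_prodPrimes hl)]
  rw [selbergTerms_apply, ← prod_primeFactors_nu hl, hf_eq]
  refine mul_le_mul (prod_le_prod (fun p _ => hf p) fun p hp => (hle p hp).1) ?_
    (prod_nonneg fun p hp => ?_) (prod_nonneg fun p hp => (hf p).trans (hle p hp).1)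
  · refine prod_le_prod (fun p hp => ?_) fun p hp => ?_
    · rw [inv_nonneg]
      linarith [(hle p hp).1, (hle p hp).2]
    · have := hle p hp
      exact inv_anti₀ (by linarith) (by linarith)
  · rw [inv_nonneg]
    linarith [(hle p hp).1, (hle p hp).2]

/- Grouping the integers `m` by their radical `l`, the part of the sum belonging to `l` is at most
the Selberg term `g(l)`: this is how completely multiplicative sums bound `∑ g(l)` from below. -/
theorem sum_le_selbergSum {s : SelbergSieve} {f : ℕ →* ℝ} (hf : ∀ n, 0 ≤ f n)
    (hf_lt : ∀ p, p.Prime → f p < 1) (hf_le : ∀ p, p.Prime → p ∣ s.prodPrimes → f p ≤ s.nu p)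
    {N : ℕ} (hN : (N : ℝ) ^ 2 ≤ s.level) :
    ∑ m ∈ Icc 1 N with m.primeFactors ⊆ s.prodPrimes.primeFactors, f m ≤ selbergSum s := by
  set T := {m ∈ Icc 1 N | m.primeFactors ⊆ s.prodPrimes.primeFactors} with hTdef
  have hT : ∀ m ∈ T, (1 ≤ m ∧ m ≤ N) ∧ m.primeFactors ⊆ s.prodPrimes.primeFactors := fun m hm => by
    rwa [hTdef, mem_filter, mem_Icc] at hm
  have hradical : ∀ m ∈ T, radical m ∈ sieveModuli s := fun m hm => by
    obtain ⟨⟨hm1, hmN⟩, hprimes⟩ := hT m hm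
    have hle : radical m ≤ N := (Nat.le_of_dvd hm1 radical_dvd_self).trans hmN
    exact mem_sieveModuli.mpr
      ⟨(Nat.radical_dvd_iff prodPrimes_ne_zero).mpr hprimes, le_trans (by gcongr) hN⟩
  rw [← sum_fiberwise_of_maps_to hradical, selbergSum]
  have hT0 : ∀ m ∈ T, m ≠ 0 := fun m hm => Nat.one_le_iff_ne_zero.mp (hT m hm).1.1
  exact sum_le_sum fun l hl => (sum_filter_radical_eq_le hf hf_lt hT0 l).trans
    (mul_prod_inv_one_sub_le_selbergTerms hf hf_le (mem_sieveModuli.mp hl).1)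

theorem sum_filter_dvd_inv_le {A : Finset ℕ} {q : ℕ} (hq : 0 < q)
    (hA : ∀ c, q * c ∈ A → c ∈ A) :
    ∑ n ∈ A with q ∣ n, (n : ℝ)⁻¹ ≤ (q : ℝ)⁻¹ * ∑ n ∈ A, (n : ℝ)⁻¹ := by
  have hsub : {n ∈ A | q ∣ n} ⊆ A.image (q * ·) := by
    intro n hn
    obtain ⟨hnA, c, rfl⟩ := mem_filter.mp hn
    exact mem_image.mpr ⟨c, hA c hnA, rfl⟩
  refine (sum_le_sum_of_subset_of_nonneg hsub fun _ _ _ => by positivity).trans_eq ?_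
  rw [sum_image fun a _ b _ hab => Nat.eq_of_mul_eq_mul_left hq hab, mul_sum]
  exact sum_congr rfl fun c _ => by rw [Nat.cast_mul, mul_inv]

theorem prod_mul_sum_inv_le (S : Finset ℕ) (hS : ∀ p ∈ S, p.Prime) (y : ℕ) :
    (∏ p ∈ S, (1 - (p : ℝ)⁻¹)) * ∑ n ∈ Icc 1 y, (n : ℝ)⁻¹ ≤
      ∑ n ∈ Icc 1 y with ∀ p ∈ S, ¬ p ∣ n, (n : ℝ)⁻¹ := by
  induction S using Finset.induction_on with
  | empty => simp
  | insert q S hq ih =>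
    have hqp : q.Prime := hS q (mem_insert_self _ _)
    have hq_inv : (q : ℝ)⁻¹ ≤ 1 := inv_le_one_of_one_le₀ (by exact_mod_cast hqp.one_le)
    specialize ih fun p hp => hS p (mem_insert_of_mem hp)
    set A := {n ∈ Icc 1 y | ∀ p ∈ S, ¬ p ∣ n} with hA
    have hfilter : {n ∈ Icc 1 y | ∀ p ∈ insert q S, ¬ p ∣ n} = {n ∈ A | ¬ q ∣ n} := by
      ext n
      simp only [hA, mem_filter, mem_insert, forall_eq_or_imp]
      tauto
    have hclosed : ∀ c, q * c ∈ A → c ∈ A := fun c hc => by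
      simp only [hA, mem_filter, mem_Icc] at hc ⊢
      exact ⟨⟨Nat.pos_of_mul_pos_left hc.1.1, (Nat.le_mul_of_pos_left c hqp.pos).trans hc.1.2⟩,
        fun p hp hpc => hc.2 p hp (hpc.mul_left q)⟩
    have hmultiples := sum_filter_dvd_inv_le hqp.pos hclosed
    have hsplit := sum_filter_add_sum_filter_not A (q ∣ ·) fun n => (n : ℝ)⁻¹
    rw [hfilter, prod_insert hq, mul_assoc]
    have hmul := mul_le_mul_of_nonneg_left ih (sub_nonneg.mpr hq_inv)
    linarith

theorem log_add_one_le_sum_Icc_inv (n : ℕ) :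
    Real.log ((n : ℝ) + 1) ≤ ∑ k ∈ Icc 1 n, (k : ℝ)⁻¹ := by
  have hharmonic := log_add_one_le_harmonic n
  rw [harmonic_eq_sum_Icc] at hharmonic
  push_cast at hharmonic
  exact hharmonic

theorem log_le_sum_Icc_inv (n : ℕ) : Real.log n ≤ ∑ k ∈ Icc 1 n, (k : ℝ)⁻¹ := by
  rcases n.eq_zero_or_pos with rfl | hn
  · simp
  · exact (Real.log_le_log (by exact_mod_cast hn) (by linarith)).trans
      (log_add_one_le_sum_Icc_inv n)

theorem sum_Icc_inv_le (n : ℕ) : ∑ k ∈ Icc 1 n, (k : ℝ)⁻¹ ≤ 1 + Real.log n := by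
  have hharmonic := harmonic_le_one_add_log n
  rw [harmonic_eq_sum_Icc] at hharmonic
  push_cast at hharmonic
  exact hharmonic

theorem totient_div_eq_prod {n : ℕ} (hn : n ≠ 0) :
    (n.totient / n : ℝ) = ∏ p ∈ n.primeFactors, (1 - (p : ℝ)⁻¹) := by
  have hprod := congrArg (Rat.cast : ℚ → ℝ) (Nat.totient_eq_mul_prod_factors n)
  push_cast at hprod
  rw [hprod, mul_div_cancel_left₀ _ (by exact_mod_cast hn)]

theorem totient_div_mul_log_le {D : ℕ} (hD : D ≠ 0) (Q : ℕ) :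
    (D.totient / D : ℝ) * Real.log Q ≤ ∑ n ∈ Icc 1 Q with n.Coprime D, (n : ℝ)⁻¹ := by
  have hcoprime : {n ∈ Icc 1 Q | ∀ p ∈ D.primeFactors, ¬ p ∣ n} = {n ∈ Icc 1 Q | n.Coprime D} :=
    filter_congr fun n _ =>
      ⟨fun h => Nat.coprime_of_dvd fun p hp hpn hpD => h p (hp.mem_primeFactors hpD hD) hpn,
        fun h p hp hpn => (Nat.prime_of_mem_primeFactors hp).ne_one
          (Nat.eq_one_of_dvd_coprimes h hpn (Nat.dvd_of_mem_primeFactors hp))⟩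
  calc (D.totient / D : ℝ) * Real.log Q ≤ (D.totient / D : ℝ) * ∑ n ∈ Icc 1 Q, (n : ℝ)⁻¹ := by
        gcongr
        exact log_le_sum_Icc_inv Q
    _ ≤ _ := by
        rw [totient_div_eq_prod hD, ← hcoprime]
        exact prod_mul_sum_inv_le _ (fun p => Nat.prime_of_mem_primeFactors) Q

theorem card_divisors_le_two_pow_cardFactors {n : ℕ} (hn : n ≠ 0) : n.divisors.card ≤ 2 ^ Ω n := by
  rw [Nat.card_divisors hn, ArithmeticFunction.cardFactors_eq_sum_factorization,
    Finsupp.sum, Nat.support_factorization, ← prod_pow_eq_pow_sum]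
  exact prod_le_prod' fun p _ => Nat.lt_two_pow_self

/-- The completely multiplicative function supported on the integers coprime to `D` with the value
`2 / p` at the primes `p ∤ D`. -/
noncomputable def coprimeTwoPowDiv (D : ℕ) : ℕ →* ℝ where
  toFun n := if n.Coprime D then 2 ^ Ω n / n else 0
  map_one' := by simp
  map_mul' a b := by
    rcases eq_or_ne a 0 with rfl | ha
    · simp
    rcases eq_or_ne b 0 with rfl | hb
    · simp
    by_cases haD : a.Coprime D
    · by_cases hbD : b.Coprime D
      · rw [if_pos (Nat.Coprime.mul_left haD hbD), if_pos haD, if_pos hbD,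
          ArithmeticFunction.cardFactors_mul ha hb, pow_add, Nat.cast_mul, mul_div_mul_comm]
      · rw [if_neg (fun h => hbD (Nat.coprime_mul_iff_left.mp h).2), if_neg hbD, mul_zero]
    · rw [if_neg (fun h => haD (Nat.coprime_mul_iff_left.mp h).1), if_neg haD, zero_mul]

theorem coprimeTwoPowDiv_apply (D n : ℕ) :
    coprimeTwoPowDiv D n = if n.Coprime D then 2 ^ Ω n / (n : ℝ) else 0 := rfl

theorem coprimeTwoPowDiv_nonneg (D n : ℕ) : 0 ≤ coprimeTwoPowDiv D n := by
  rw [coprimeTwoPowDiv_apply]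
  split_ifs <;> positivity

theorem coprimeTwoPowDiv_prime_le (D : ℕ) {p : ℕ} (hp : p.Prime) :
    coprimeTwoPowDiv D p ≤ 2 / p := by
  rw [coprimeTwoPowDiv_apply, ArithmeticFunction.cardFactors_apply_prime hp, pow_one]
  split_ifs
  exacts [le_rfl, by positivity]

theorem coprimeTwoPowDiv_prime_lt_one {D : ℕ} (heven : 2 ∣ D) {p : ℕ} (hp : p.Prime) :
    coprimeTwoPowDiv D p < 1 := by
  by_cases hp2 : p = 2
  · rw [coprimeTwoPowDiv_apply, hp2, if_neg fun h => (Nat.prime_two.coprime_iff_not_dvd.mp h) heven]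
    exact one_pos
  · have htwo : 2 < p := lt_of_le_of_ne hp.two_le (Ne.symm hp2)
    refine (coprimeTwoPowDiv_prime_le D hp).trans_lt ?_
    rw [div_lt_one (by exact_mod_cast hp.pos)]
    exact_mod_cast htwo

theorem sq_sum_coprime_inv_le (D Q : ℕ) :
    (∑ n ∈ Icc 1 Q with n.Coprime D, (n : ℝ)⁻¹) ^ 2 ≤
      ∑ m ∈ Icc 1 (Q ^ 2) with m.Coprime D, coprimeTwoPowDiv D m := by
  set A := {n ∈ Icc 1 Q | n.Coprime D} with hA
  have hmaps : ∀ x ∈ A ×ˢ A, x.1 * x.2 ∈ {m ∈ Icc 1 (Q ^ 2) | m.Coprime D} := fun x hx => by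
    simp only [hA, mem_product, mem_filter, mem_Icc] at hx ⊢
    obtain ⟨⟨⟨ha, haQ⟩, haD⟩, ⟨hb, hbQ⟩, hbD⟩ := hx
    exact ⟨⟨Nat.mul_pos ha hb, by rw [sq]; exact Nat.mul_le_mul haQ hbQ⟩, haD.mul_left hbD⟩
  have hfiber : ∀ m ∈ {m ∈ Icc 1 (Q ^ 2) | m.Coprime D},
      ∑ x ∈ A ×ˢ A with x.1 * x.2 = m, (x.1 : ℝ)⁻¹ * (x.2 : ℝ)⁻¹ ≤ coprimeTwoPowDiv D m := by
    intro m hm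
    obtain ⟨hmIcc, hmD⟩ := mem_filter.mp hm
    have hm0 : m ≠ 0 := (Nat.succ_le_iff.mp (mem_Icc.mp hmIcc).1).ne'
    have hcard : #{x ∈ A ×ˢ A | x.1 * x.2 = m} ≤ 2 ^ Ω m := by
      have hsub : {x ∈ A ×ˢ A | x.1 * x.2 = m} ⊆ m.divisorsAntidiagonal := fun x hx =>
        Nat.mem_divisorsAntidiagonal.mpr ⟨(mem_filter.mp hx).2, hm0⟩
      refine (card_le_card hsub).trans ?_
      rw [← Nat.map_div_right_divisors, card_map]
      exact card_divisors_le_two_pow_cardFactors hm0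
    have hterm : ∀ x ∈ {x ∈ A ×ˢ A | x.1 * x.2 = m}, (x.1 : ℝ)⁻¹ * (x.2 : ℝ)⁻¹ = (m : ℝ)⁻¹ :=
      fun x hx => by rw [← mul_inv, ← Nat.cast_mul, (mem_filter.mp hx).2]
    rw [sum_congr rfl hterm, sum_const, nsmul_eq_mul, coprimeTwoPowDiv_apply, if_pos hmD,
      div_eq_mul_inv]
    gcongr
    exact_mod_cast hcard
  calc (∑ n ∈ A, (n : ℝ)⁻¹) ^ 2 = ∑ x ∈ A ×ˢ A, (x.1 : ℝ)⁻¹ * (x.2 : ℝ)⁻¹ := by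
        rw [sq, sum_mul_sum, sum_product]
    _ ≤ _ := by
        rw [← sum_fiberwise_of_maps_to hmaps]
        exact sum_le_sum hfiber

theorem sq_totient_div_mul_log_le_selbergSum {s : SelbergSieve} {D Q : ℕ} (hD : D ≠ 0)
    (heven : 2 ∣ D) (hlevel : (Q : ℝ) ^ 4 ≤ s.level)
    (hprimes : ∀ p, p.Prime → p ≤ Q ^ 2 → ¬ p ∣ D → p ∣ s.prodPrimes)
    (hnu : ∀ p, p.Prime → p ∣ s.prodPrimes → 2 / (p : ℝ) ≤ s.nu p) :
    ((D.totient / D : ℝ) * Real.log Q) ^ 2 ≤ selbergSum s := by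
  have hsub : {m ∈ Icc 1 (Q ^ 2) | m.Coprime D} ⊆
      {m ∈ Icc 1 (Q ^ 2) | m.primeFactors ⊆ s.prodPrimes.primeFactors} := by
    intro m hm
    simp only [mem_filter, mem_Icc] at hm ⊢
    obtain ⟨⟨hm1, hmQ⟩, hmD⟩ := hm
    refine ⟨⟨hm1, hmQ⟩, fun p hp => ?_⟩
    have hprime := Nat.prime_of_mem_primeFactors hp
    have hdvd := Nat.dvd_of_mem_primeFactors hp
    exact hprime.mem_primeFactors (hprimes p hprime ((Nat.le_of_dvd hm1 hdvd).trans hmQ)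
      fun hpD => hprime.ne_one (Nat.eq_one_of_dvd_coprimes hmD hdvd hpD)) prodPrimes_ne_zero
  have : 0 ≤ Real.log Q := Real.log_natCast_nonneg Q
  calc ((D.totient / D : ℝ) * Real.log Q) ^ 2
      ≤ (∑ n ∈ Icc 1 Q with n.Coprime D, (n : ℝ)⁻¹) ^ 2 := by
        gcongr
        exact totient_div_mul_log_le hD Q
    _ ≤ ∑ m ∈ Icc 1 (Q ^ 2) with m.Coprime D, coprimeTwoPowDiv D m := sq_sum_coprime_inv_le D Q
    _ ≤ ∑ m ∈ Icc 1 (Q ^ 2) with m.primeFactors ⊆ s.prodPrimes.primeFactors,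
        coprimeTwoPowDiv D m :=
        sum_le_sum_of_subset_of_nonneg hsub fun m _ _ => coprimeTwoPowDiv_nonneg D m
    _ ≤ selbergSum s :=
        sum_le_selbergSum (coprimeTwoPowDiv_nonneg D)
          (fun p => coprimeTwoPowDiv_prime_lt_one heven)
          (fun p hp hpP => (coprimeTwoPowDiv_prime_le D hp).trans (hnu p hp hpP))
          (by push_cast; rwa [← pow_mul])

end SelbergSumLowerBound

section TotientRatio

open Finset

/-- The ratio `n / φ(n)`: the loss, compared with sieving by all primes, when the prime divisors of
`n` are left out of a sieve. -/
noncomputable def totientRatio (n : ℕ) : ℝ := n / n.totient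

theorem totientRatio_nonneg (n : ℕ) : 0 ≤ totientRatio n := by
  unfold totientRatio
  positivity

theorem totientRatio_mul_le (a b : ℕ) : totientRatio (a * b) ≤ totientRatio a * totientRatio b := by
  rcases a.eq_zero_or_pos with rfl | ha
  · simp [totientRatio]
  rcases b.eq_zero_or_pos with rfl | hb
  · simp [totientRatio]
  have : (0 : ℝ) < a.totient := by exact_mod_cast Nat.totient_pos.mpr ha
  have : (0 : ℝ) < b.totient := by exact_mod_cast Nat.totient_pos.mpr hb
  have hφ : (a.totient * b.totient : ℝ) ≤ (a * b).totient := by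
    exact_mod_cast Nat.totient_super_multiplicative a b
  unfold totientRatio
  rw [div_mul_div_comm, Nat.cast_mul]
  gcongr

theorem totientRatio_eq_prod {n : ℕ} (hn : n ≠ 0) :
    totientRatio n = ∏ p ∈ n.primeFactors, (1 - (p : ℝ)⁻¹)⁻¹ := by
  rw [totientRatio, ← inv_div, totient_div_eq_prod hn, prod_inv_distrib]

theorem prod_primeFactors_one_add (g : ℕ → ℝ) {n : ℕ} (hn : n ≠ 0) :
    ∏ p ∈ n.primeFactors, (1 + g p) =
      ∑ e ∈ n.divisors with Squarefree e, ∏ p ∈ e.primeFactors, g p := by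
  have hprime : ∀ t ∈ n.primeFactors.powerset, ∀ p ∈ t, p.Prime := fun t ht p hp =>
    Nat.prime_of_mem_primeFactors (mem_powerset.mp ht hp)
  rw [prod_one_add]
  refine sum_nbij' (fun t => ∏ p ∈ t, p) (fun e => e.primeFactors) (fun t ht => ?_) (fun e he => ?_)
    (fun t ht => Nat.primeFactors_prod (hprime t ht))
    (fun e he => Nat.prod_primeFactors_of_squarefree (mem_filter.mp he).2) fun t ht => ?_
  · refine mem_filter.mpr ⟨Nat.mem_divisors.mpr ⟨?_, hn⟩, ?_⟩
    · exact (prod_dvd_prod_of_subset _ _ (fun p : ℕ => p) (mem_powerset.mp ht)).trans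
        (Nat.prod_primeFactors_dvd n)
    · refine squarefree_prod_of_pairwise_isCoprime (fun p hp q hq hpq => ?_)
        fun p hp => (hprime t ht p hp).prime.squarefree
      exact Nat.coprime_iff_isRelPrime.mp
        ((Nat.coprime_primes (hprime t ht p hp) (hprime t ht q hq)).mpr hpq)
  · exact mem_powerset.mpr (Nat.primeFactors_mono (Nat.dvd_of_mem_divisors (mem_filter.mp he).1) hn)
  · rw [Nat.primeFactors_prod (hprime t ht)]

theorem prod_rpow_primeFactors {e : ℕ} (he : Squarefree e) (s : ℝ) :
    ∏ p ∈ e.primeFactors, (p : ℝ) ^ s = (e : ℝ) ^ s := by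
  rw [Real.finsetProd_rpow _ _ fun p _ => Nat.cast_nonneg p, ← Nat.cast_prod,
    Nat.prod_primeFactors_of_squarefree he]

theorem prod_one_add_rpow_primeFactors_le (s : ℝ) {n : ℕ} (hn : n ≠ 0) :
    ∏ p ∈ n.primeFactors, (1 + (p : ℝ) ^ s) ≤ ∑ e ∈ n.divisors, (e : ℝ) ^ s := by
  rw [prod_primeFactors_one_add (fun p => (p : ℝ) ^ s) hn,
    sum_congr rfl fun e he => prod_rpow_primeFactors (mem_filter.mp he).2 s]
  exact sum_le_sum_of_subset_of_nonneg (filter_subset _ _) fun _ _ _ => by positivity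

theorem inv_one_sub_inv_pow_le {m p : ℕ} (hp : p.Prime) (hmp : 4 * m ^ 2 ≤ p) :
    ((1 - (p : ℝ)⁻¹)⁻¹) ^ m ≤ 1 + (p : ℝ) ^ (-(1 / 2) : ℝ) := by
  have hp2 : (2 : ℝ) ≤ p := by exact_mod_cast hp.two_le
  have hp0 : (0 : ℝ) < p := by linarith
  have hinv : (p : ℝ)⁻¹ ≤ 2⁻¹ := inv_anti₀ two_pos hp2
  set r := (p : ℝ) ^ (-(1 / 2) : ℝ)
  have hr : 0 < r := by positivity
  have hrr : r * r = (p : ℝ)⁻¹ := by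
    rw [← Real.rpow_add hp0, ← Real.rpow_neg_one]
    norm_num
  have hmr : m * r ≤ 1 / 2 := by
    have hmp' : (4 * m ^ 2 : ℝ) * (p : ℝ)⁻¹ ≤ 1 := by
      rw [← div_eq_mul_inv, div_le_one hp0]
      exact_mod_cast hmp
    nlinarith
  have hr1 : r ≤ 1 := by nlinarith
  have hbernoulli : 1 - m * (p : ℝ)⁻¹ ≤ (1 - (p : ℝ)⁻¹) ^ m := by
    have := one_add_mul_le_pow (by linarith : (-2 : ℝ) ≤ -(p : ℝ)⁻¹) m
    rw [← sub_eq_add_neg] at this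
    linarith
  have hpow : 0 < (1 - (p : ℝ)⁻¹) ^ m := pow_pos (by linarith) m
  rw [inv_pow, inv_le_iff_one_le_mul₀ hpow]
  calc 1 ≤ (1 + r) * (1 - m * (r * r)) := by nlinarith [mul_le_mul_of_nonneg_left hmr hr.le]
    _ ≤ _ := by
        rw [hrr]
        gcongr

theorem exists_totientRatio_pow_le (m : ℕ) :
    ∃ C : ℝ, 0 < C ∧ ∀ n : ℕ, n ≠ 0 →
      totientRatio n ^ m ≤ C * ∑ e ∈ n.divisors, (e : ℝ) ^ (-(1 / 2) : ℝ) := by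
  have hfactor : ∀ p : ℕ, p.Prime → 0 ≤ (1 - (p : ℝ)⁻¹)⁻¹ ∧ ((1 - (p : ℝ)⁻¹)⁻¹) ^ m ≤
      (if p < 4 * m ^ 2 then 2 ^ m else 1) * (1 + (p : ℝ) ^ (-(1 / 2) : ℝ)) := by
    intro p hp
    have hinv : (p : ℝ)⁻¹ ≤ 2⁻¹ := inv_anti₀ two_pos (by exact_mod_cast hp.two_le)
    have hnonneg : 0 ≤ (1 - (p : ℝ)⁻¹)⁻¹ := inv_nonneg.mpr (by linarith)
    refine ⟨hnonneg, ?_⟩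
    split_ifs with hsmall
    · have hle : (1 - (p : ℝ)⁻¹)⁻¹ ≤ 2 := by
        rw [inv_le_comm₀ (by linarith) two_pos]
        linarith
      exact (pow_le_pow_left₀ hnonneg hle m).trans
        (le_mul_of_one_le_right (by positivity) (le_add_of_nonneg_right (by positivity)))
    · rw [one_mul]
      exact inv_one_sub_inv_pow_le hp (not_lt.mp hsmall)
  refine ⟨(2 ^ m) ^ (4 * m ^ 2), by positivity, fun n hn => ?_⟩
  have hcard : #{p ∈ n.primeFactors | p < 4 * m ^ 2} ≤ 4 * m ^ 2 := by
    have hsub : {p ∈ n.primeFactors | p < 4 * m ^ 2} ⊆ range (4 * m ^ 2) := fun p hp =>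
      mem_range.mpr (mem_filter.mp hp).2
    simpa only [card_range] using card_le_card hsub
  calc totientRatio n ^ m = ∏ p ∈ n.primeFactors, ((1 - (p : ℝ)⁻¹)⁻¹) ^ m := by
        rw [totientRatio_eq_prod hn, prod_pow]
    _ ≤ ∏ p ∈ n.primeFactors,
          (if p < 4 * m ^ 2 then 2 ^ m else 1) * (1 + (p : ℝ) ^ (-(1 / 2) : ℝ)) :=
        prod_le_prod
          (fun p hp => pow_nonneg (hfactor p (Nat.prime_of_mem_primeFactors hp)).1 m)
          fun p hp => (hfactor p (Nat.prime_of_mem_primeFactors hp)).2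
    _ = (2 ^ m) ^ #{p ∈ n.primeFactors | p < 4 * m ^ 2} *
          ∏ p ∈ n.primeFactors, (1 + (p : ℝ) ^ (-(1 / 2) : ℝ)) := by
        rw [prod_mul_distrib, prod_ite, prod_const, prod_const_one, mul_one]
    _ ≤ (2 ^ m) ^ (4 * m ^ 2) * ∑ e ∈ n.divisors, (e : ℝ) ^ (-(1 / 2) : ℝ) := by
        gcongr
        · exact one_le_pow₀ one_le_two
        · exact prod_one_add_rpow_primeFactors_le _ hn

theorem sum_sum_divisors_mul_inv (f : ℕ → ℝ) (K : ℕ) :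
    ∑ n ∈ Icc 1 K, (∑ e ∈ n.divisors, f e) * (n : ℝ)⁻¹ =
      ∑ e ∈ Icc 1 K, f e * (e : ℝ)⁻¹ * ∑ m ∈ Icc 1 (K / e), (m : ℝ)⁻¹ := by
  let F : ArithmeticFunction ℝ := ⟨fun e => f e * (e : ℝ)⁻¹, by simp⟩
  let G : ArithmeticFunction ℝ := ⟨fun m => (m : ℝ)⁻¹, by simp⟩
  have hFG : ∀ n : ℕ, (∑ e ∈ n.divisors, f e) * (n : ℝ)⁻¹ = (F * G) n := fun n => by
    rw [ArithmeticFunction.mul_apply, ← Nat.sum_divisorsAntidiagonal (fun e _ => f e), sum_mul]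
    refine sum_congr rfl fun x hx => ?_
    rw [← (Nat.mem_divisorsAntidiagonal.mp hx).1, Nat.cast_mul, mul_inv, ← mul_assoc]
    rfl
  simp only [hFG]
  exact ArithmeticFunction.sum_Ioc_mul_eq_sum_sum F G K

theorem sum_sum_divisors_mul_inv_le {f : ℕ → ℝ} (hf : ∀ n, 0 ≤ f n) (K : ℕ) :
    ∑ n ∈ Icc 1 K, (∑ e ∈ n.divisors, f e) * (n : ℝ)⁻¹ ≤
      (∑ e ∈ Icc 1 K, f e * (e : ℝ)⁻¹) * ∑ n ∈ Icc 1 K, (n : ℝ)⁻¹ := by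
  rw [sum_sum_divisors_mul_inv, sum_mul]
  gcongr with e
  · exact mul_nonneg (hf e) (by positivity)
  · exact Nat.div_le_self _ _

theorem exists_sum_totientRatio_pow_mul_inv_le (m : ℕ) :
    ∃ C : ℝ, 0 < C ∧ ∀ K : ℕ,
      ∑ n ∈ Icc 1 K, totientRatio n ^ m * (n : ℝ)⁻¹ ≤ C * ∑ n ∈ Icc 1 K, (n : ℝ)⁻¹ := by
  obtain ⟨C, hC, hpow⟩ := exists_totientRatio_pow_le m
  have hsummable : Summable fun e : ℕ => (e : ℝ) ^ (-(3 / 2) : ℝ) :=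
    Real.summable_nat_rpow.mpr (by norm_num)
  have hexponent : ∀ e : ℕ, 1 ≤ e →
      (e : ℝ) ^ (-(1 / 2) : ℝ) * (e : ℝ)⁻¹ = (e : ℝ) ^ (-(3 / 2) : ℝ) := by
    intro e he
    have he0 : (0 : ℝ) < e := by exact_mod_cast he
    rw [← Real.rpow_neg_one, ← Real.rpow_add he0]
    norm_num
  refine ⟨C * (∑' e : ℕ, (e : ℝ) ^ (-(3 / 2) : ℝ) + 1),
    mul_pos hC (add_pos_of_nonneg_of_pos (tsum_nonneg fun _ => by positivity) one_pos),
    fun K => ?_⟩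
  calc ∑ n ∈ Icc 1 K, totientRatio n ^ m * (n : ℝ)⁻¹
      ≤ ∑ n ∈ Icc 1 K, C * ((∑ e ∈ n.divisors, (e : ℝ) ^ (-(1 / 2) : ℝ)) * (n : ℝ)⁻¹) := by
        refine sum_le_sum fun n hn => ?_
        rw [← mul_assoc]
        gcongr
        exact hpow n (Nat.one_le_iff_ne_zero.mp (mem_Icc.mp hn).1)
    _ ≤ C * ((∑ e ∈ Icc 1 K, (e : ℝ) ^ (-(1 / 2) : ℝ) * (e : ℝ)⁻¹) *
          ∑ n ∈ Icc 1 K, (n : ℝ)⁻¹) := by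
        rw [← mul_sum]
        gcongr
        exact sum_sum_divisors_mul_inv_le (fun n => by positivity) K
    _ ≤ C * ((∑' e : ℕ, (e : ℝ) ^ (-(3 / 2) : ℝ) + 1) * ∑ n ∈ Icc 1 K, (n : ℝ)⁻¹) := by
        rw [sum_congr rfl fun e he => hexponent e (mem_Icc.mp he).1]
        gcongr
        linarith [hsummable.sum_le_tsum (Icc 1 K) fun _ _ => by positivity]
    _ = _ := by ring

theorem sum_sum_mul_sub_le {a b : ℕ → ℝ} (ha : ∀ n, 0 ≤ a n) (hb : ∀ n, 0 ≤ b n) (K : ℕ) :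
    ∑ l ∈ Icc 1 K, ∑ k ∈ Ico 1 l, a k * b (l - k) ≤
      (∑ n ∈ Icc 1 K, a n) * ∑ n ∈ Icc 1 K, b n := by
  have hswap : ∀ l k : ℕ, l ∈ Icc 1 K ∧ k ∈ Ico 1 l ↔ l ∈ Ioc k K ∧ k ∈ Icc 1 K := by
    intro l k
    simp only [mem_Icc, mem_Ico, mem_Ioc]
    omega
  rw [sum_comm' hswap, sum_mul]
  refine sum_le_sum fun k _ => ?_
  rw [← mul_sum]
  refine mul_le_mul_of_nonneg_left ?_ (ha k)
  have hinj : Set.InjOn (· - k) (Ioc k K : Set ℕ) := fun x hx y hy (hxy : x - k = y - k) => by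
    have := (Finset.mem_Ioc.mp hx).1
    have := (Finset.mem_Ioc.mp hy).1
    omega
  rw [← sum_image (f := b) hinj]
  refine sum_le_sum_of_subset_of_nonneg (image_subset_iff.mpr fun l hl => ?_) fun n _ _ => hb n
  rw [mem_Ioc] at hl
  rw [mem_Icc]
  omega

theorem mul_mul_le_add_pow_three {a b c : ℝ} (ha : 0 ≤ a) (hb : 0 ≤ b) (hc : 0 ≤ c) :
    a * b * c ≤ a ^ 3 + b ^ 3 + c ^ 3 := by
  have hamgm : 0 ≤ (a + b + c) * ((a - b) ^ 2 + (b - c) ^ 2 + (c - a) ^ 2) := by positivity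
  nlinarith [mul_nonneg (mul_nonneg ha hb) hc]

theorem sq_totientRatio_mul_mul_le (k l m : ℕ) :
    totientRatio (k * l * m) ^ 2 ≤
      totientRatio k ^ 6 + totientRatio l ^ 6 + totientRatio m ^ 6 := by
  have := totientRatio_nonneg k
  have := totientRatio_nonneg l
  have hm := totientRatio_nonneg m
  have hmul : totientRatio (k * l * m) ≤ totientRatio k * totientRatio l * totientRatio m :=
    (totientRatio_mul_le _ _).trans (by gcongr; exact totientRatio_mul_le k l)
  calc totientRatio (k * l * m) ^ 2 ≤ (totientRatio k * totientRatio l * totientRatio m) ^ 2 :=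
        pow_le_pow_left₀ (totientRatio_nonneg _) hmul 2
    _ = totientRatio k ^ 2 * totientRatio l ^ 2 * totientRatio m ^ 2 := by ring
    _ ≤ (totientRatio k ^ 2) ^ 3 + (totientRatio l ^ 2) ^ 3 + (totientRatio m ^ 2) ^ 3 :=
        mul_mul_le_add_pow_three (by positivity) (by positivity) (by positivity)
    _ = _ := by ring

theorem sum_sum_mul_le {a b : ℕ → ℝ} (ha : ∀ n, 0 ≤ a n) (hb : ∀ n, 0 ≤ b n) (K : ℕ) :
    ∑ l ∈ Icc 1 K, ∑ k ∈ Ico 1 l, a k * b l ≤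
      (∑ n ∈ Icc 1 K, a n) * ∑ n ∈ Icc 1 K, b n := by
  rw [sum_mul_sum, sum_comm]
  refine sum_le_sum fun l hl => sum_le_sum_of_subset_of_nonneg (fun k hk => ?_)
    fun k _ _ => mul_nonneg (ha k) (hb l)
  rw [mem_Icc] at hl ⊢
  rw [mem_Ico] at hk
  omega

theorem exists_sum_sq_totientRatio_pairs_le :
    ∃ C : ℝ, 0 < C ∧ ∀ K : ℕ,
      ∑ l ∈ Icc 1 K, ∑ k ∈ Ico 1 l,
          (k : ℝ)⁻¹ * (l : ℝ)⁻¹ * totientRatio (k * l * (l - k)) ^ 2 ≤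
        C * (∑ n ∈ Icc 1 K, (n : ℝ)⁻¹) ^ 2 := by
  obtain ⟨C, hC, hmoment⟩ := exists_sum_totientRatio_pow_mul_inv_le 6
  refine ⟨3 * C, by positivity, fun K => ?_⟩
  set a : ℕ → ℝ := fun n => (n : ℝ)⁻¹
  set b : ℕ → ℝ := fun n => totientRatio n ^ 6 * (n : ℝ)⁻¹
  have ha : ∀ n, 0 ≤ a n := fun n => inv_nonneg.mpr n.cast_nonneg
  have hb : ∀ n, 0 ≤ b n := fun n =>
    mul_nonneg (pow_nonneg (totientRatio_nonneg n) 6) (ha n)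
  have hterm : ∀ l, ∀ k ∈ Ico 1 l, a k * a l * totientRatio (k * l * (l - k)) ^ 2 ≤
      b k * a l + a k * b l + a k * b (l - k) := by
    intro l k hk
    have hkl := (mem_Ico.mp hk).2
    have hanti : a l ≤ a (l - k) :=
      inv_anti₀ (by exact_mod_cast Nat.sub_pos_of_lt hkl) (by exact_mod_cast Nat.sub_le l k)
    calc a k * a l * totientRatio (k * l * (l - k)) ^ 2
        ≤ a k * a l * (totientRatio k ^ 6 + totientRatio l ^ 6 + totientRatio (l - k) ^ 6) :=
          mul_le_mul_of_nonneg_left (sq_totientRatio_mul_mul_le k l (l - k))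
            (mul_nonneg (ha k) (ha l))
      _ = b k * a l + a k * b l + a k * (totientRatio (l - k) ^ 6 * a l) := by ring
      _ ≤ b k * a l + a k * b l + a k * (totientRatio (l - k) ^ 6 * a (l - k)) := by
          have := ha k
          have := totientRatio_nonneg (l - k)
          gcongr
  calc _ ≤ ∑ l ∈ Icc 1 K, ∑ k ∈ Ico 1 l, (b k * a l + a k * b l + a k * b (l - k)) :=
        sum_le_sum fun l _ => sum_le_sum (hterm l)
    _ = ∑ l ∈ Icc 1 K, ∑ k ∈ Ico 1 l, b k * a l + ∑ l ∈ Icc 1 K, ∑ k ∈ Ico 1 l, a k * b l +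
          ∑ l ∈ Icc 1 K, ∑ k ∈ Ico 1 l, a k * b (l - k) := by simp only [sum_add_distrib]
    _ ≤ 3 * (∑ n ∈ Icc 1 K, b n) * ∑ n ∈ Icc 1 K, a n := by
        linarith [sum_sum_mul_le hb ha K, sum_sum_mul_le ha hb K, sum_sum_mul_sub_le ha hb K]
    _ ≤ 3 * (C * ∑ n ∈ Icc 1 K, a n) * ∑ n ∈ Icc 1 K, a n := by
        have := sum_nonneg fun n (_ : n ∈ Icc 1 K) => ha n
        gcongr
        exact hmoment K
    _ = _ := by ring

end TotientRatio

section LinearFormsSieve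

open Finset BoundingSieve

/-- The density `τ(n) / n` of the solutions of `(k * d + 1) * (l * d + 1) ≡ 0` modulo a squarefree
`n` coprime to `k * l * (l - k)`. -/
noncomputable def divisorDensity : ArithmeticFunction ℝ :=
  ⟨fun n => (n.divisors.card : ℝ) / n, by simp⟩

theorem divisorDensity_apply (n : ℕ) : divisorDensity n = (n.divisors.card : ℝ) / n := rfl

theorem divisorDensity_prime {p : ℕ} (hp : p.Prime) : divisorDensity p = 2 / p := by
  rw [divisorDensity_apply, hp.divisors, card_pair hp.ne_one.symm, Nat.cast_two]

theorem divisorDensity_isMultiplicative : divisorDensity.IsMultiplicative := by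
  refine ArithmeticFunction.IsMultiplicative.iff_ne_zero.mpr
    ⟨by simp [divisorDensity_apply], fun _ _ hcop => ?_⟩
  rw [divisorDensity_apply, divisorDensity_apply, divisorDensity_apply, hcop.card_divisors_mul,
    Nat.cast_mul, Nat.cast_mul, mul_div_mul_comm]

theorem inv_divisorDensity_le {n : ℕ} (hn : n ≠ 0) : (divisorDensity n)⁻¹ ≤ n := by
  have hcard : (1 : ℝ) ≤ n.divisors.card := by
    exact_mod_cast card_pos.mpr ⟨1, Nat.one_mem_divisors.mpr hn⟩
  rw [divisorDensity_apply, inv_div]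
  exact div_le_self n.cast_nonneg hcard

/-- The product of the primes up to `R` that do not divide `D`. -/
def primeProductAvoiding (D R : ℕ) : ℕ := ∏ p ∈ Icc 1 R with p.Prime ∧ ¬ p ∣ D, p

theorem squarefree_primeProductAvoiding (D R : ℕ) : Squarefree (primeProductAvoiding D R) := by
  refine squarefree_prod_of_pairwise_isCoprime (fun p hp q hq hpq => ?_) fun p hp => ?_
  · exact Nat.coprime_iff_isRelPrime.mp
      ((Nat.coprime_primes (mem_filter.mp hp).2.1 (mem_filter.mp hq).2.1).mpr hpq)
  · exact (mem_filter.mp hp).2.1.prime.squarefree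

theorem prime_dvd_primeProductAvoiding {D R p : ℕ} (hp : p.Prime) :
    p ∣ primeProductAvoiding D R ↔ p ≤ R ∧ ¬ p ∣ D := by
  rw [primeProductAvoiding, hp.prime.dvd_finsetProd_iff]
  constructor
  · rintro ⟨q, hq, hpq⟩
    rw [mem_filter, mem_Icc] at hq
    rw [(Nat.prime_dvd_prime_iff_eq hp hq.2.1).mp hpq]
    exact ⟨hq.1.2, hq.2.2⟩
  · rintro ⟨hpR, hpD⟩
    exact ⟨p, mem_filter.mpr ⟨mem_Icc.mpr ⟨hp.one_le, hpR⟩, hp, hpD⟩, dvd_rfl⟩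

theorem coprime_of_dvd_primeProductAvoiding {D R m a : ℕ} (hm : m ∣ primeProductAvoiding D R)
    (ha : a ∣ D) : a.Coprime m :=
  Nat.coprime_of_dvd fun _ hp hpa hpm =>
    ((prime_dvd_primeProductAvoiding hp).mp (hpm.trans hm)).2 (hpa.trans ha)

theorem two_dvd_mul_mul_sub (k l : ℕ) : 2 ∣ k * l * (l - k) := by
  rcases Nat.even_or_odd k with hk | hk
  · exact (hk.two_dvd.mul_right l).mul_right _
  rcases Nat.even_or_odd l with hl | hl
  · exact (hl.two_dvd.mul_left k).mul_right _
  · exact (Nat.Odd.sub_odd hl hk).two_dvd.mul_left _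

theorem linearForms_injective {k : ℕ} (hk : 0 < k) (l : ℕ) :
    Function.Injective fun d : ℕ => (d * k + 1) * (d * l + 1) := by
  refine StrictMono.injective fun a b hab => ?_
  have hfirst : a * k + 1 < b * k + 1 := by gcongr
  have hsecond : a * l + 1 ≤ b * l + 1 := by gcongr
  exact Nat.mul_lt_mul_of_lt_of_le hfirst hsecond (Nat.succ_pos _)

theorem abs_card_Ico_modEq_sub_le (M N c : ℕ) {m : ℕ} (hm : 0 < m) :
    |((#{d ∈ Ico M (M + N) | d ≡ c [MOD m]} : ℕ) : ℝ) - N / m| ≤ 1 := by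
  have hcard := Nat.Ico_filter_modEq_card M (M + N) hm c
  set n := #{d ∈ Ico M (M + N) | d ≡ c [MOD m]}
  have hrat : |(n : ℚ) - N / m| ≤ 1 := by
    have hn : (n : ℚ) = max ((⌈(((M + N : ℕ) : ℚ) - c) / m⌉ : ℚ) - ⌈((M : ℚ) - c) / m⌉) 0 := by
      exact_mod_cast hcard
    have hend : (((M + N : ℕ) : ℚ) - c) / m = ((M : ℚ) - c) / m + N / m := by
      push_cast
      ring
    have hnonneg : (0 : ℚ) ≤ N / m := by positivity
    have hlower := Int.le_ceil ((((M + N : ℕ) : ℚ) - c) / m)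
    have hupper := Int.ceil_lt_add_one ((((M + N : ℕ) : ℚ) - c) / m)
    have hlower' := Int.le_ceil (((M : ℚ) - c) / m)
    have hupper' := Int.ceil_lt_add_one (((M : ℚ) - c) / m)
    rw [hn, abs_le]
    constructor
    · linarith [le_max_left ((⌈(((M + N : ℕ) : ℚ) - c) / m⌉ : ℚ) - ⌈((M : ℚ) - c) / m⌉) 0]
    · have hmax : max ((⌈(((M + N : ℕ) : ℚ) - c) / m⌉ : ℚ) - ⌈((M : ℚ) - c) / m⌉) 0 ≤ N / m + 1 :=
        max_le (by linarith) (by linarith)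
      linarith
  have hreal := (Rat.cast_le (K := ℝ)).mpr hrat
  push_cast at hreal
  exact hreal

theorem exists_dvd_mul_add_one_iff {k u : ℕ} (hu : 0 < u) (h : k.Coprime u) :
    ∃ c : ℕ, ∀ d : ℕ, u ∣ d * k + 1 ↔ d ≡ c [MOD u] := by
  have : NeZero u := ⟨hu.ne'⟩
  have hk := ZMod.coe_mul_inv_eq_one k h
  refine ⟨(-(k : ZMod u)⁻¹).val, fun d => ?_⟩
  rw [← ZMod.natCast_eq_zero_iff, ← ZMod.natCast_eq_natCast_iff, ZMod.natCast_zmod_val]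
  push_cast
  constructor
  · intro hd
    linear_combination (k : ZMod u)⁻¹ * hd - (d : ZMod u) * hk
  · intro hd
    linear_combination (k : ZMod u) * hd - hk

theorem abs_card_linearForms_sub_le (M N : ℕ) {k l u v : ℕ} (hu : 0 < u) (hv : 0 < v)
    (huv : u.Coprime v) (hk : k.Coprime u) (hl : l.Coprime v) :
    |((#{d ∈ Ico M (M + N) | u ∣ d * k + 1 ∧ v ∣ d * l + 1} : ℕ) : ℝ) - N / (u * v : ℕ)| ≤ 1 := by
  obtain ⟨a, ha⟩ := exists_dvd_mul_add_one_iff hu hk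
  obtain ⟨b, hb⟩ := exists_dvd_mul_add_one_iff hv hl
  obtain ⟨c, hca, hcb⟩ := Nat.chineseRemainder huv a b
  have hfilter : {d ∈ Ico M (M + N) | u ∣ d * k + 1 ∧ v ∣ d * l + 1} =
      {d ∈ Ico M (M + N) | d ≡ c [MOD u * v]} := by
    refine filter_congr fun d _ => ?_
    rw [ha, hb, ← Nat.modEq_and_modEq_iff_modEq_mul huv]
    exact ⟨fun h => ⟨h.1.trans hca.symm, h.2.trans hcb.symm⟩,
      fun h => ⟨h.1.trans hca, h.2.trans hcb⟩⟩
  rw [hfilter]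
  exact abs_card_Ico_modEq_sub_le M N c (Nat.mul_pos hu hv)

theorem card_divisors_filter_dvd_and_div_dvd {m x y : ℕ} (hm : 0 < m)
    (hxy : (m.gcd x).Coprime y) :
    #{u ∈ m.divisors | u ∣ x ∧ m / u ∣ y} = if m ∣ x * y then 1 else 0 := by
  split_ifs with hdvd
  · have hgcd : 0 < m.gcd x := Nat.gcd_pos_of_pos_left x hm
    rw [card_eq_one]
    refine ⟨m.gcd x, eq_singleton_iff_unique_mem.mpr ⟨?_, fun u hu => ?_⟩⟩
    · have hquot : m / m.gcd x ∣ (x / m.gcd x) * y := by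
        rw [Nat.div_mul_right_comm (Nat.gcd_dvd_right m x)]
        exact Nat.div_dvd_div (Nat.gcd_dvd_left m x) hdvd
      exact mem_filter.mpr ⟨Nat.mem_divisors.mpr ⟨Nat.gcd_dvd_left m x, hm.ne'⟩,
        Nat.gcd_dvd_right m x, (Nat.coprime_div_gcd_div_gcd hgcd).dvd_of_dvd_mul_left hquot⟩
    · obtain ⟨hum, hux, huy⟩ := mem_filter.mp hu
      have hum := Nat.dvd_of_mem_divisors hum
      have hgcd_dvd : m.gcd x ∣ u * (m / u) := by
        rw [Nat.mul_div_cancel' hum]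
        exact Nat.gcd_dvd_left m x
      exact Nat.dvd_antisymm (Nat.dvd_gcd hum hux)
        ((hxy.coprime_dvd_right huy).dvd_of_dvd_mul_right hgcd_dvd)
  · refine card_eq_zero.mpr (filter_eq_empty_iff.mpr fun u hu ⟨hux, huy⟩ => hdvd ?_)
    rw [← Nat.mul_div_cancel' (Nat.dvd_of_mem_divisors hu)]
    exact mul_dvd_mul hux huy

variable {k l M N Q : ℕ}

/-- The Selberg sieve for the products `(d * k + 1) * (d * l + 1)` with `M ≤ d < M + N`, sifted by
the primes up to `Q ^ 2` that do not divide `k * l * (l - k)`; the level `Q ^ 4` makes the sieve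
moduli run up to `Q ^ 2`. -/
noncomputable def linearFormsSieve (k l M N : ℕ) (hQ : 1 ≤ Q) : SelbergSieve where
  support := (Ico M (M + N)).image fun d => (d * k + 1) * (d * l + 1)
  prodPrimes := primeProductAvoiding (k * l * (l - k)) (Q ^ 2)
  prodPrimes_squarefree := squarefree_primeProductAvoiding _ _
  weights := 1
  weights_nonneg := fun _ => zero_le_one
  totalMass := N
  nu := divisorDensity
  nu_mult := divisorDensity_isMultiplicative
  nu_pos_of_prime := fun p hp _ => by
    rw [divisorDensity_prime hp]
    have := hp.pos
    positivity
  nu_lt_one_of_prime := fun p hp hdvd => by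
    have hne : 2 ≠ p := by
      rintro rfl
      exact ((prime_dvd_primeProductAvoiding hp).mp hdvd).2 (two_dvd_mul_mul_sub k l)
    rw [divisorDensity_prime hp, div_lt_one (by exact_mod_cast hp.pos)]
    exact_mod_cast lt_of_le_of_ne hp.two_le hne
  level := (Q : ℝ) ^ 4
  one_le_level := one_le_pow₀ (by exact_mod_cast hQ)

theorem gcd_coprime_of_dvd_primeProductAvoiding {m R : ℕ}
    (hm : m ∣ primeProductAvoiding (k * l * (l - k)) R) (d : ℕ) :
    (m.gcd (d * k + 1)).Coprime (d * l + 1) := by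
  refine Nat.coprime_of_dvd fun p hp hpgcd hpl => ?_
  have hpk : p ∣ d * k + 1 := hpgcd.trans (Nat.gcd_dvd_right _ _)
  have hpm : p ∣ m := hpgcd.trans (Nat.gcd_dvd_left _ _)
  have hdiff : l * (d * k + 1) - k * (d * l + 1) = l - k := by
    rw [show l * (d * k + 1) = k * (d * l) + l by ring,
      show k * (d * l + 1) = k * (d * l) + k by ring, Nat.add_sub_add_left]
  have hp_dvd : p ∣ l - k := hdiff ▸ Nat.dvd_sub (hpk.mul_left l) (hpl.mul_left k)
  exact ((prime_dvd_primeProductAvoiding hp).mp (hpm.trans hm)).2 (hp_dvd.mul_left _)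

theorem multSum_linearFormsSieve (hQ : 1 ≤ Q) (hk : 0 < k) {m : ℕ}
    (hm : m ∣ (linearFormsSieve k l M N hQ).prodPrimes) :
    (linearFormsSieve k l M N hQ).multSum m =
      ∑ u ∈ m.divisors, ((#{d ∈ Ico M (M + N) | u ∣ d * k + 1 ∧ m / u ∣ d * l + 1} : ℕ) : ℝ) := by
  have hm0 : 0 < m := Nat.pos_of_ne_zero (squarefree_of_dvd_prodPrimes hm).ne_zero
  have hcount : ∀ d ∈ Ico M (M + N), (if m ∣ (d * k + 1) * (d * l + 1) then (1 : ℝ) else 0) =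
      ∑ u ∈ m.divisors, if u ∣ d * k + 1 ∧ m / u ∣ d * l + 1 then (1 : ℝ) else 0 := fun d _ => by
    rw [sum_boole, card_divisors_filter_dvd_and_div_dvd hm0
      (gcd_coprime_of_dvd_primeProductAvoiding hm d), Nat.cast_ite, Nat.cast_one, Nat.cast_zero]
  simp only [multSum, linearFormsSieve, Pi.one_apply]
  rw [sum_image fun a _ b _ hab => linearForms_injective hk l hab, sum_congr rfl hcount, sum_comm]
  exact sum_congr rfl fun u _ => sum_boole _ _

theorem abs_rem_linearFormsSieve_le (hQ : 1 ≤ Q) (hk : 0 < k) {m : ℕ}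
    (hm : m ∣ (linearFormsSieve k l M N hQ).prodPrimes) :
    |(linearFormsSieve k l M N hQ).rem m| ≤ m := by
  have hsq := squarefree_of_dvd_prodPrimes hm
  have hm0 : 0 < m := Nat.pos_of_ne_zero hsq.ne_zero
  have hmain : (linearFormsSieve k l M N hQ).nu m * (linearFormsSieve k l M N hQ).totalMass =
      ∑ _u ∈ m.divisors, (N : ℝ) / m := by
    simp only [linearFormsSieve, divisorDensity_apply, sum_const, nsmul_eq_mul]
    ring
  have hterm : ∀ u ∈ m.divisors,
      |((#{d ∈ Ico M (M + N) | u ∣ d * k + 1 ∧ m / u ∣ d * l + 1} : ℕ) : ℝ) - N / m| ≤ 1 := by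
    intro u hu
    have hum := Nat.dvd_of_mem_divisors hu
    have hu0 := Nat.pos_of_dvd_of_pos hum hm0
    have hprod : u * (m / u) = m := Nat.mul_div_cancel' hum
    have hcount := abs_card_linearForms_sub_le M N hu0 (Nat.div_pos (Nat.le_of_dvd hm0 hum) hu0)
      (Nat.coprime_of_squarefree_mul (hprod.symm ▸ hsq))
      (coprime_of_dvd_primeProductAvoiding (hum.trans hm) ((dvd_mul_right k l).mul_right (l - k)))
      (coprime_of_dvd_primeProductAvoiding ((Nat.div_dvd_of_dvd hum).trans hm)
        ((dvd_mul_left l k).mul_right (l - k)))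
    rwa [hprod] at hcount
  rw [rem, multSum_linearFormsSieve hQ hk hm, hmain, ← sum_sub_distrib]
  calc _ ≤ ∑ _u ∈ m.divisors, (1 : ℝ) := (abs_sum_le_sum_abs _ _).trans (sum_le_sum hterm)
    _ = m.divisors.card := by rw [sum_const, nsmul_eq_mul, mul_one]
    _ ≤ m := by exact_mod_cast Nat.card_divisors_le_self m

theorem le_sq_of_mem_sieveModuli_linearFormsSieve (hQ : 1 ≤ Q) {d : ℕ}
    (hd : d ∈ sieveModuli (linearFormsSieve k l M N hQ)) : d ≤ Q ^ 2 := by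
  have hlevel : (d : ℝ) ^ 2 ≤ (Q : ℝ) ^ 4 := (mem_sieveModuli.mp hd).2
  have hsq : d ^ 2 ≤ (Q ^ 2) ^ 2 := by
    rw [← pow_mul]
    exact_mod_cast hlevel
  exact (Nat.pow_le_pow_iff_left two_ne_zero).mp hsq

theorem sum_rem_linearFormsSieve_le (hQ : 1 ≤ Q) (hk : 0 < k) :
    ∑ x ∈ sieveModuli (linearFormsSieve k l M N hQ) ×ˢ sieveModuli (linearFormsSieve k l M N hQ),
      ((linearFormsSieve k l M N hQ).nu x.1)⁻¹ * ((linearFormsSieve k l M N hQ).nu x.2)⁻¹ *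
        |(linearFormsSieve k l M N hQ).rem (x.1.lcm x.2)| ≤ (Q : ℝ) ^ 12 := by
  set s := linearFormsSieve k l M N hQ
  have hmoduli : ∀ d ∈ sieveModuli s, d ∣ s.prodPrimes ∧ d ≠ 0 ∧ (d : ℝ) ≤ (Q : ℝ) ^ 2 :=
    fun d hd =>
      have hdvd := (mem_sieveModuli.mp hd).1
      ⟨hdvd, (squarefree_of_dvd_prodPrimes hdvd).ne_zero,
        by exact_mod_cast le_sq_of_mem_sieveModuli_linearFormsSieve hQ hd⟩
  have hnu : ∀ d ∈ sieveModuli s, (s.nu d)⁻¹ ≤ (Q : ℝ) ^ 2 := fun d hd =>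
    (inv_divisorDensity_le (hmoduli d hd).2.1).trans (hmoduli d hd).2.2
  have hcard : (#(sieveModuli s) : ℝ) ≤ (Q : ℝ) ^ 2 := by
    have hsub : sieveModuli s ⊆ Icc 1 (Q ^ 2) := fun d hd =>
      mem_Icc.mpr ⟨Nat.one_le_iff_ne_zero.mpr (hmoduli d hd).2.1,
        le_sq_of_mem_sieveModuli_linearFormsSieve hQ hd⟩
    have hcard := card_le_card hsub
    rw [Nat.card_Icc, Nat.add_sub_cancel] at hcard
    exact_mod_cast hcard
  have hterm : ∀ x ∈ sieveModuli s ×ˢ sieveModuli s,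
      (s.nu x.1)⁻¹ * (s.nu x.2)⁻¹ * |s.rem (x.1.lcm x.2)| ≤ (Q : ℝ) ^ 8 := by
    intro x hx
    obtain ⟨hx₁, hx₂⟩ := mem_product.mp hx
    obtain ⟨hdvd₁, -, hle₁⟩ := hmoduli _ hx₁
    obtain ⟨hdvd₂, -, hle₂⟩ := hmoduli _ hx₂
    have hlcm : ((x.1.lcm x.2 : ℕ) : ℝ) ≤ x.1 * x.2 := by
      exact_mod_cast Nat.le_of_dvd (Nat.mul_pos (Nat.pos_of_ne_zero (hmoduli _ hx₁).2.1)
        (Nat.pos_of_ne_zero (hmoduli _ hx₂).2.1)) (Nat.lcm_dvd_mul x.1 x.2)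
    have hrem : |s.rem (x.1.lcm x.2)| ≤ (Q : ℝ) ^ 2 * (Q : ℝ) ^ 2 :=
      (abs_rem_linearFormsSieve_le hQ hk (Nat.lcm_dvd hdvd₁ hdvd₂)).trans (hlcm.trans (by gcongr))
    have : 0 ≤ (s.nu x.1)⁻¹ := inv_nonneg.mpr (nu_pos_of_dvd_prodPrimes hdvd₁).le
    have hnu₂ : 0 ≤ (s.nu x.2)⁻¹ := inv_nonneg.mpr (nu_pos_of_dvd_prodPrimes hdvd₂).le
    calc (s.nu x.1)⁻¹ * (s.nu x.2)⁻¹ * |s.rem (x.1.lcm x.2)|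
        ≤ (Q : ℝ) ^ 2 * (Q : ℝ) ^ 2 * ((Q : ℝ) ^ 2 * (Q : ℝ) ^ 2) := by
          gcongr
          exacts [hnu _ hx₁, hnu _ hx₂]
      _ = (Q : ℝ) ^ 8 := by ring
  calc _ ≤ ∑ _x ∈ sieveModuli s ×ˢ sieveModuli s, (Q : ℝ) ^ 8 := sum_le_sum hterm
    _ = #(sieveModuli s) * #(sieveModuli s) * (Q : ℝ) ^ 8 := by
        rw [sum_const, card_product, nsmul_eq_mul, Nat.cast_mul]
    _ ≤ (Q : ℝ) ^ 2 * (Q : ℝ) ^ 2 * (Q : ℝ) ^ 8 := by gcongr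
    _ = (Q : ℝ) ^ 12 := by ring

theorem card_both_prime_le_siftedSum (hQ : 1 ≤ Q) (hk : 0 < k) (hl : 0 < l) (hQM : Q ^ 2 ≤ M) :
    (#{d ∈ Ico M (M + N) | (d * k + 1).Prime ∧ (d * l + 1).Prime} : ℝ) ≤
      (linearFormsSieve k l M N hQ).siftedSum := by
  have hcoprime : ∀ a d : ℕ, 0 < a → d ∈ Ico M (M + N) → (d * a + 1).Prime →
      (primeProductAvoiding (k * l * (l - k)) (Q ^ 2)).Coprime (d * a + 1) := by
    intro a d ha hd hprime
    refine ((Nat.Prime.coprime_iff_not_dvd hprime).mpr fun hdvd => ?_).symm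
    have hle := ((prime_dvd_primeProductAvoiding hprime).mp hdvd).1
    have := Nat.le_mul_of_pos_right d ha
    have := (mem_Ico.mp hd).1
    omega
  have hsift : (linearFormsSieve k l M N hQ).siftedSum =
      ∑ n ∈ (Ico M (M + N)).image fun d => (d * k + 1) * (d * l + 1),
        if (primeProductAvoiding (k * l * (l - k)) (Q ^ 2)).Coprime n then (1 : ℝ) else 0 := rfl
  rw [hsift, sum_image fun a _ b _ hab => linearForms_injective hk l hab, sum_boole]
  gcongr with d hd
  exact fun hprimes => (hcoprime k d hk hd hprimes.1).mul_right (hcoprime l d hl hd hprimes.2)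

theorem card_both_prime_le (hk : 0 < k) (hkl : k < l) (hQ : 2 ≤ Q) (hQM : Q ^ 2 ≤ M) :
    (#{d ∈ Ico M (M + N) | (d * k + 1).Prime ∧ (d * l + 1).Prime} : ℝ) ≤
      N * totientRatio (k * l * (l - k)) ^ 2 / Real.log Q ^ 2 + (Q : ℝ) ^ 12 := by
  have hQ1 : 1 ≤ Q := one_le_two.trans hQ
  have hl : 0 < l := hk.trans hkl
  have hlog : 0 < Real.log Q := Real.log_pos (by exact_mod_cast hQ)
  set D := k * l * (l - k)
  have hD : 0 < D := Nat.mul_pos (Nat.mul_pos hk hl) (Nat.sub_pos_of_lt hkl)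
  have : 0 < D.totient := Nat.totient_pos.mpr hD
  have hsum : ((D.totient / D : ℝ) * Real.log Q) ^ 2 ≤
      selbergSum (linearFormsSieve k l M N hQ1) :=
    sq_totient_div_mul_log_le_selbergSum hD.ne' (two_dvd_mul_mul_sub k l) le_rfl
      (fun p hp hpQ hpD => (prime_dvd_primeProductAvoiding hp).mpr ⟨hpQ, hpD⟩)
      fun p hp _ => (divisorDensity_prime hp).ge
  calc _ ≤ (linearFormsSieve k l M N hQ1).siftedSum := card_both_prime_le_siftedSum hQ1 hk hl hQM
    _ ≤ N / selbergSum (linearFormsSieve k l M N hQ1) + (Q : ℝ) ^ 12 :=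
        (siftedSum_le_div_selbergSum_add _).trans
          (add_le_add_right (sum_rem_linearFormsSieve_le hQ1 hk) _)
    _ ≤ N / ((D.totient / D : ℝ) * Real.log Q) ^ 2 + (Q : ℝ) ^ 12 := by gcongr
    _ = _ := by
        rw [totientRatio]
        field_simp

end LinearFormsSieve

section PrimeCofactors

open Finset

theorem primeCounting_floor_le {x : ℝ} (hx : 1 < x) :
    (Nat.primeCounting ⌊x⌋₊ : ℝ) ≤ 8 * x / Real.log x := by
  have hx0 : 0 < x := one_pos.trans hx
  have hlog : 0 < Real.log x := Real.log_pos hx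
  have hlog4 : Real.log 4 ≤ 3 := by
    linarith [Real.log_le_sub_one_of_pos (show (0 : ℝ) < 4 by norm_num)]
  have hsqrt : 0 < √x := Real.sqrt_pos.mpr hx0
  have hlog_sqrt : Real.log x ≤ 2 * √x := by
    have := Real.log_le_sub_one_of_pos hsqrt
    rw [Real.log_sqrt hx0.le] at this
    linarith
  have hsqrt_le : √x ≤ 2 * x / Real.log x := by
    rw [le_div_iff₀ hlog]
    nlinarith [Real.mul_self_sqrt hx0.le]
  calc (Nat.primeCounting ⌊x⌋₊ : ℝ) ≤ Real.log 4 * x / (Real.log x / 2) + √x := by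
        rw [← Real.log_sqrt hx0.le]
        exact Chebyshev.pi_le_log4_mul_div hx
    _ ≤ 3 * x / (Real.log x / 2) + 2 * x / Real.log x := by gcongr
    _ = 8 * x / Real.log x := by
        field_simp
        ring

theorem card_prime_mul_add_one_le {M k : ℕ} (hM : 2 ≤ M) (hk : 0 < k) :
    (#{d ∈ Ico M (2 * M) | (d * k + 1).Prime} : ℝ) ≤ 16 * M * k / Real.log M := by
  have hcard : #{d ∈ Ico M (2 * M) | (d * k + 1).Prime} ≤ Nat.primeCounting (2 * M * k) := by
    rw [← Nat.primesLE_card_eq_primeCounting]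
    refine card_le_card_of_injOn (fun d => d * k + 1) (fun d hd => ?_) fun a _ b _ hab =>
      Nat.eq_of_mul_eq_mul_right hk (Nat.succ_injective hab)
    obtain ⟨hdM, hprime⟩ := mem_filter.mp hd
    refine Nat.mem_primesLE.mpr ⟨?_, hprime⟩
    calc d * k + 1 ≤ d * k + k := by gcongr; exact hk
      _ = (d + 1) * k := by ring
      _ ≤ 2 * M * k := Nat.mul_le_mul_right k (mem_Ico.mp hdM).2
  have hM2 : (2 : ℝ) ≤ M := by exact_mod_cast hM
  have hk1 : (1 : ℝ) ≤ k := by exact_mod_cast hk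
  have hMk : (M : ℝ) ≤ ((2 * M * k : ℕ) : ℝ) := by
    push_cast
    nlinarith
  have hlog : 0 < Real.log M := Real.log_pos (by linarith)
  calc _ ≤ (Nat.primeCounting ⌊((2 * M * k : ℕ) : ℝ)⌋₊ : ℝ) := by
        rw [Nat.floor_natCast]
        exact_mod_cast hcard
    _ ≤ 8 * ((2 * M * k : ℕ) : ℝ) / Real.log (2 * M * k : ℕ) :=
        primeCounting_floor_le (by linarith)
    _ ≤ 8 * ((2 * M * k : ℕ) : ℝ) / Real.log M := by gcongr
    _ = _ := by
        push_cast
        ring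

theorem sq_sum_Icc_eq (f : ℕ → ℝ) (K : ℕ) :
    (∑ k ∈ Icc 1 K, f k) ^ 2 =
      ∑ k ∈ Icc 1 K, f k ^ 2 + 2 * ∑ l ∈ Icc 1 K, ∑ k ∈ Ico 1 l, f k * f l := by
  induction K with
  | zero => simp
  | succ K ih =>
    have hIco : Ico 1 (K + 1) = Icc 1 K := rfl
    simp only [sum_Icc_succ_top (Nat.le_add_left 1 K), add_sq, ih, hIco, ← sum_mul]
    ring

/-- The sum over `M ≤ d < 2 * M` of the square of `∑ 1 / k`, taken over the `k ≤ K` for which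
`d * k + 1` is prime. -/
noncomputable def cofactorSqSum (M K : ℕ) : ℝ :=
  ∑ d ∈ Ico M (2 * M), (∑ k ∈ Icc 1 K with (d * k + 1).Prime, (k : ℝ)⁻¹) ^ 2

theorem cofactorSqSum_eq (M K : ℕ) :
    cofactorSqSum M K =
      ∑ k ∈ Icc 1 K, (k : ℝ)⁻¹ ^ 2 * #{d ∈ Ico M (2 * M) | (d * k + 1).Prime} +
      2 * ∑ l ∈ Icc 1 K, ∑ k ∈ Ico 1 l, (k : ℝ)⁻¹ * (l : ℝ)⁻¹ *
        #{d ∈ Ico M (2 * M) | (d * k + 1).Prime ∧ (d * l + 1).Prime} := by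
  have hdiag : ∀ d k : ℕ, (if (d * k + 1).Prime then (k : ℝ)⁻¹ else 0) ^ 2 =
      (k : ℝ)⁻¹ ^ 2 * if (d * k + 1).Prime then 1 else 0 := fun d k => by
    split_ifs <;> simp
  have hoff : ∀ d k l : ℕ, (if (d * k + 1).Prime then (k : ℝ)⁻¹ else 0) *
      (if (d * l + 1).Prime then (l : ℝ)⁻¹ else 0) =
      (k : ℝ)⁻¹ * (l : ℝ)⁻¹ * if (d * k + 1).Prime ∧ (d * l + 1).Prime then 1 else 0 :=
    fun d k l => by
      rw [ite_zero_mul_ite_zero, mul_ite_zero, mul_one]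
  simp only [cofactorSqSum, sum_filter, sq_sum_Icc_eq, hdiag, hoff, sum_add_distrib, ← mul_sum]
  congr 1
  · rw [sum_comm]
    simp only [← mul_sum, sum_boole]
  · rw [sum_comm]
    congr 1
    refine sum_congr rfl fun l _ => ?_
    rw [sum_comm]
    simp only [← mul_sum, sum_boole]

theorem exists_sieveLevel {M : ℕ} (hM : 2 ^ 16 ≤ M) :
    ∃ Q : ℕ, 2 ≤ Q ∧ Q ^ 2 ≤ M ∧ Real.log M / 32 ≤ Real.log Q ∧
      (Q : ℝ) ^ 12 ≤ 64 * M / Real.log M ^ 2 := by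
  have hM' : (2 : ℝ) ^ 16 ≤ M := by exact_mod_cast hM
  have hM0 : (0 : ℝ) < M := lt_of_lt_of_le (by positivity) hM'
  have hM1 : (1 : ℝ) < M := by linarith
  have hlog : 0 < Real.log M := Real.log_pos hM1
  set x : ℝ := (M : ℝ) ^ (1 / 16 : ℝ) with hx
  have hx2 : 2 ≤ x := by
    calc (2 : ℝ) = ((2 : ℝ) ^ 16) ^ (1 / 16 : ℝ) := by
          rw [← Real.rpow_natCast, ← Real.rpow_mul two_pos.le]
          norm_num
      _ ≤ x := Real.rpow_le_rpow (by positivity) hM' (by norm_num)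
  have hpow : x ^ 16 = M := by
    rw [hx, ← Real.rpow_natCast, ← Real.rpow_mul hM0.le]
    norm_num
  have hfloor : (⌊x⌋₊ : ℝ) ≤ x := Nat.floor_le (by linarith)
  have hQ2 : 2 ≤ ⌊x⌋₊ := Nat.le_floor (by exact_mod_cast hx2)
  have hQ2' : (2 : ℝ) ≤ ⌊x⌋₊ := by exact_mod_cast hQ2
  have hlogx : Real.log M = 16 * Real.log x := by
    rw [← hpow, Real.log_pow]
    norm_num
  refine ⟨⌊x⌋₊, hQ2, ?_, ?_, ?_⟩
  · have : (⌊x⌋₊ : ℝ) ^ 2 ≤ M := by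
      calc (⌊x⌋₊ : ℝ) ^ 2 ≤ x ^ 2 := by gcongr
        _ ≤ x ^ 16 := pow_le_pow_right₀ (by linarith) (by norm_num)
        _ = M := hpow
    exact_mod_cast this
  · have hsq : x ≤ (⌊x⌋₊ : ℝ) ^ 2 := by nlinarith [Nat.lt_floor_add_one x]
    have := Real.log_le_log (by linarith) hsq
    rw [Real.log_pow] at this
    push_cast at this
    linarith
  · have hlog_le : Real.log M ≤ 8 * x ^ 2 := by
      nlinarith [Real.log_le_sub_one_of_pos (by linarith : 0 < x)]
    rw [le_div_iff₀ (by positivity)]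
    calc (⌊x⌋₊ : ℝ) ^ 12 * Real.log M ^ 2 ≤ x ^ 12 * (8 * x ^ 2) ^ 2 := by gcongr
      _ = 64 * (M : ℝ) := by
          rw [← hpow]
          ring

theorem card_both_prime_le_div_log_sq {M k l : ℕ} (hM : 2 ^ 16 ≤ M) (hk : 0 < k) (hkl : k < l) :
    (#{d ∈ Ico M (2 * M) | (d * k + 1).Prime ∧ (d * l + 1).Prime} : ℝ) ≤
      1024 * (M / Real.log M ^ 2) * (totientRatio (k * l * (l - k)) ^ 2 + 1) := by
  obtain ⟨Q, hQ2, hQM, hlogQ, hQpow⟩ := exists_sieveLevel hM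
  have hM1 : (1 : ℝ) < M := by exact_mod_cast lt_of_lt_of_le (by norm_num) hM
  have hlog : 0 < Real.log M := Real.log_pos hM1
  have hcount := card_both_prime_le (N := M) hk hkl hQ2 hQM
  rw [← two_mul] at hcount
  calc _ ≤ M * totientRatio (k * l * (l - k)) ^ 2 / Real.log Q ^ 2 + (Q : ℝ) ^ 12 := hcount
    _ ≤ M * totientRatio (k * l * (l - k)) ^ 2 / (Real.log M / 32) ^ 2 +
          1024 * M / Real.log M ^ 2 := by
        gcongr
        refine hQpow.trans ?_
        gcongr
        norm_num
    _ = _ := by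
        field_simp
        ring

theorem sum_inv_sq_mul_card_prime_le {M : ℕ} (hM : 2 ≤ M) (K : ℕ) :
    ∑ k ∈ Icc 1 K, (k : ℝ)⁻¹ ^ 2 * #{d ∈ Ico M (2 * M) | (d * k + 1).Prime} ≤
      16 * (M / Real.log M) * ∑ k ∈ Icc 1 K, (k : ℝ)⁻¹ := by
  rw [mul_sum]
  refine sum_le_sum fun k hk => ?_
  have hk0 : (0 : ℝ) < k := by exact_mod_cast (mem_Icc.mp hk).1
  calc _ ≤ (k : ℝ)⁻¹ ^ 2 * (16 * M * k / Real.log M) := by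
        gcongr
        exact card_prime_mul_add_one_le hM (mem_Icc.mp hk).1
    _ = _ := by field_simp

theorem exists_sum_inv_mul_card_both_prime_le :
    ∃ C : ℝ, 0 < C ∧ ∀ M K : ℕ, 2 ^ 16 ≤ M →
      ∑ l ∈ Icc 1 K, ∑ k ∈ Ico 1 l, (k : ℝ)⁻¹ * (l : ℝ)⁻¹ *
          #{d ∈ Ico M (2 * M) | (d * k + 1).Prime ∧ (d * l + 1).Prime} ≤
        C * (M / Real.log M ^ 2) * (∑ k ∈ Icc 1 K, (k : ℝ)⁻¹) ^ 2 := by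
  obtain ⟨C, hC, hpairs⟩ := exists_sum_sq_totientRatio_pairs_le
  refine ⟨1024 * (C + 1), by positivity, fun M K hM => ?_⟩
  have hinv : ∀ n : ℕ, (0 : ℝ) ≤ (n : ℝ)⁻¹ := fun n => by positivity
  set H := ∑ k ∈ Icc 1 K, (k : ℝ)⁻¹
  set X := 1024 * (M / Real.log M ^ 2 : ℝ) with hX
  have : 0 ≤ X := by positivity
  calc _ ≤ ∑ l ∈ Icc 1 K, ∑ k ∈ Ico 1 l, (k : ℝ)⁻¹ * (l : ℝ)⁻¹ *
          (X * (totientRatio (k * l * (l - k)) ^ 2 + 1)) := by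
        refine sum_le_sum fun l _ => sum_le_sum fun k hk => ?_
        gcongr
        exact card_both_prime_le_div_log_sq hM (mem_Ico.mp hk).1 (mem_Ico.mp hk).2
    _ = X * (∑ l ∈ Icc 1 K, ∑ k ∈ Ico 1 l,
            (k : ℝ)⁻¹ * (l : ℝ)⁻¹ * totientRatio (k * l * (l - k)) ^ 2 +
          ∑ l ∈ Icc 1 K, ∑ k ∈ Ico 1 l, (k : ℝ)⁻¹ * (l : ℝ)⁻¹) := by
        simp only [← sum_add_distrib, mul_sum]
        exact sum_congr rfl fun l _ => sum_congr rfl fun k _ => by ring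
    _ ≤ X * (C * H ^ 2 + H * H) := by
        gcongr
        exacts [hpairs K, sum_sum_mul_le hinv hinv K]
    _ = _ := by
        rw [hX]
        ring

theorem exists_cofactorSqSum_le :
    ∃ C : ℝ, 0 < C ∧ ∀ M K : ℕ, 2 ^ 16 ≤ M →
      cofactorSqSum M K ≤
        C * M * ((1 + Real.log K) / Real.log M + ((1 + Real.log K) / Real.log M) ^ 2) := by
  obtain ⟨C, hC, hoff⟩ := exists_sum_inv_mul_card_both_prime_le
  refine ⟨16 + 2 * C, by positivity, fun M K hM => ?_⟩
  have hM2 : 2 ≤ M := le_trans (by norm_num) hM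
  have hlog : 0 < Real.log M := Real.log_pos (by exact_mod_cast hM2)
  have : 0 ≤ 1 + Real.log K := by linarith [Real.log_natCast_nonneg K]
  set H := ∑ k ∈ Icc 1 K, (k : ℝ)⁻¹
  have : 0 ≤ H := sum_nonneg fun k _ => by positivity
  have hHlog : H ≤ 1 + Real.log K := sum_Icc_inv_le K
  set y := (1 + Real.log K) / Real.log M with hy
  have : 0 ≤ y := by positivity
  calc cofactorSqSum M K
      ≤ 16 * (M / Real.log M) * H + 2 * (C * (M / Real.log M ^ 2) * H ^ 2) := by
        rw [cofactorSqSum_eq]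
        gcongr
        exacts [sum_inv_sq_mul_card_prime_le hM2 K, hoff M K hM]
    _ ≤ 16 * (M / Real.log M) * (1 + Real.log K) +
          2 * (C * (M / Real.log M ^ 2) * (1 + Real.log K) ^ 2) := by gcongr
    _ = 16 * M * y + 2 * C * M * y ^ 2 := by
        rw [hy]
        ring
    _ ≤ (16 + 2 * C) * M * y + (16 + 2 * C) * M * y ^ 2 := by
        gcongr <;> linarith
    _ = _ := by ring

end PrimeCofactors

section NearBlocks

open Finset

/-- The part of `∑ 1/(p-1)`, over primes `p ≡ 1 (mod d)`, with `2^j < p ≤ 2^(j+1)`. -/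
noncomputable def blockSum (j d : ℕ) : ℝ :=
  ∑ p ∈ Ioc (2 ^ j) (2 ^ (j + 1)) with p.Prime ∧ d ∣ p - 1, ((p : ℝ) - 1)⁻¹

/-- The block `(2^j, 2^(j+1)]` is far from the modulus `d` when `1 ≤ j` and `d ≤ 2^(j(1-ε))`, so
that the Elliott–Halberstam conjecture controls the primes `p ≡ 1 (mod d)` in it. -/
def IsFarBlock (ε : ℝ) (d j : ℕ) : Prop :=
  1 ≤ j ∧ (d : ℝ) ≤ (2 : ℝ) ^ ((j : ℝ) * (1 - ε))

open Classical in
/-- The contribution to `∑ 1/(p-1)`, `p ≡ 1 (mod d)`, `p ≤ 2^J`, of the blocks not far from `d`. -/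
noncomputable def nearSum (ε : ℝ) (J d : ℕ) : ℝ :=
  ∑ j ∈ range J with ¬ IsFarBlock ε d j, blockSum j d

open Classical in
/-- The contribution to `∑ 1/(p-1)`, `p ≡ 1 (mod d)`, `p ≤ 2^J`, of the blocks far from `d`. -/
noncomputable def farSum (ε : ℝ) (J d : ℕ) : ℝ :=
  ∑ j ∈ range J with IsFarBlock ε d j, blockSum j d

theorem blockSum_nonneg (j d : ℕ) : 0 ≤ blockSum j d :=
  sum_nonneg fun p hp => by
    have hp1 : (1 : ℝ) ≤ p := by exact_mod_cast (mem_filter.mp hp).2.1.one_le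
    exact inv_nonneg.mpr (by linarith)

theorem nearSum_nonneg (ε : ℝ) (J d : ℕ) : 0 ≤ nearSum ε J d :=
  sum_nonneg fun _ _ => blockSum_nonneg _ _

theorem nearSum_add_farSum (ε : ℝ) (J d : ℕ) :
    nearSum ε J d + farSum ε J d = ∑ j ∈ range J, blockSum j d := by
  rw [nearSum, farSum, add_comm, sum_filter_add_sum_filter_not]

/-- A bound for the cofactors `(p-1)/d` of the primes `p ≡ 1 (mod d)` in the blocks that are not
far from a modulus `d < 2^(i+1)`. -/
noncomputable def cofactorBound (ε : ℝ) (i : ℕ) : ℕ :=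
  ⌊2 * (2 : ℝ) ^ (2 * ε * ((i : ℝ) + 1))⌋₊

theorem one_le_cofactorBound {ε : ℝ} (hε : 0 ≤ ε) (i : ℕ) : 1 ≤ cofactorBound ε i := by
  have hpow : (1 : ℝ) ≤ (2 : ℝ) ^ (2 * ε * ((i : ℝ) + 1)) :=
    Real.one_le_rpow one_le_two (by positivity)
  refine Nat.le_floor ?_
  push_cast
  linarith

theorem log_cofactorBound_le {ε : ℝ} (hε : 0 ≤ ε) (i : ℕ) :
    Real.log (cofactorBound ε i) ≤ 1 + 2 * ε * ((i : ℝ) + 1) := by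
  have hpos : (0 : ℝ) < cofactorBound ε i := by exact_mod_cast one_le_cofactorBound hε i
  have hexp : 0 ≤ 2 * ε * ((i : ℝ) + 1) := by positivity
  have hlog2 : Real.log 2 ≤ 1 := by linarith [Real.log_two_lt_d9]
  calc Real.log (cofactorBound ε i) ≤ Real.log (2 * (2 : ℝ) ^ (2 * ε * ((i : ℝ) + 1))) :=
        Real.log_le_log hpos (Nat.floor_le (by positivity))
    _ = Real.log 2 + 2 * ε * ((i : ℝ) + 1) * Real.log 2 := by
        rw [Real.log_mul two_ne_zero (by positivity), Real.log_rpow two_pos]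
    _ ≤ 1 + 2 * ε * ((i : ℝ) + 1) := add_le_add hlog2 (mul_le_of_le_one_right hexp hlog2)

theorem le_cofactorBound_of_not_isFarBlock {ε : ℝ} (hε : 0 ≤ ε) (hε2 : ε ≤ 1 / 2) {i j d k : ℕ}
    (hd : 0 < d) (hdi : d < 2 ^ (i + 1)) (hfar : ¬ IsFarBlock ε d j)
    (hk : d * k + 1 ≤ 2 ^ (j + 1)) : k ≤ cofactorBound ε i := by
  rcases Nat.eq_zero_or_pos j with rfl | hj
  · have hkd : k ≤ d * k := Nat.le_mul_of_pos_left k hd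
    refine le_trans ?_ (one_le_cofactorBound hε i)
    omega
  have hdj : (2 : ℝ) ^ ((j : ℝ) * (1 - ε)) < d := lt_of_not_ge fun h => hfar ⟨hj, h⟩
  have hji : (j : ℝ) * (1 - ε) < (i : ℝ) + 1 := by
    refine (Real.rpow_lt_rpow_left_iff one_lt_two).mp (hdj.trans ?_)
    exact_mod_cast hdi
  have hj2 : (j : ℝ) ≤ 2 * ((i : ℝ) + 1) := by
    have : (0 : ℝ) ≤ j := j.cast_nonneg
    nlinarith
  have hdk : (d : ℝ) * k ≤ 2 ^ (j + 1) := by exact_mod_cast (Nat.le_succ _).trans hk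
  refine Nat.le_floor (le_of_mul_le_mul_left ?_ (by exact_mod_cast hd : (0 : ℝ) < d))
  calc (d : ℝ) * k ≤ 2 ^ (j + 1) := hdk
    _ = 2 ^ ((j : ℝ) * (1 - ε)) * (2 * 2 ^ (j * ε)) := by
        rw [mul_left_comm, ← Real.rpow_add two_pos, ← mul_add, sub_add_cancel, mul_one,
          Real.rpow_natCast, pow_succ']
    _ ≤ d * (2 * 2 ^ (2 * ((i : ℝ) + 1) * ε)) := by
        gcongr
        exact one_le_two
    _ = d * (2 * 2 ^ (2 * ε * ((i : ℝ) + 1))) := by ring_nf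

theorem pairwiseDisjoint_Ioc_two_pow (s : Set ℕ) :
    s.PairwiseDisjoint fun j => Ioc (2 ^ j) (2 ^ (j + 1)) := fun i _ j _ hij => by
  rw [Function.onFun, ← disjoint_coe, coe_Ioc, coe_Ioc]
  exact (pow_right_mono₀ (one_le_two (α := ℕ))).pairwise_disjoint_on_Ioc_succ hij

theorem nearSum_le {ε : ℝ} (hε : 0 ≤ ε) (hε2 : ε ≤ 1 / 2) (J : ℕ) {i d : ℕ}
    (hd : 0 < d) (hdi : d < 2 ^ (i + 1)) :
    nearSum ε J d ≤
      (d : ℝ)⁻¹ * ∑ k ∈ Icc 1 (cofactorBound ε i) with (d * k + 1).Prime, (k : ℝ)⁻¹ := by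
  classical
  set cofactors := {k ∈ Icc 1 (cofactorBound ε i) | (d * k + 1).Prime}
  set near := {j ∈ range J | ¬ IsFarBlock ε d j}
  have hsub : (near.biUnion fun j => {p ∈ Ioc (2 ^ j) (2 ^ (j + 1)) | p.Prime ∧ d ∣ p - 1}) ⊆
      cofactors.image fun k => d * k + 1 := fun p hp => by
    obtain ⟨j, hj, hpj⟩ := mem_biUnion.mp hp
    obtain ⟨hpj, hp, k, hk⟩ := mem_filter.mp hpj
    have hpk : d * k + 1 = p := by have := hp.one_lt; omega
    have hk0 : 0 < k := Nat.pos_of_ne_zero fun h => hp.ne_one (by rw [← hpk, h, mul_zero])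
    have hkK := le_cofactorBound_of_not_isFarBlock hε hε2 hd hdi (mem_filter.mp hj).2
      (hpk.le.trans (mem_Ioc.mp hpj).2)
    exact mem_image.mpr ⟨k, mem_filter.mpr ⟨mem_Icc.mpr ⟨hk0, hkK⟩, hpk ▸ hp⟩, hpk⟩
  have hdisj : (near : Set ℕ).PairwiseDisjoint fun j =>
      {p ∈ Ioc (2 ^ j) (2 ^ (j + 1)) | p.Prime ∧ d ∣ p - 1} := fun a ha b hb hab =>
    disjoint_filter_filter (pairwiseDisjoint_Ioc_two_pow _ ha hb hab)
  calc nearSum ε J d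
      = ∑ p ∈ near.biUnion fun j => {p ∈ Ioc (2 ^ j) (2 ^ (j + 1)) | p.Prime ∧ d ∣ p - 1},
          ((p : ℝ) - 1)⁻¹ := (sum_biUnion hdisj).symm
    _ ≤ ∑ p ∈ cofactors.image fun k => d * k + 1, ((p : ℝ) - 1)⁻¹ := by
        refine sum_le_sum_of_subset_of_nonneg hsub fun p hp _ => inv_nonneg.mpr ?_
        obtain ⟨k, _, rfl⟩ := mem_image.mp hp
        push_cast
        linarith [show (0 : ℝ) ≤ d * k by positivity]
    _ = ∑ k ∈ cofactors, (d : ℝ)⁻¹ * (k : ℝ)⁻¹ := by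
        rw [sum_image fun k _ l _ h => Nat.eq_of_mul_eq_mul_left hd (Nat.succ_injective h)]
        refine sum_congr rfl fun k _ => ?_
        rw [Nat.cast_succ, add_sub_cancel_right, Nat.cast_mul, mul_inv]
    _ = _ := (mul_sum _ _ _).symm

theorem totient_mul_nearSum_sq_le {ε : ℝ} (hε : 0 ≤ ε) (hε2 : ε ≤ 1 / 2) (J : ℕ) {i d : ℕ}
    (hd : d ∈ Ico (2 ^ i) (2 * 2 ^ i)) :
    (d.totient : ℝ) * nearSum ε J d ^ 2 ≤ (2 ^ i)⁻¹ *
      (∑ k ∈ Icc 1 (cofactorBound ε i) with (d * k + 1).Prime, (k : ℝ)⁻¹) ^ 2 := by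
  obtain ⟨hid, hdi⟩ := mem_Ico.mp hd
  have hpow : 0 < 2 ^ i := by positivity
  have hd0 : 0 < d := hpow.trans_le hid
  set S := ∑ k ∈ Icc 1 (cofactorBound ε i) with (d * k + 1).Prime, (k : ℝ)⁻¹
  calc (d.totient : ℝ) * nearSum ε J d ^ 2 ≤ d * ((d : ℝ)⁻¹ * S) ^ 2 := by
        gcongr
        exacts [d.totient_le, nearSum_nonneg ε J d, nearSum_le hε hε2 J hd0 (pow_succ' 2 i ▸ hdi)]
    _ = (d : ℝ)⁻¹ * S ^ 2 := by field_simp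
    _ ≤ (2 ^ i)⁻¹ * S ^ 2 := by
        gcongr
        exact_mod_cast hid

theorem sum_Ico_one_two_pow (f : ℕ → ℝ) (n : ℕ) :
    ∑ d ∈ Ico 1 (2 ^ n), f d = ∑ i ∈ range n, ∑ d ∈ Ico (2 ^ i) (2 * 2 ^ i), f d := by
  induction n with
  | zero => simp
  | succ n ih =>
    rw [sum_range_succ, ← ih, pow_succ',
      sum_Ico_consecutive f Nat.one_le_two_pow (Nat.le_mul_of_pos_left _ two_pos)]

theorem sum_totient_mul_nearSum_sq_le_sum_cofactorSqSum {ε : ℝ} (hε : 0 ≤ ε) (hε2 : ε ≤ 1 / 2)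
    (J : ℕ) :
    ∑ d ∈ Icc 1 (2 ^ J), (d.totient : ℝ) * nearSum ε J d ^ 2 ≤
      ∑ i ∈ range (J + 1), (2 ^ i)⁻¹ * cofactorSqSum (2 ^ i) (cofactorBound ε i) := by
  calc ∑ d ∈ Icc 1 (2 ^ J), (d.totient : ℝ) * nearSum ε J d ^ 2
      ≤ ∑ d ∈ Ico 1 (2 ^ (J + 1)), (d.totient : ℝ) * nearSum ε J d ^ 2 := by
        refine sum_le_sum_of_subset_of_nonneg (fun d hd => ?_) fun _ _ _ => by positivity
        have hlt : 2 ^ J < 2 ^ (J + 1) := Nat.pow_lt_pow_succ one_lt_two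
        rw [mem_Icc] at hd
        exact mem_Ico.mpr ⟨hd.1, by omega⟩
    _ ≤ _ := by
        rw [sum_Ico_one_two_pow]
        refine sum_le_sum fun i _ => ?_
        rw [cofactorSqSum, mul_sum]
        exact sum_le_sum fun d hd => totient_mul_nearSum_sq_le hε hε2 J hd

theorem exists_cofactorSqSum_cofactorBound_le :
    ∃ C : ℝ, ∀ ε : ℝ, 0 < ε → ε ≤ 1 / 4 → ∀ᶠ i : ℕ in atTop,
      (2 ^ i)⁻¹ * cofactorSqSum (2 ^ i) (cofactorBound ε i) ≤ C * ε := by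
  obtain ⟨C, hC, hcof⟩ := exists_cofactorSqSum_le
  refine ⟨20 * C, fun ε hε hε4 => ?_⟩
  have hlarge : ∀ᶠ i : ℕ in atTop, ε⁻¹ ≤ i :=
    tendsto_natCast_atTop_atTop.eventually (eventually_ge_atTop ε⁻¹)
  filter_upwards [eventually_ge_atTop 16, hlarge] with i hi hεi
  have hi16 : (16 : ℝ) ≤ i := by exact_mod_cast hi
  have hiε : 1 ≤ ε * i := (inv_le_iff_one_le_mul₀' hε).mp hεi
  have hlog2 := Real.log_two_gt_d9
  have hlogK := log_cofactorBound_le hε.le i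
  have := Real.log_natCast_nonneg (cofactorBound ε i)
  have hlogM : Real.log ((2 ^ i : ℕ) : ℝ) = i * Real.log 2 := by
    rw [Nat.cast_pow, Real.log_pow, Nat.cast_ofNat]
  have hlogM0 : 0 < Real.log ((2 ^ i : ℕ) : ℝ) := by rw [hlogM]; positivity
  set y := (1 + Real.log (cofactorBound ε i)) / Real.log ((2 ^ i : ℕ) : ℝ) with hy
  have hy0 : 0 ≤ y := by positivity
  have hy7 : y ≤ 7 * ε := by
    rw [hy, div_le_iff₀ hlogM0, hlogM]
    nlinarith [mul_pos hε (by linarith : (0 : ℝ) < i)]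
  calc (2 ^ i)⁻¹ * cofactorSqSum (2 ^ i) (cofactorBound ε i)
      ≤ (2 ^ i)⁻¹ * (C * (2 ^ i : ℕ) * (y + y ^ 2)) := by
        gcongr
        exact hcof _ _ (Nat.pow_le_pow_right two_pos hi)
    _ = C * (y + y ^ 2) := by
        push_cast
        field_simp
    _ ≤ C * (20 * ε) := by
        gcongr
        nlinarith
    _ = _ := by ring

theorem exists_sum_range_le_mul_add {f : ℕ → ℝ} {c : ℝ} (hf : ∀ᶠ i in atTop, f i ≤ c) :
    ∃ B : ℝ, ∀ n : ℕ, ∑ i ∈ range n, f i ≤ c * n + B := by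
  obtain ⟨i₀, hi₀⟩ := eventually_atTop.mp hf
  refine ⟨∑ i ∈ range i₀, |f i - c|, fun n => ?_⟩
  have hexcess : ∑ i ∈ range n, (f i - c) ≤ ∑ i ∈ range i₀, |f i - c| := by
    calc ∑ i ∈ range n, (f i - c) ≤ ∑ i ∈ range n with i < i₀, (f i - c) := by
          rw [← sum_filter_add_sum_filter_not (range n) (· < i₀)]
          refine add_le_of_nonpos_right (sum_nonpos fun i hi => ?_)
          exact sub_nonpos.mpr (hi₀ i (not_lt.mp (mem_filter.mp hi).2))
      _ ≤ ∑ i ∈ range n with i < i₀, |f i - c| := sum_le_sum fun _ _ => le_abs_self _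
      _ ≤ ∑ i ∈ range i₀, |f i - c| :=
          sum_le_sum_of_subset_of_nonneg (fun i hi => mem_range.mpr (mem_filter.mp hi).2)
            fun _ _ _ => abs_nonneg _
  rw [sum_sub_distrib, sum_const, card_range, nsmul_eq_mul] at hexcess
  linarith

theorem exists_sum_totient_mul_nearSum_sq_le :
    ∃ C : ℝ, ∀ ε : ℝ, 0 < ε → ε ≤ 1 / 4 → ∃ B : ℝ, ∀ J : ℕ,
      ∑ d ∈ Icc 1 (2 ^ J), (d.totient : ℝ) * nearSum ε J d ^ 2 ≤ C * ε * J + B := by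
  obtain ⟨C, hcof⟩ := exists_cofactorSqSum_cofactorBound_le
  refine ⟨C, fun ε hε hε4 => ?_⟩
  obtain ⟨B, hB⟩ := exists_sum_range_le_mul_add (hcof ε hε hε4)
  refine ⟨C * ε + B, fun J => ?_⟩
  have hsum := (sum_totient_mul_nearSum_sq_le_sum_cofactorSqSum hε.le (by linarith) J).trans
    (hB (J + 1))
  push_cast at hsum
  linarith

end NearBlocks

section TotientReciprocals

open Finset

theorem tendsto_log_natCast_atTop : Tendsto (fun N : ℕ => Real.log N) atTop atTop :=
  Real.tendsto_log_atTop.comp tendsto_natCast_atTop_atTop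

theorem sum_Icc_div_inv_le (N e : ℕ) :
    ∑ m ∈ Icc 1 (N / e), (m : ℝ)⁻¹ ≤ 1 + Real.log N :=
  calc ∑ m ∈ Icc 1 (N / e), (m : ℝ)⁻¹ ≤ ∑ m ∈ Icc 1 N, (m : ℝ)⁻¹ :=
        sum_le_sum_of_subset_of_nonneg (Icc_subset_Icc_right (Nat.div_le_self _ _))
          fun _ _ _ => by positivity
    _ ≤ 1 + Real.log N := sum_Icc_inv_le N

theorem log_sub_log_le_sum_Icc_div_inv {N e : ℕ} (hN : 0 < N) (he : 0 < e) :
    Real.log N - Real.log e ≤ ∑ m ∈ Icc 1 (N / e), (m : ℝ)⁻¹ := by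
  have hN' : (0 : ℝ) < N := by exact_mod_cast hN
  have he' : (0 : ℝ) < e := by exact_mod_cast he
  rw [← Real.log_div hN'.ne' he'.ne']
  refine (Real.log_le_log (by positivity) ((div_le_iff₀ he').mpr ?_)).trans
    (log_add_one_le_sum_Icc_inv (N / e))
  have hlt : N < e * (N / e + 1) := Nat.lt_mul_div_succ N he
  rw [mul_comm] at hlt
  exact_mod_cast hlt.le

theorem tendsto_sum_Icc_div_inv_div_log {e : ℕ} (he : 0 < e) :
    Tendsto (fun N : ℕ => (∑ m ∈ Icc 1 (N / e), (m : ℝ)⁻¹) / Real.log N) atTop (nhds 1) := by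
  have hlower : Tendsto (fun N : ℕ => 1 - Real.log e / Real.log N) atTop (nhds 1) := by
    simpa using (tendsto_log_natCast_atTop.const_div_atTop (Real.log e)).const_sub 1
  have hupper : Tendsto (fun N : ℕ => 1 / Real.log N + 1) atTop (nhds 1) := by
    simpa using (tendsto_log_natCast_atTop.const_div_atTop 1).add_const 1
  refine tendsto_of_tendsto_of_tendsto_of_le_of_le' hlower hupper ?_ ?_ <;>
    filter_upwards [eventually_ge_atTop 2] with N hN
  all_goals have hlog : 0 < Real.log N := Real.log_pos (by exact_mod_cast hN)
  · rw [one_sub_div hlog.ne']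
    gcongr
    exact log_sub_log_le_sum_Icc_div_inv (by omega) he
  · rw [div_add_one hlog.ne']
    gcongr
    exact sum_Icc_div_inv_le N e

theorem sum_sum_divisors_mul_inv_eq_tsum (g : ℕ → ℝ) (N : ℕ) :
    ∑ n ∈ Icc 1 N, (∑ e ∈ n.divisors, g e) * (n : ℝ)⁻¹ =
      ∑' e : ℕ, g e * (e : ℝ)⁻¹ * ∑ m ∈ Icc 1 (N / e), (m : ℝ)⁻¹ := by
  rw [sum_sum_divisors_mul_inv, tsum_eq_sum]
  intro e he
  rcases Nat.eq_zero_or_pos e with rfl | he0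
  · simp
  · have hNe : N / e = 0 := Nat.div_eq_of_lt (lt_of_not_ge fun h => he (mem_Icc.mpr ⟨he0, h⟩))
    simp [hNe]

theorem tendsto_sum_sum_divisors_mul_inv_div_log {g : ℕ → ℝ}
    (hg : Summable fun e : ℕ => g e * (e : ℝ)⁻¹) :
    Tendsto (fun N : ℕ => (∑ n ∈ Icc 1 N, (∑ e ∈ n.divisors, g e) * (n : ℝ)⁻¹) / Real.log N)
      atTop (nhds (∑' e : ℕ, g e * (e : ℝ)⁻¹)) := by
  simp only [sum_sum_divisors_mul_inv_eq_tsum, ← tsum_div_const, mul_div_assoc]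
  refine tendsto_tsum_of_dominated_convergence (hg.norm.mul_right 3) (fun e => ?_) ?_
  · rcases Nat.eq_zero_or_pos e with rfl | he
    · simp
    · simpa using (tendsto_sum_Icc_div_inv_div_log he).const_mul (g e * (e : ℝ)⁻¹)
  · filter_upwards [eventually_ge_atTop 2] with N hN e
    have hlog : 1 / 2 ≤ Real.log N := by
      have hlog2 : Real.log 2 ≤ Real.log N := Real.log_le_log two_pos (by exact_mod_cast hN)
      linarith [Real.log_two_gt_d9]
    have hsum0 : 0 ≤ ∑ m ∈ Icc 1 (N / e), (m : ℝ)⁻¹ := sum_nonneg fun _ _ => by positivity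
    rw [norm_mul, Real.norm_of_nonneg (div_nonneg hsum0 (by linarith))]
    gcongr
    rw [div_le_iff₀ (by linarith)]
    linarith [sum_Icc_div_inv_le N e]

/-- `μ(e)^2 / φ(e)`, the function whose sum over the divisors of `n` is `n / φ(n)`. -/
noncomputable def squarefreeInvTotient (e : ℕ) : ℝ :=
  if Squarefree e then (e.totient : ℝ)⁻¹ else 0

theorem squarefreeInvTotient_nonneg (e : ℕ) : 0 ≤ squarefreeInvTotient e := by
  rw [squarefreeInvTotient]
  positivity

theorem squarefreeInvTotient_le (e : ℕ) : squarefreeInvTotient e ≤ (e.totient : ℝ)⁻¹ := by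
  rw [squarefreeInvTotient]
  split_ifs
  exacts [le_rfl, by positivity]

theorem squarefreeInvTotient_mul {m n : ℕ} (hmn : m.Coprime n) :
    squarefreeInvTotient (m * n) = squarefreeInvTotient m * squarefreeInvTotient n := by
  simp only [squarefreeInvTotient, Nat.squarefree_mul hmn, Nat.totient_mul hmn, ite_and,
    Nat.cast_mul, mul_inv]
  split_ifs <;> simp

theorem prod_primeFactors_totient {e : ℕ} (he : Squarefree e) :
    ∏ p ∈ e.primeFactors, p.totient = e.totient := by
  have htotient := Nat.totient_mul_prod_primeFactors e
  rw [Nat.prod_primeFactors_of_squarefree he, mul_comm] at htotient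
  rw [Nat.eq_of_mul_eq_mul_left (Nat.pos_of_ne_zero he.ne_zero) htotient]
  exact prod_congr rfl fun p hp => Nat.totient_prime (Nat.prime_of_mem_primeFactors hp)

theorem sum_divisors_squarefreeInvTotient {n : ℕ} (hn : n ≠ 0) :
    ∑ e ∈ n.divisors, squarefreeInvTotient e = totientRatio n := by
  have hfactor : ∀ p ∈ n.primeFactors, (1 - (p : ℝ)⁻¹)⁻¹ = 1 + (p.totient : ℝ)⁻¹ := fun p hp => by
    have hp := Nat.prime_of_mem_primeFactors hp
    have hp1 : (1 : ℝ) < p := by exact_mod_cast hp.one_lt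
    have hp_sub : (p : ℝ) - 1 ≠ 0 := by linarith
    rw [Nat.totient_prime hp, Nat.cast_sub hp.one_le, Nat.cast_one]
    field_simp
    ring
  rw [totientRatio_eq_prod hn, prod_congr rfl hfactor, prod_primeFactors_one_add _ hn, sum_filter]
  refine sum_congr rfl fun e _ => ?_
  rw [squarefreeInvTotient]
  split_ifs with he
  · rw [prod_inv_distrib, ← prod_primeFactors_totient he, Nat.cast_prod]
  · rfl

theorem totientRatio_le_two_mul_sqrt (n : ℕ) : totientRatio n ≤ 2 * √n := by
  rcases eq_or_ne n 0 with rfl | hn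
  · simp [totientRatio]
  have hfactor : ∀ p ∈ n.primeFactors,
      (1 - (p : ℝ)⁻¹)⁻¹ ≤ (if p = 2 then 2 else 1) * √p := fun p hp => by
    have hp2 : 2 ≤ p := (Nat.prime_of_mem_primeFactors hp).two_le
    split_ifs with h
    · subst h
      norm_num
    · have hp3 : (3 : ℝ) ≤ p := by exact_mod_cast lt_of_le_of_ne hp2 (Ne.symm h)
      have hinv : (1 - (p : ℝ)⁻¹)⁻¹ = p / (p - 1) := by
        have : (p : ℝ) - 1 ≠ 0 := by linarith
        field_simp
      rw [one_mul, hinv]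
      refine Real.le_sqrt_of_sq_le ?_
      rw [div_pow, div_le_iff₀ (by nlinarith)]
      nlinarith
  calc totientRatio n = ∏ p ∈ n.primeFactors, (1 - (p : ℝ)⁻¹)⁻¹ := totientRatio_eq_prod hn
    _ ≤ ∏ p ∈ n.primeFactors, (if p = 2 then 2 else 1) * √p := by
        refine prod_le_prod (fun p _ => inv_nonneg.mpr ?_) hfactor
        exact sub_nonneg.mpr p.cast_inv_le_one
    _ = (∏ p ∈ n.primeFactors, if p = 2 then 2 else 1) * √((∏ p ∈ n.primeFactors, p : ℕ) : ℝ) := by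
        rw [prod_mul_distrib, Nat.cast_prod, Real.sqrt_prod _ fun p _ => p.cast_nonneg]
    _ ≤ 2 * √n := by
        rw [prod_ite_eq']
        gcongr
        · split_ifs <;> norm_num
        · exact Nat.le_of_dvd (Nat.pos_of_ne_zero hn) (Nat.prod_primeFactors_dvd n)

theorem summable_squarefreeInvTotient_mul_inv :
    Summable fun e : ℕ => squarefreeInvTotient e * (e : ℝ)⁻¹ := by
  have hsummable : Summable fun e : ℕ => 2 * (e : ℝ) ^ (-(3 / 2) : ℝ) :=
    (Real.summable_nat_rpow.mpr (by norm_num)).mul_left 2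
  refine hsummable.of_nonneg_of_le
    (fun e => mul_nonneg (squarefreeInvTotient_nonneg e) (by positivity)) fun e => ?_
  rcases Nat.eq_zero_or_pos e with rfl | he
  · simp
  have he0 : (0 : ℝ) < e := by exact_mod_cast he
  calc squarefreeInvTotient e * (e : ℝ)⁻¹ ≤ (e.totient : ℝ)⁻¹ * (e : ℝ)⁻¹ := by
        gcongr
        exact squarefreeInvTotient_le e
    _ = totientRatio e * (e : ℝ) ^ (-2 : ℝ) := by
        rw [totientRatio, Real.rpow_neg he0.le, Real.rpow_two]
        field_simp
    _ ≤ 2 * √e * (e : ℝ) ^ (-2 : ℝ) := by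
        gcongr
        exact totientRatio_le_two_mul_sqrt e
    _ = 2 * (e : ℝ) ^ (-(3 / 2) : ℝ) := by
        rw [Real.sqrt_eq_rpow, mul_assoc, ← Real.rpow_add he0]
        norm_num

/-- `∑ μ(e)^2 / (e φ(e))`, the constant in `∑_{d ≤ N} 1/φ(d) ~ totientConstant * log N`. -/
noncomputable def totientConstant : ℝ :=
  ∑' e : ℕ, squarefreeInvTotient e * (e : ℝ)⁻¹

theorem tendsto_sum_inv_totient_div_log :
    Tendsto (fun N : ℕ => (∑ d ∈ Icc 1 N, (d.totient : ℝ)⁻¹) / Real.log N) atTop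
      (nhds totientConstant) := by
  refine (tendsto_sum_sum_divisors_mul_inv_div_log
    summable_squarefreeInvTotient_mul_inv).congr fun N => ?_
  congr 1
  refine sum_congr rfl fun d hd => ?_
  have hd0 : d ≠ 0 := Nat.one_le_iff_ne_zero.mp (mem_Icc.mp hd).1
  rw [sum_divisors_squarefreeInvTotient hd0, totientRatio]
  field_simp

theorem riemannZeta_natCast_eq_ofReal {k : ℕ} (hk : 1 < k) :
    riemannZeta k = ((∑' n : ℕ, ((n : ℝ) ^ k)⁻¹ : ℝ) : ℂ) := by
  rw [zeta_nat_eq_tsum_of_gt_one hk, Complex.ofReal_tsum]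
  simp only [one_div, Complex.ofReal_inv, Complex.ofReal_pow, Complex.ofReal_natCast]

theorem riemannZeta_natCast_re_pos {k : ℕ} (hk : 1 < k) : 0 < (riemannZeta k).re := by
  rw [riemannZeta_natCast_eq_ofReal hk, Complex.ofReal_re]
  exact (Real.summable_nat_pow_inv.mpr hk).tsum_pos (fun n => by positivity) 1 (by simp)

theorem hasProd_riemannZeta_natCast_re {k : ℕ} (hk : 1 < k) :
    HasProd (fun p : Nat.Primes => (1 - ((p : ℝ) ^ k)⁻¹)⁻¹) (riemannZeta k).re := by
  let invPow : ℕ →*₀ ℝ :=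
    invMonoidWithZeroHom.comp ((powMonoidWithZeroHom (by omega : k ≠ 0)).comp
      (Nat.castRingHom ℝ).toMonoidWithZeroHom)
  rw [riemannZeta_natCast_eq_ofReal hk, Complex.ofReal_re]
  exact EulerProduct.eulerProduct_completely_multiplicative_hasProd (f := invPow)
    (Real.summable_nat_pow_inv.mpr hk).norm

theorem hasProd_totientConstant :
    HasProd (fun p : Nat.Primes => 1 + ((p : ℝ) * ((p : ℝ) - 1))⁻¹) totientConstant := by
  have hprod := EulerProduct.eulerProduct_hasProd
    (f := fun e : ℕ => squarefreeInvTotient e * (e : ℝ)⁻¹) (by simp [squarefreeInvTotient])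
    (fun {m n} hmn => by
      rw [squarefreeInvTotient_mul hmn, Nat.cast_mul, mul_inv, mul_mul_mul_comm])
    summable_squarefreeInvTotient_mul_inv.norm (by simp)
  refine hprod.congr_fun fun p => ?_
  have hnot_squarefree : ∀ k ∉ range 2, ¬ Squarefree ((p : ℕ) ^ k) := fun k hk hsq => by
    have hk2 : 2 ≤ k := not_lt.mp (mem_range.not.mp hk)
    exact p.2.not_isUnit (hsq _ (by rw [← sq]; exact pow_dvd_pow _ hk2))
  rw [tsum_eq_sum (s := range 2) fun k hk => by simp [squarefreeInvTotient, hnot_squarefree k hk]]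
  simp [sum_range_succ, squarefreeInvTotient, p.2.prime.squarefree, Nat.totient_prime p.2,
    Nat.cast_sub p.2.one_le, mul_comm]

theorem totientConstant_eq :
    totientConstant = (riemannZeta 2).re * (riemannZeta 3).re / (riemannZeta 6).re := by
  have hprod2 := hasProd_riemannZeta_natCast_re (k := 2) (by norm_num)
  have hprod3 := hasProd_riemannZeta_natCast_re (k := 3) (by norm_num)
  have hprod6 := hasProd_riemannZeta_natCast_re (k := 6) (by norm_num)
  have hzeta6 := (riemannZeta_natCast_re_pos (k := 6) (by norm_num)).ne'
  push_cast at hprod2 hprod3 hprod6 hzeta6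
  rw [eq_div_iff hzeta6]
  refine (hasProd_totientConstant.mul hprod6).unique ((hprod2.mul hprod3).congr_fun fun p => ?_)
  have hp1 : (1 : ℝ) < p := by exact_mod_cast p.2.one_lt
  set x : ℝ := ((p : ℕ) : ℝ)
  have hpow : ∀ k : ℕ, k ≠ 0 → x ^ k - 1 ≠ 0 := fun k hk =>
    (sub_pos.mpr (one_lt_pow₀ hp1 hk)).ne'
  have hlocal : ∀ k : ℕ, k ≠ 0 → (1 - (x ^ k)⁻¹)⁻¹ = x ^ k / (x ^ k - 1) := fun k hk => by
    have := hpow k hk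
    field_simp
  have hx1 : x - 1 ≠ 0 := by linarith
  have hx2 := hpow 2 two_ne_zero
  have hx3 := hpow 3 three_ne_zero
  have hx6 := hpow 6 (by norm_num)
  rw [hlocal 2 two_ne_zero, hlocal 3 three_ne_zero, hlocal 6 (by norm_num)]
  field_simp
  ring

theorem totientConstant_pos : 0 < totientConstant := by
  have hzeta2 := riemannZeta_natCast_re_pos (k := 2) (by norm_num)
  have hzeta3 := riemannZeta_natCast_re_pos (k := 3) (by norm_num)
  have hzeta6 := riemannZeta_natCast_re_pos (k := 6) (by norm_num)
  push_cast at hzeta2 hzeta3 hzeta6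
  rw [totientConstant_eq]
  positivity

end TotientReciprocals

section LogIntegral

open MeasureTheory

theorem continuousOn_inv_log : ContinuousOn (fun t : ℝ => 1 / Real.log t) (Set.Ici 2) := by
  have htwo_le : ∀ t ∈ Set.Ici (2 : ℝ), 2 ≤ t := fun _ ht => ht
  refine continuousOn_const.div (Real.continuousOn_log.mono fun t ht => ?_) fun t ht => ?_
  · exact (zero_lt_two.trans_le (htwo_le t ht)).ne'
  · exact (Real.log_pos (one_lt_two.trans_le (htwo_le t ht))).ne'

theorem hasDerivAt_li {t : ℝ} (ht : 2 < t) : HasDerivAt li (1 / Real.log t) t := by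
  refine intervalIntegral.integral_hasDerivAt_right ?_ ?_ ?_
  · refine (continuousOn_inv_log.mono ?_).intervalIntegrable
    rw [Set.uIcc_of_le ht.le]
    exact Set.Icc_subset_Ici_self
  · exact (continuousOn_inv_log.mono Set.Ioi_subset_Ici_self).stronglyMeasurableAtFilter
      isOpen_Ioi t ht
  · exact continuousOn_inv_log.continuousAt (Ici_mem_nhds ht)

theorem continuousOn_li : ContinuousOn li (Set.Ici 2) := by
  intro t (ht : 2 ≤ t)
  have ht1 : 2 ≤ t + 1 := by linarith
  have hprimitive : ContinuousOn li (Set.uIcc 2 (t + 1)) := by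
    refine intervalIntegral.continuousOn_primitive_interval ?_
    rw [Set.uIcc_of_le ht1]
    exact (continuousOn_inv_log.mono Set.Icc_subset_Ici_self).integrableOn_Icc
  rw [Set.uIcc_of_le ht1] at hprimitive
  refine (hprimitive t ⟨ht, by linarith⟩).mono_of_mem_nhdsWithin ?_
  rw [← Set.Ici_inter_Iic]
  exact inter_mem_nhdsWithin _ (Iic_mem_nhds (by linarith))

theorem abs_li_le {y : ℝ} (hy : 2 ≤ y) : |li y| ≤ 2 * y := by
  have hintegrand : ∀ t ∈ Set.uIoc 2 y, ‖1 / Real.log t‖ ≤ 2 := by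
    intro t ht
    rw [Set.uIoc_of_le hy] at ht
    have hlog : Real.log 2 ≤ Real.log t := Real.log_le_log two_pos ht.1.le
    have hlog2 := Real.log_two_gt_d9
    rw [Real.norm_of_nonneg (one_div_nonneg.mpr (by linarith)), div_le_iff₀ (by linarith)]
    linarith
  have hbound := intervalIntegral.norm_integral_le_of_norm_le_const hintegrand
  rw [abs_of_nonneg (by linarith)] at hbound
  exact hbound.trans (by linarith)

theorem intervalIntegrable_li_div_sq {a b : ℝ} (ha : 2 ≤ a) (hab : a ≤ b) :
    IntervalIntegrable (fun t => li t / t ^ 2) volume a b := by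
  refine ContinuousOn.intervalIntegrable ?_
  rw [Set.uIcc_of_le hab]
  refine (continuousOn_li.mono fun t ht => ha.trans ht.1).div (by fun_prop) fun t ht => ?_
  have ht2 : 2 ≤ t := ha.trans ht.1
  positivity

theorem integral_li_div_sq {a b : ℝ} (ha : 2 ≤ a) (hab : a ≤ b) :
    ∫ t in a..b, li t / t ^ 2 =
      (Real.log (Real.log b) - li b / b) - (Real.log (Real.log a) - li a / a) := by
  have hpos : ∀ t ∈ Set.Icc a b, 0 < t := fun t ht => by linarith [ht.1]
  have hlog : ∀ t ∈ Set.Icc a b, Real.log t ≠ 0 := fun t ht =>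
    (Real.log_pos (by linarith [ht.1])).ne'
  have hcont : ContinuousOn (fun t : ℝ => Real.log (Real.log t) - li t / t) (Set.Icc a b) := by
    have hlog_cont : ContinuousOn Real.log (Set.Icc a b) :=
      Real.continuousOn_log.mono fun t ht => (hpos t ht).ne'
    exact (hlog_cont.log hlog).sub ((continuousOn_li.mono fun t ht => ha.trans ht.1).div
      continuousOn_id fun t ht => (hpos t ht).ne')
  refine intervalIntegral.integral_eq_sub_of_hasDerivAt_of_le hab hcont (fun t ht => ?_)
    (intervalIntegrable_li_div_sq ha hab)
  have ht0 := (hpos t (Set.Ioo_subset_Icc_self ht)).ne'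
  have hlogt := hlog t (Set.Ioo_subset_Icc_self ht)
  refine (((Real.hasDerivAt_log ht0).log hlogt).sub
    ((hasDerivAt_li (ha.trans_lt ht.1)).div (hasDerivAt_id t) ht0)).congr_deriv ?_
  simp only [id]
  field_simp
  ring

end LogIntegral

section PrimesInProgression

open Finset MeasureTheory

/-- The error `π(y; d, 1) - li y / φ(d)` in the prime number theorem for the progression
`1 (mod d)`; `maxDiscrepancy` is the supremum of its absolute value. -/
noncomputable def discrepancy (d : ℕ) (y : ℝ) : ℝ :=
  primeCountingAP y d 1 - li y / d.totient

theorem primeCountingAP_one_eq (y : ℝ) (d : ℕ) :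
    primeCountingAP y d 1 = #{p ∈ Icc 0 ⌊y⌋₊ | p.Prime ∧ d ∣ p - 1} := by
  rw [primeCountingAP]
  congr 1
  ext p
  simp only [mem_filter, Nat.mem_primesLE, mem_Icc, zero_le, true_and, and_assoc]
  refine and_congr_right fun _ => and_congr_right fun hp => ?_
  rw [← Nat.modEq_iff_dvd' hp.one_le]
  exact Nat.ModEq.comm

theorem card_prime_dvd_sub_one_le (N d : ℕ) : #{p ∈ Icc 0 N | p.Prime ∧ d ∣ p - 1} ≤ N / d := by
  rw [← Nat.Ioc_filter_dvd_card_eq_div]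
  refine card_le_card_of_injOn (· - 1) (fun p hp => ?_) fun p hp q hq hpq => ?_
  · obtain ⟨hpN, hp, hdp⟩ := mem_filter.mp hp
    have hp2 := hp.two_le
    rw [mem_Icc] at hpN
    exact mem_filter.mpr ⟨mem_Ioc.mpr (by dsimp only; omega), hdp⟩
  · exact Nat.pred_inj (mem_filter.mp hp).2.1.pos (mem_filter.mp hq).2.1.pos hpq

theorem abs_discrepancy_le {x y : ℝ} {d : ℕ} (hd : 0 < d) (hy : 2 ≤ y) (hyx : y ≤ x) :
    |discrepancy d y| ≤ 3 * x / d.totient := by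
  have hφ : (0 : ℝ) < d.totient := by exact_mod_cast Nat.totient_pos.mpr hd
  have hφd : (d.totient : ℝ) ≤ d := by exact_mod_cast Nat.totient_le d
  have hπ : |(primeCountingAP y d 1 : ℝ)| ≤ x / d.totient := by
    rw [Nat.abs_cast, primeCountingAP_one_eq]
    calc _ ≤ ((⌊y⌋₊ / d : ℕ) : ℝ) := by exact_mod_cast card_prime_dvd_sub_one_le _ d
      _ ≤ (⌊y⌋₊ : ℝ) / d := Nat.cast_div_le
      _ ≤ x / d.totient := by
          have hx0 : 0 ≤ x := by linarith
          have hfloor : (⌊y⌋₊ : ℝ) ≤ x := (Nat.floor_le (by linarith)).trans hyx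
          gcongr
  have hli : |li y / d.totient| ≤ 2 * x / d.totient := by
    rw [abs_div, abs_of_pos hφ]
    gcongr
    exact (abs_li_le hy).trans (by linarith)
  calc |discrepancy d y| ≤ x / d.totient + 2 * x / d.totient :=
        (abs_sub _ _).trans (add_le_add hπ hli)
    _ = 3 * x / d.totient := by ring

theorem abs_discrepancy_le_maxDiscrepancy {x y : ℝ} {d : ℕ} (hd : 0 < d) (hy : 2 ≤ y)
    (hyx : y ≤ x) : |discrepancy d y| ≤ maxDiscrepancy x d := by
  refine le_ciSup (f := fun y : Set.Icc (2 : ℝ) x => |discrepancy d y|) ?_ ⟨y, hy, hyx⟩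
  exact ⟨3 * x / d.totient, Set.forall_mem_range.mpr fun z => abs_discrepancy_le hd z.2.1 z.2.2⟩

theorem maxDiscrepancy_nonneg (x : ℝ) (d : ℕ) : 0 ≤ maxDiscrepancy x d :=
  Real.iSup_nonneg fun _ => abs_nonneg _

theorem maxDiscrepancy_le {x : ℝ} {d : ℕ} (hd : 0 < d) (hx : 2 ≤ x) :
    maxDiscrepancy x d ≤ 3 * x / d.totient := by
  have : Nonempty (Set.Icc (2 : ℝ) x) := ⟨⟨2, le_rfl, hx⟩⟩
  exact ciSup_le fun z => abs_discrepancy_le hd z.2.1 z.2.2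

theorem intervalIntegrable_sum_Icc_div_sq (c : ℕ → ℝ) {a b : ℕ} (ha : 0 < a) (hab : a ≤ b) :
    IntervalIntegrable (fun t : ℝ => (∑ k ∈ Icc 0 ⌊t⌋₊, c k) / t ^ 2) volume a b := by
  have hcont : ContinuousOn (fun t : ℝ => (t ^ 2)⁻¹) (Set.Icc (a : ℝ) b) :=
    ContinuousOn.inv₀ (by fun_prop) fun t ht => by
      have : 0 < t := (Nat.cast_pos.mpr ha).trans_le ht.1
      positivity
  rw [intervalIntegrable_iff_integrableOn_Icc_of_le (Nat.cast_le.mpr hab)]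
  exact (integrableOn_mul_sum_Icc (m := 0) c (Nat.cast_nonneg a) hcont.integrableOn_Icc).congr_fun
    (fun _ _ => inv_mul_eq_div _ _) measurableSet_Icc

theorem sum_Ioc_inv_mul_eq (c : ℕ → ℝ) {a b : ℕ} (ha : 0 < a) (hab : a ≤ b) :
    ∑ k ∈ Ioc a b, (k : ℝ)⁻¹ * c k =
      (∑ k ∈ Icc 0 b, c k) / b - (∑ k ∈ Icc 0 a, c k) / a +
        ∫ t in (a : ℝ)..b, (∑ k ∈ Icc 0 ⌊t⌋₊, c k) / t ^ 2 := by
  have hpos : ∀ t ∈ Set.Icc (a : ℝ) b, 0 < t := fun t ht => (Nat.cast_pos.mpr ha).trans_le ht.1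
  have hderiv : ∀ t : ℝ, deriv (fun t : ℝ => t⁻¹) t = -(t ^ 2)⁻¹ := fun t => by simp
  have hcont : ContinuousOn (deriv fun t : ℝ => t⁻¹) (Set.Icc (a : ℝ) b) := by
    rw [funext hderiv]
    exact ContinuousOn.neg (ContinuousOn.inv₀ (by fun_prop) fun t ht =>
      (pow_pos (hpos t ht) 2).ne')
  have habel := sum_mul_eq_sub_sub_integral_mul' (f := fun t : ℝ => t⁻¹) c hab
    (fun t ht => differentiableAt_inv (hpos t ht).ne') hcont.integrableOn_Icc
  rw [habel, ← intervalIntegral.integral_of_le (Nat.cast_le.mpr hab), sub_eq_add_neg,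
    ← intervalIntegral.integral_neg, inv_mul_eq_div, inv_mul_eq_div]
  congr 2 with t
  rw [hderiv]
  ring

theorem sum_indicator_prime_dvd_sub_one (d : ℕ) (t : ℝ) :
    ∑ k ∈ Icc 0 ⌊t⌋₊, (if k.Prime ∧ d ∣ k - 1 then (1 : ℝ) else 0) = primeCountingAP t d 1 := by
  rw [primeCountingAP_one_eq, sum_boole]

theorem intervalIntegrable_primeCountingAP_div_sq {a b : ℕ} (ha : 2 ≤ a) (hab : a ≤ b) (d : ℕ) :
    IntervalIntegrable (fun t : ℝ => (primeCountingAP t d 1 : ℝ) / t ^ 2) volume a b := by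
  have h := intervalIntegrable_sum_Icc_div_sq (fun k => if k.Prime ∧ d ∣ k - 1 then (1 : ℝ) else 0)
    (by omega : 0 < a) hab
  simpa only [sum_indicator_prime_dvd_sub_one] using h

theorem sum_inv_prime_sub_eq {a b : ℕ} (ha : 2 ≤ a) (hab : a ≤ b) (d : ℕ) :
    ∑ p ∈ Ioc a b with p.Prime ∧ d ∣ p - 1, (p : ℝ)⁻¹ -
        (Real.log (Real.log b) - Real.log (Real.log a)) / d.totient =
      discrepancy d b / b - discrepancy d a / a +
        ∫ t in (a : ℝ)..b, discrepancy d t / t ^ 2 := by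
  have ha2 : (2 : ℝ) ≤ a := by exact_mod_cast ha
  have hab' : (a : ℝ) ≤ b := by exact_mod_cast hab
  set c : ℕ → ℝ := fun k => if k.Prime ∧ d ∣ k - 1 then 1 else 0 with hc
  have hcount : ∀ t : ℝ, ∑ k ∈ Icc 0 ⌊t⌋₊, c k = primeCountingAP t d 1 :=
    sum_indicator_prime_dvd_sub_one d
  have hcount_nat : ∀ n : ℕ, ∑ k ∈ Icc 0 n, c k = primeCountingAP n d 1 := fun n => by
    simpa only [Nat.floor_natCast] using hcount n
  have habel := sum_Ioc_inv_mul_eq c (by omega : 0 < a) hab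
  simp only [hcount, hcount_nat] at habel
  have hsum : ∑ p ∈ Ioc a b with p.Prime ∧ d ∣ p - 1, (p : ℝ)⁻¹ =
      ∑ k ∈ Ioc a b, (k : ℝ)⁻¹ * c k := by
    simp only [hc, mul_ite, mul_one, mul_zero, sum_filter]
  have hintegral : ∫ t in (a : ℝ)..b, discrepancy d t / t ^ 2 =
      (∫ t in (a : ℝ)..b, (primeCountingAP t d 1 : ℝ) / t ^ 2) -
        (∫ t in (a : ℝ)..b, li t / t ^ 2) / d.totient := by
    rw [← intervalIntegral.integral_div, ← intervalIntegral.integral_sub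
      (intervalIntegrable_primeCountingAP_div_sq ha hab d)
      ((intervalIntegrable_li_div_sq ha2 hab').div_const _)]
    congr 1 with t
    rw [discrepancy]
    ring
  rw [hsum, habel, hintegral, integral_li_div_sq ha2 hab', discrepancy, discrepancy]
  ring

theorem abs_sum_inv_prime_sub_le {a b d : ℕ} (ha : 2 ≤ a) (hab : a ≤ b) (hba : b ≤ 2 * a)
    (hd : 0 < d) :
    |∑ p ∈ Ioc a b with p.Prime ∧ d ∣ p - 1, (p : ℝ)⁻¹ -
      (Real.log (Real.log b) - Real.log (Real.log a)) / d.totient| ≤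
      3 * maxDiscrepancy b d / a := by
  have ha2 : (2 : ℝ) ≤ a := by exact_mod_cast ha
  have ha0 : (0 : ℝ) < a := by linarith
  have hab' : (a : ℝ) ≤ b := by exact_mod_cast hab
  have hba' : (b : ℝ) - a ≤ a := by
    have : (b : ℝ) ≤ 2 * a := by exact_mod_cast hba
    linarith
  set m := maxDiscrepancy b d
  have hm0 : 0 ≤ m := maxDiscrepancy_nonneg _ _
  have hm : ∀ t : ℝ, a ≤ t → t ≤ b → |discrepancy d t| ≤ m := fun t hat htb =>
    abs_discrepancy_le_maxDiscrepancy hd (ha2.trans hat) htb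
  have hboundary : ∀ t : ℝ, a ≤ t → t ≤ b → |discrepancy d t / t| ≤ m / a := fun t hat htb => by
    rw [abs_div, abs_of_pos (ha0.trans_le hat)]
    exact div_le_div₀ hm0 (hm t hat htb) ha0 hat
  have hintegral : |∫ t in (a : ℝ)..b, discrepancy d t / t ^ 2| ≤ m / a := by
    rw [← Real.norm_eq_abs]
    calc ‖∫ t in (a : ℝ)..b, discrepancy d t / t ^ 2‖ ≤ m / (a : ℝ) ^ 2 * |(b : ℝ) - a| := by
          refine intervalIntegral.norm_integral_le_of_norm_le_const fun t ht => ?_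
          rw [Set.uIoc_of_le hab'] at ht
          rw [Real.norm_eq_abs, abs_div, abs_sq]
          exact div_le_div₀ hm0 (hm t ht.1.le ht.2) (by positivity)
            (pow_le_pow_left₀ ha0.le ht.1.le 2)
      _ ≤ m / (a : ℝ) ^ 2 * a := by
          rw [abs_of_nonneg (sub_nonneg.mpr hab')]
          gcongr
      _ = m / a := by field_simp
  rw [sum_inv_prime_sub_eq ha hab]
  calc _ ≤ m / a + m / a + m / a :=
        (abs_add_le _ _).trans (add_le_add ((abs_sub _ _).trans
          (add_le_add (hboundary b hab' le_rfl) (hboundary a le_rfl hab'))) hintegral)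
    _ = 3 * m / a := by ring

end PrimesInProgression

section FarBlocks

open Finset

/-- The main term of `∑ 1/p` over the primes of the block `(2^j, 2^(j+1)]`, that is the increment
of `log log` over this block. Since `Real.log 0 = 0`, its value at `j = 0` is the junk `0`. -/
noncomputable def blockWeight (j : ℕ) : ℝ :=
  Real.log (j + 1 : ℕ) - Real.log j

/-- The level `2^(j(1-ε))` up to which the moduli are far from the block `j`. -/
noncomputable def farLevel (ε : ℝ) (j : ℕ) : ℕ :=
  ⌊(2 : ℝ) ^ ((j : ℝ) * (1 - ε))⌋₊

open Classical in
/-- The value of `farSum` predicted by the prime number theorem for arithmetic progressions. -/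
noncomputable def modelSum (ε : ℝ) (J d : ℕ) : ℝ :=
  ∑ j ∈ range J with IsFarBlock ε d j, blockWeight j / d.totient

/-- The mean square, weighted by `φ`, of the error of the prime number theorem in block `j`. -/
noncomputable def blockError (ε : ℝ) (j : ℕ) : ℝ :=
  ∑ d ∈ Icc 1 (farLevel ε j), (d.totient : ℝ) * (blockSum j d - blockWeight j / d.totient) ^ 2

theorem isFarBlock_iff_le_farLevel {ε : ℝ} {d j : ℕ} :
    IsFarBlock ε d j ↔ 1 ≤ j ∧ d ≤ farLevel ε j := by
  rw [IsFarBlock, farLevel, Nat.le_floor_iff (by positivity)]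

theorem farLevel_mono {ε : ℝ} (hε1 : ε ≤ 1) : Monotone (farLevel ε) := fun _ _ hij =>
  Nat.floor_le_floor (Real.rpow_le_rpow_of_exponent_le one_le_two
    (mul_le_mul_of_nonneg_right (Nat.cast_le.mpr hij) (sub_nonneg.mpr hε1)))

theorem farLevel_le_two_pow {ε : ℝ} (hε : 0 ≤ ε) (j : ℕ) : farLevel ε j ≤ 2 ^ j := by
  refine Nat.floor_le_of_le ?_
  rw [Nat.cast_pow, Nat.cast_ofNat, ← Real.rpow_natCast]
  exact Real.rpow_le_rpow_of_exponent_le one_le_two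
    (mul_le_of_le_one_right (Nat.cast_nonneg j) (by linarith))

theorem blockError_nonneg (ε : ℝ) (j : ℕ) : 0 ≤ blockError ε j :=
  sum_nonneg fun _ _ => by positivity

theorem log_log_two_pow_succ_sub {j : ℕ} (hj : 1 ≤ j) :
    Real.log (Real.log (2 ^ (j + 1))) - Real.log (Real.log (2 ^ j)) = blockWeight j := by
  have hlog2 : Real.log 2 ≠ 0 := (Real.log_pos one_lt_two).ne'
  have hj0 : (j : ℝ) ≠ 0 := Nat.cast_ne_zero.mpr (by omega)
  rw [Real.log_pow, Real.log_pow, Real.log_mul (by positivity) hlog2, Real.log_mul hj0 hlog2,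
    blockWeight]
  ring

theorem abs_blockSum_sub_sum_inv_le (j d : ℕ) :
    |blockSum j d - ∑ p ∈ Ioc (2 ^ j) (2 ^ (j + 1)) with p.Prime ∧ d ∣ p - 1, (p : ℝ)⁻¹| ≤
      2 / (2 ^ j * d) := by
  set P := {p ∈ Ioc (2 ^ j) (2 ^ (j + 1)) | p.Prime ∧ d ∣ p - 1}
  have hterm : ∀ p ∈ P, |((p : ℝ) - 1)⁻¹ - (p : ℝ)⁻¹| ≤ ((2 ^ j) ^ 2)⁻¹ := by
    intro p hp
    have hpj : (2 : ℝ) ^ j + 1 ≤ p := by exact_mod_cast (mem_Ioc.mp (mem_filter.mp hp).1).1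
    have h2j : (0 : ℝ) < 2 ^ j := by positivity
    have hp1 : (0 : ℝ) < p - 1 := by linarith
    have hp0 : (0 : ℝ) < p := by linarith
    have hsub : ((p : ℝ) - 1)⁻¹ - (p : ℝ)⁻¹ = (((p : ℝ) - 1) * p)⁻¹ := by field_simp; ring
    rw [hsub, abs_of_pos (by positivity), sq]
    gcongr <;> linarith
  have hcard : (#P : ℝ) ≤ 2 * 2 ^ j / d := by
    have hP : #P ≤ 2 ^ (j + 1) / d := by
      refine (card_le_card (filter_subset_filter _ fun p hp => ?_)).trans
        (card_prime_dvd_sub_one_le (2 ^ (j + 1)) d)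
      exact mem_Icc.mpr ⟨p.zero_le, (mem_Ioc.mp hp).2⟩
    calc (#P : ℝ) ≤ ((2 ^ (j + 1) / d : ℕ) : ℝ) := Nat.cast_le.mpr hP
      _ ≤ ((2 ^ (j + 1) : ℕ) : ℝ) / d := Nat.cast_div_le
      _ = 2 * 2 ^ j / d := by rw [pow_succ']; push_cast; rfl
  rw [blockSum, ← sum_sub_distrib]
  calc _ ≤ ∑ p ∈ P, |((p : ℝ) - 1)⁻¹ - (p : ℝ)⁻¹| := abs_sum_le_sum_abs _ _
    _ ≤ #P * ((2 ^ j) ^ 2)⁻¹ := by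
        rw [← nsmul_eq_mul]
        exact sum_le_card_nsmul _ _ _ hterm
    _ ≤ 2 * 2 ^ j / d * ((2 ^ j) ^ 2)⁻¹ := by gcongr
    _ = 2 / (2 ^ j * d) := by field_simp

theorem abs_blockSum_sub_le {j d : ℕ} (hj : 1 ≤ j) (hd : 0 < d) :
    |blockSum j d - blockWeight j / d.totient| ≤
      3 * maxDiscrepancy (2 ^ (j + 1)) d / 2 ^ j + 2 / (2 ^ j * d) := by
  have hprimes := abs_sum_inv_prime_sub_le (a := 2 ^ j) (b := 2 ^ (j + 1))
    (Nat.le_self_pow (by omega) 2) (Nat.pow_le_pow_right two_pos j.le_succ) (pow_succ' 2 j).le hd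
  push_cast at hprimes
  rw [log_log_two_pow_succ_sub hj] at hprimes
  rw [add_comm]
  exact (abs_sub_le _ _ _).trans (add_le_add (abs_blockSum_sub_sum_inv_le j d) hprimes)

theorem totient_mul_blockSum_sub_sq_le {j d : ℕ} (hj : 1 ≤ j) (hd : 0 < d) :
    (d.totient : ℝ) * (blockSum j d - blockWeight j / d.totient) ^ 2 ≤
      108 / 2 ^ j * maxDiscrepancy (2 ^ (j + 1)) d + 8 / (2 ^ j) ^ 2 := by
  have hφ : (0 : ℝ) < d.totient := by exact_mod_cast Nat.totient_pos.mpr hd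
  have hφd : (d.totient : ℝ) / (d : ℝ) ^ 2 ≤ 1 := by
    have hφ_le : (d.totient : ℝ) ≤ d := by exact_mod_cast Nat.totient_le d
    have hd1 : (1 : ℝ) ≤ d := by exact_mod_cast hd
    rw [div_le_one (by positivity)]
    nlinarith
  set m := maxDiscrepancy (2 ^ (j + 1)) d
  have hm0 : 0 ≤ m := maxDiscrepancy_nonneg _ _
  have hmφ : m * d.totient ≤ 3 * 2 ^ (j + 1) :=
    (le_div_iff₀ hφ).mp (maxDiscrepancy_le hd (le_self_pow₀ one_le_two (by omega)))
  calc (d.totient : ℝ) * (blockSum j d - blockWeight j / d.totient) ^ 2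
      ≤ d.totient * (3 * m / 2 ^ j + 2 / (2 ^ j * d)) ^ 2 := by
        gcongr ?_ * ?_
        exact sq_le_sq.mpr ((abs_blockSum_sub_le hj hd).trans (le_abs_self _))
    _ ≤ d.totient * (2 * ((3 * m / 2 ^ j) ^ 2 + (2 / (2 ^ j * d)) ^ 2)) := by
        gcongr
        exact add_sq_le
    _ = 18 / (2 ^ j) ^ 2 * (m * d.totient) * m +
          8 / (2 ^ j) ^ 2 * (d.totient / (d : ℝ) ^ 2) := by field_simp; ring
    _ ≤ 18 / (2 ^ j) ^ 2 * (3 * 2 ^ (j + 1)) * m + 8 / (2 ^ j) ^ 2 * 1 := by gcongr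
    _ = 108 / 2 ^ j * m + 8 / (2 ^ j) ^ 2 := by rw [pow_succ]; field_simp; ring

theorem blockError_le {ε : ℝ} (hε : 0 ≤ ε) {j : ℕ} (hj : 1 ≤ j) :
    blockError ε j ≤
      108 / 2 ^ j * ∑ d ∈ Icc 1 (farLevel ε j), maxDiscrepancy (2 ^ (j + 1)) d + 8 / 2 ^ j := by
  have hlevel : (farLevel ε j : ℝ) ≤ 2 ^ j := by exact_mod_cast farLevel_le_two_pow hε j
  calc blockError ε j
      ≤ ∑ d ∈ Icc 1 (farLevel ε j),
          (108 / 2 ^ j * maxDiscrepancy (2 ^ (j + 1)) d + 8 / (2 ^ j) ^ 2) :=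
        sum_le_sum fun d hd => totient_mul_blockSum_sub_sq_le hj (mem_Icc.mp hd).1
    _ = 108 / 2 ^ j * ∑ d ∈ Icc 1 (farLevel ε j), maxDiscrepancy (2 ^ (j + 1)) d +
          farLevel ε j * (8 / (2 ^ j) ^ 2) := by
        rw [sum_add_distrib, ← mul_sum, sum_const, Nat.card_Icc, add_tsub_cancel_right,
          nsmul_eq_mul]
    _ ≤ 108 / 2 ^ j * ∑ d ∈ Icc 1 (farLevel ε j), maxDiscrepancy (2 ^ (j + 1)) d +
          2 ^ j * (8 / (2 ^ j) ^ 2) := by gcongr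
    _ = _ := by field_simp

theorem exists_eventually_sum_maxDiscrepancy_le (hEH : ElliottHalberstam) {ε : ℝ} (hε : 0 < ε)
    (hε1 : ε < 1) :
    ∃ C : ℝ, 0 ≤ C ∧ ∀ᶠ j : ℕ in atTop,
      ∑ d ∈ Icc 1 (farLevel ε j), maxDiscrepancy (2 ^ (j + 1)) d ≤
        C * (2 ^ j / ((j : ℝ) + 1) ^ 4) := by
  obtain ⟨C, hC⟩ := (hEH 4 ε (by norm_num) hε).bound
  have hpow : Tendsto (fun j : ℕ => (2 : ℝ) ^ (j + 1)) atTop atTop :=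
    (tendsto_pow_atTop_atTop_of_one_lt one_lt_two).comp (tendsto_add_atTop_nat 1)
  refine ⟨32 * |C|, by positivity, ?_⟩
  filter_upwards [hpow.eventually hC] with j hj
  have hlog : ((j : ℝ) + 1) / 2 ≤ Real.log (2 ^ (j + 1)) := by
    rw [Real.log_pow, Nat.cast_add_one, div_eq_mul_inv]
    gcongr
    linarith [Real.log_two_gt_d9]
  have hlevel : farLevel ε j ≤ ⌊((2 : ℝ) ^ (j + 1)) ^ (1 - ε)⌋₊ := by
    refine (farLevel_mono hε1.le j.le_succ).trans_eq ?_
    rw [farLevel, Real.rpow_mul zero_le_two, Real.rpow_natCast]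
  calc _ ≤ ∑ d ∈ Icc 1 ⌊((2 : ℝ) ^ (j + 1)) ^ (1 - ε)⌋₊, maxDiscrepancy (2 ^ (j + 1)) d :=
        sum_le_sum_of_subset_of_nonneg (Icc_subset_Icc_right hlevel)
          fun _ _ _ => maxDiscrepancy_nonneg _ _
    _ ≤ C * ‖(2 : ℝ) ^ (j + 1) / Real.log (2 ^ (j + 1)) ^ (4 : ℝ)‖ := (le_abs_self _).trans hj
    _ ≤ |C| * (2 ^ (j + 1) / (((j : ℝ) + 1) / 2) ^ 4) := by
        have hlog0 : 0 < Real.log ((2 : ℝ) ^ (j + 1)) := hlog.trans_lt' (by positivity)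
        rw [Real.norm_of_nonneg (by positivity), ← Nat.cast_ofNat (R := ℝ) (n := 4),
          Real.rpow_natCast]
        gcongr
        exact le_abs_self C
    _ = 32 * |C| * (2 ^ j / ((j : ℝ) + 1) ^ 4) := by rw [pow_succ]; field_simp; ring

theorem summable_sq_mul_blockError (hEH : ElliottHalberstam) {ε : ℝ} (hε : 0 < ε) (hε1 : ε < 1) :
    Summable fun j : ℕ => ((j : ℝ) + 1) ^ 2 * blockError ε j := by
  obtain ⟨C, _, hC⟩ := exists_eventually_sum_maxDiscrepancy_le hEH hε hε1
  have hinv_sq : Summable fun j : ℕ => 108 * C * (((j + 1 : ℕ) : ℝ) ^ 2)⁻¹ :=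
    ((summable_nat_add_iff 1).mpr (Real.summable_nat_pow_inv.mpr one_lt_two)).mul_left _
  have hgeom : Summable fun j : ℕ => 16 * (((j + 1 : ℕ) : ℝ) ^ 2 * (1 / 2) ^ (j + 1)) :=
    ((summable_nat_add_iff 1).mpr (summable_pow_mul_geometric_of_norm_lt_one 2
      (r := (1 / 2 : ℝ)) (by norm_num))).mul_left _
  refine Summable.of_norm_bounded_eventually_nat (hinv_sq.add hgeom) ?_
  filter_upwards [hC, eventually_ge_atTop 1] with j hj hj1
  rw [Real.norm_of_nonneg (mul_nonneg (by positivity) (blockError_nonneg ε j))]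
  calc ((j : ℝ) + 1) ^ 2 * blockError ε j
      ≤ ((j : ℝ) + 1) ^ 2 * (108 / 2 ^ j * (C * (2 ^ j / ((j : ℝ) + 1) ^ 4)) + 8 / 2 ^ j) := by
        gcongr
        exact (blockError_le hε.le hj1).trans (by gcongr)
    _ = _ := by
        rw [one_div_pow, pow_succ (2 : ℝ)]
        push_cast
        field_simp
        ring

theorem sq_sum_range_le (f : ℕ → ℝ) (J : ℕ) :
    (∑ j ∈ range J, f j) ^ 2 ≤ 2 * ∑ j ∈ range J, ((j : ℝ) + 1) ^ 2 * f j ^ 2 := by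
  have hinv_sq : ∑ j ∈ range J, (((j : ℝ) + 1) ^ 2)⁻¹ ≤ 2 := by
    have h := sum_Ioo_inv_sq_le (α := ℝ) 0 (J + 1)
    rw [← Ico_add_one_left_eq_Ioo, sum_Ico_eq_sum_range] at h
    simpa [add_comm] using h
  calc (∑ j ∈ range J, f j) ^ 2
      ≤ (∑ j ∈ range J, (((j : ℝ) + 1) ^ 2)⁻¹) * ∑ j ∈ range J, ((j : ℝ) + 1) ^ 2 * f j ^ 2 := by
        refine sum_sq_le_sum_mul_sum_of_sq_le_mul _ (fun _ _ => by positivity)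
          (fun _ _ => by positivity) fun j _ => ?_
        rw [inv_mul_cancel_left₀ (by positivity)]
    _ ≤ 2 * ∑ j ∈ range J, ((j : ℝ) + 1) ^ 2 * f j ^ 2 := by
        gcongr

theorem farSum_sub_modelSum_sq_le (ε : ℝ) (J d : ℕ) :
    (farSum ε J d - modelSum ε J d) ^ 2 ≤ 2 * ∑ j ∈ range J, ((j : ℝ) + 1) ^ 2 *
      if d ≤ farLevel ε j then (blockSum j d - blockWeight j / d.totient) ^ 2 else 0 := by
  classical
  rw [farSum, modelSum, ← sum_sub_distrib, sum_filter]
  refine (sq_sum_range_le _ J).trans ?_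
  gcongr with j
  by_cases hfar : IsFarBlock ε d j
  · rw [if_pos hfar, if_pos (isFarBlock_iff_le_farLevel.mp hfar).2]
  · rw [if_neg hfar, zero_pow two_ne_zero]
    split_ifs <;> positivity

theorem exists_sum_totient_mul_farSum_sub_sq_le (hEH : ElliottHalberstam) {ε : ℝ} (hε : 0 < ε)
    (hε1 : ε < 1) :
    ∃ B : ℝ, ∀ J : ℕ,
      ∑ d ∈ Icc 1 (2 ^ J), (d.totient : ℝ) * (farSum ε J d - modelSum ε J d) ^ 2 ≤ B := by
  refine ⟨2 * ∑' j : ℕ, ((j : ℝ) + 1) ^ 2 * blockError ε j, fun J => ?_⟩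
  set E : ℕ → ℕ → ℝ := fun j d =>
    if d ≤ farLevel ε j then (blockSum j d - blockWeight j / d.totient) ^ 2 else 0 with hE
  have hblock : ∀ j, ∑ d ∈ Icc 1 (2 ^ J), (d.totient : ℝ) * E j d ≤ blockError ε j := by
    intro j
    simp only [hE, mul_ite, mul_zero]
    rw [← sum_filter]
    refine sum_le_sum_of_subset_of_nonneg (fun d hd => ?_) fun _ _ _ => by positivity
    obtain ⟨hd, hlevel⟩ := mem_filter.mp hd
    exact mem_Icc.mpr ⟨(mem_Icc.mp hd).1, hlevel⟩
  calc ∑ d ∈ Icc 1 (2 ^ J), (d.totient : ℝ) * (farSum ε J d - modelSum ε J d) ^ 2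
      ≤ ∑ d ∈ Icc 1 (2 ^ J), (d.totient : ℝ) *
          (2 * ∑ j ∈ range J, ((j : ℝ) + 1) ^ 2 * E j d) := by
        gcongr with d
        exact farSum_sub_modelSum_sq_le ε J d
    _ = 2 * ∑ j ∈ range J, ((j : ℝ) + 1) ^ 2 * ∑ d ∈ Icc 1 (2 ^ J), (d.totient : ℝ) * E j d := by
        simp only [mul_sum]
        rw [sum_comm]
        exact sum_congr rfl fun j _ => sum_congr rfl fun d _ => by ring
    _ ≤ 2 * ∑ j ∈ range J, ((j : ℝ) + 1) ^ 2 * blockError ε j := by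
        gcongr with j
        exact hblock j
    _ ≤ 2 * ∑' j : ℕ, ((j : ℝ) + 1) ^ 2 * blockError ε j := by
        gcongr
        exact (summable_sq_mul_blockError hEH hε hε1).sum_le_tsum _ fun j _ =>
          mul_nonneg (by positivity) (blockError_nonneg ε j)

end FarBlocks

section ModelMeanSquare

open Finset

theorem blockWeight_zero : blockWeight 0 = 0 := by
  simp [blockWeight]

theorem blockWeight_nonneg (j : ℕ) : 0 ≤ blockWeight j := by
  rcases Nat.eq_zero_or_pos j with rfl | hj
  · exact blockWeight_zero.ge
  · exact sub_nonneg.mpr (Real.log_le_log (Nat.cast_pos.mpr hj) (Nat.cast_le.mpr j.le_succ))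

theorem sum_range_blockWeight (J : ℕ) : ∑ j ∈ range J, blockWeight j = Real.log J := by
  simp only [blockWeight]
  rw [sum_range_sub (fun j : ℕ => Real.log j), Nat.cast_zero, Real.log_zero, sub_zero]

theorem sum_Ico_blockWeight {m J : ℕ} (hm : 1 ≤ m) (hmJ : m ≤ J) :
    ∑ j ∈ Ico m J, blockWeight j = Real.log ((J : ℝ) / m) := by
  simp only [blockWeight]
  rw [sum_Ico_sub (fun j : ℕ => Real.log j) hmJ,
    Real.log_div (Nat.cast_ne_zero.mpr (by omega)) (Nat.cast_ne_zero.mpr (by omega))]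

theorem sum_sum_mul_mul_min (a : ℕ → ℝ) (J : ℕ) :
    ∑ i ∈ range J, ∑ j ∈ range J, a i * a j * (min i j : ℕ) =
      ∑ m ∈ Ico 1 J, (∑ i ∈ Ico m J, a i) ^ 2 := by
  have hmin : ∀ i ∈ range J, ∀ j, a i * a j * (min i j : ℕ) =
      ∑ m ∈ Ico 1 J, (if m ≤ i then a i else 0) * if m ≤ j then a j else 0 := by
    intro i hi j
    have hfilter : {m ∈ Ico 1 J | m ≤ i ∧ m ≤ j} = Icc 1 (min i j) := by
      have hiJ := mem_range.mp hi
      ext m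
      simp only [mem_filter, mem_Ico, mem_Icc, le_min_iff]
      omega
    calc a i * a j * (min i j : ℕ) = ∑ m ∈ Ico 1 J with m ≤ i ∧ m ≤ j, a i * a j := by
          rw [hfilter, sum_const, Nat.card_Icc, add_tsub_cancel_right, nsmul_eq_mul, mul_comm]
      _ = _ := by
          rw [sum_filter]
          exact sum_congr rfl fun m _ => by rw [ite_and, ite_mul, mul_ite, zero_mul, mul_zero]
  have hIco : ∀ m, ∑ i ∈ Ico m J, a i = ∑ i ∈ range J, if m ≤ i then a i else 0 := by
    intro m
    rw [← sum_filter]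
    congr 1
    ext i
    simp only [mem_filter, mem_range, mem_Ico, and_comm]
  calc _ = ∑ i ∈ range J, ∑ m ∈ Ico 1 J, ∑ j ∈ range J,
        (if m ≤ i then a i else 0) * (if m ≤ j then a j else 0) := by
        refine sum_congr rfl fun i hi => ?_
        rw [sum_comm]
        exact sum_congr rfl fun j _ => hmin i hi j
    _ = _ := by
        rw [sum_comm]
        exact sum_congr rfl fun m _ => by rw [hIco, sq, sum_mul_sum]

theorem sum_sum_blockWeight_mul_mul_min (J : ℕ) :
    ∑ i ∈ range J, ∑ j ∈ range J, blockWeight i * blockWeight j * (min i j : ℕ) =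
      ∑ m ∈ Ico 1 J, Real.log ((J : ℝ) / m) ^ 2 := by
  rw [sum_sum_mul_mul_min]
  refine sum_congr rfl fun m hm => ?_
  obtain ⟨hm1, hmJ⟩ := mem_Ico.mp hm
  rw [sum_Ico_blockWeight hm1 hmJ.le]

theorem integral_log_div_sq {J : ℝ} (hJ : 1 ≤ J) :
    ∫ t in (1 : ℝ)..J, Real.log (J / t) ^ 2 =
      2 * J - (Real.log J ^ 2 + 2 * Real.log J + 2) := by
  have hJ0 : J ≠ 0 := by linarith
  have hpos : ∀ t ∈ Set.uIcc 1 J, t ≠ 0 := fun t ht => by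
    rw [Set.uIcc_of_le hJ] at ht
    linarith [ht.1]
  have hderiv : ∀ t ∈ Set.uIcc 1 J, HasDerivAt
      (fun t : ℝ => t * (Real.log (J / t) ^ 2 + 2 * Real.log (J / t) + 2))
      (Real.log (J / t) ^ 2) t := by
    intro t ht
    have ht0 := hpos t ht
    have hlog : HasDerivAt (fun t : ℝ => Real.log (J / t)) (-1 / t) t := by
      refine (((hasDerivAt_const t J).div (hasDerivAt_id t) ht0).log
        (div_ne_zero hJ0 ht0)).congr_deriv ?_
      simp only [id, Pi.div_apply]
      field_simp
      ring
    refine ((hasDerivAt_id t).mul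
      (((hlog.pow 2).add (hlog.const_mul 2)).add_const 2)).congr_deriv ?_
    simp only [id, Pi.add_apply, Pi.pow_apply]
    field_simp
    ring
  have hcont : ContinuousOn (fun t : ℝ => Real.log (J / t) ^ 2) (Set.uIcc 1 J) :=
    ((continuousOn_const.div continuousOn_id hpos).log
      fun t ht => div_ne_zero hJ0 (hpos t ht)).pow 2
  rw [intervalIntegral.integral_eq_sub_of_hasDerivAt hderiv hcont.intervalIntegrable,
    div_self hJ0, div_one, Real.log_one]
  ring

theorem antitoneOn_log_div_sq (J : ℕ) :
    AntitoneOn (fun t : ℝ => Real.log ((J : ℝ) / t) ^ 2) (Set.Icc ((1 : ℕ) : ℝ) J) := by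
  intro s hs t ht hst
  rw [Nat.cast_one] at hs
  have hs0 : 0 < s := zero_lt_one.trans_le hs.1
  have ht0 : 0 < t := hs0.trans_le hst
  have hJ0 : (0 : ℝ) < J := ht0.trans_le ht.2
  refine pow_le_pow_left₀ (Real.log_nonneg ((one_le_div ht0).mpr ht.2))
    (Real.log_le_log (by positivity) ?_) 2
  gcongr

theorem le_sum_log_div_sq {J : ℕ} (hJ : 1 ≤ J) :
    2 * (J : ℝ) - (2 * Real.log J ^ 2 + 3) ≤ ∑ m ∈ Ico 1 J, Real.log ((J : ℝ) / m) ^ 2 := by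
  have hintegral := (antitoneOn_log_div_sq J).integral_le_sum_Ico hJ
  rw [Nat.cast_one, integral_log_div_sq (by exact_mod_cast hJ)] at hintegral
  linarith [sq_nonneg (Real.log J - 1), sub_sq (Real.log J) 1]

theorem sum_log_div_sq_le (J : ℕ) :
    ∑ m ∈ Ico 1 J, Real.log ((J : ℝ) / m) ^ 2 ≤ 2 * J := by
  rcases Nat.eq_zero_or_pos J with rfl | hJ
  · simp
  have hJ1 : (1 : ℝ) ≤ J := by exact_mod_cast hJ
  have hintegral := (antitoneOn_log_div_sq J).sum_le_integral_Ico hJ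
  rw [Nat.cast_one, integral_log_div_sq hJ1,
    sum_Ico_add' (fun m : ℕ => Real.log ((J : ℝ) / m) ^ 2) 1 J 1] at hintegral
  have hbot := sum_eq_sum_Ico_succ_bot (Nat.lt_succ_of_le hJ)
    fun m : ℕ => Real.log ((J : ℝ) / m) ^ 2
  have htop := sum_Ico_succ_top hJ fun m : ℕ => Real.log ((J : ℝ) / m) ^ 2
  rw [Nat.cast_one, div_one] at hbot
  linarith [sq_nonneg (Real.log ((J : ℝ) / J)), Real.log_nonneg hJ1]

theorem tendsto_log_sq_div_natCast :
    Tendsto (fun J : ℕ => Real.log J ^ 2 / J) atTop (nhds 0) :=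
  (Real.isLittleO_pow_log_id_atTop (n := 2)).tendsto_div_nhds_zero.comp
    tendsto_natCast_atTop_atTop

theorem tendsto_sum_log_div_sq :
    Tendsto (fun J : ℕ => (∑ m ∈ Ico 1 J, Real.log ((J : ℝ) / m) ^ 2) / J) atTop (nhds 2) := by
  have hlower : Tendsto (fun J : ℕ => 2 - (2 * (Real.log J ^ 2 / J) + 3 * (J : ℝ)⁻¹))
      atTop (nhds 2) := by
    simpa using ((tendsto_log_sq_div_natCast.const_mul 2).add
      (tendsto_inv_atTop_nhds_zero_nat.const_mul 3)).const_sub 2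
  refine tendsto_of_tendsto_of_tendsto_of_le_of_le' hlower tendsto_const_nhds ?_ ?_ <;>
    filter_upwards [eventually_ge_atTop 1] with J hJ
  · have hJ0 : (0 : ℝ) < J := by exact_mod_cast hJ
    rw [le_div_iff₀ hJ0]
    refine (le_of_eq ?_).trans (le_sum_log_div_sq hJ)
    field_simp
  · exact div_le_of_le_mul₀ (Nat.cast_nonneg J) zero_le_two (sum_log_div_sq_le J)

theorem exists_abs_sub_le_of_tendsto_div {G : ℕ → ℝ} {c δ : ℝ} (hδ : 0 < δ)
    (hG : Tendsto (fun m : ℕ => G m / m) atTop (nhds c)) :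
    ∃ K : ℝ, ∀ m : ℕ, |G m - c * m| ≤ δ * m + K := by
  have hbdd : IsBoundedUnder (· ≤ ·) atTop fun m : ℕ => |G m - c * m| - δ * m := by
    refine isBoundedUnder_of_eventually_le (a := 0) ?_
    filter_upwards [Metric.tendsto_nhds.mp hG δ hδ, eventually_gt_atTop 0] with m hm hm0
    have hm0' : (0 : ℝ) < m := Nat.cast_pos.mpr hm0
    rw [Real.dist_eq, div_sub' hm0'.ne', abs_div, abs_of_pos hm0', div_lt_iff₀ hm0'] at hm
    rw [mul_comm c]
    linarith
  obtain ⟨K, hK⟩ := hbdd.bddAbove_range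
  exact ⟨K, fun m => by linarith [hK (Set.mem_range_self m)]⟩

theorem abs_sum_sum_blockWeight_sub_le {G : ℕ → ℝ} {c δ K : ℝ}
    (hG : ∀ m : ℕ, |G m - c * m| ≤ δ * m + K) (J : ℕ) :
    |∑ i ∈ range J, ∑ j ∈ range J, blockWeight i * blockWeight j * G (min i j) -
        c * ∑ m ∈ Ico 1 J, Real.log ((J : ℝ) / m) ^ 2| ≤
      δ * ∑ m ∈ Ico 1 J, Real.log ((J : ℝ) / m) ^ 2 + K * Real.log J ^ 2 := by
  have hweight : ∀ i j, 0 ≤ blockWeight i * blockWeight j := fun i j =>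
    mul_nonneg (blockWeight_nonneg i) (blockWeight_nonneg j)
  rw [← sum_sum_blockWeight_mul_mul_min, ← sum_range_blockWeight, sq, sum_mul_sum]
  calc _ = |∑ i ∈ range J, ∑ j ∈ range J,
        blockWeight i * blockWeight j * (G (min i j) - c * (min i j : ℕ))| := by
        simp only [mul_sum, ← sum_sub_distrib, mul_sub, mul_left_comm c]
    _ ≤ ∑ i ∈ range J, ∑ j ∈ range J,
        blockWeight i * blockWeight j * (δ * (min i j : ℕ) + K) := by
        refine (abs_sum_le_sum_abs _ _).trans (sum_le_sum fun i _ => ?_)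
        refine (abs_sum_le_sum_abs _ _).trans (sum_le_sum fun j _ => ?_)
        rw [abs_mul, abs_of_nonneg (hweight i j)]
        exact mul_le_mul_of_nonneg_left (hG _) (hweight i j)
    _ = _ := by
        simp only [mul_add, sum_add_distrib, mul_sum, sum_mul, mul_left_comm δ, mul_comm K]

theorem tendsto_sum_sum_blockWeight_div {G : ℕ → ℝ} {c : ℝ}
    (hG : Tendsto (fun m : ℕ => G m / m) atTop (nhds c)) :
    Tendsto (fun J : ℕ => (∑ i ∈ range J, ∑ j ∈ range J,
      blockWeight i * blockWeight j * G (min i j)) / J) atTop (nhds (2 * c)) := by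
  set W : ℕ → ℝ := fun J => ∑ m ∈ Ico 1 J, Real.log ((J : ℝ) / m) ^ 2
  set S : ℕ → ℝ := fun J => ∑ i ∈ range J, ∑ j ∈ range J,
    blockWeight i * blockWeight j * G (min i j)
  have hdiff : Tendsto (fun J : ℕ => S J / J - c * (W J / J)) atTop (nhds 0) := by
    refine Metric.tendsto_nhds.mpr fun η hη => ?_
    obtain ⟨K, hK⟩ := exists_abs_sub_le_of_tendsto_div (δ := η / 4) (by positivity) hG
    have hlog : Tendsto (fun J : ℕ => K * (Real.log J ^ 2 / J)) atTop (nhds 0) := by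
      simpa only [mul_zero] using tendsto_log_sq_div_natCast.const_mul K
    filter_upwards [hlog.eventually_lt_const (half_pos hη), eventually_gt_atTop 0] with J hJlog hJ
    have hJ0 : (0 : ℝ) < J := Nat.cast_pos.mpr hJ
    rw [dist_zero_right, Real.norm_eq_abs, ← mul_div_assoc, ← sub_div, abs_div, abs_of_pos hJ0]
    calc _ ≤ (η / 4 * (2 * J) + K * Real.log J ^ 2) / J := by
          gcongr
          refine (abs_sum_sum_blockWeight_sub_le hK J).trans ?_
          gcongr
          exact sum_log_div_sq_le J
      _ = η / 2 + K * (Real.log J ^ 2 / J) := by field_simp; ring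
      _ < η := by linarith
  have hsum := hdiff.add (tendsto_sum_log_div_sq.const_mul c)
  simp only [W, sub_add_cancel, zero_add] at hsum
  rwa [mul_comm c 2] at hsum

theorem tendsto_two_rpow_mul_atTop {ε : ℝ} (hε1 : ε < 1) :
    Tendsto (fun m : ℕ => (2 : ℝ) ^ ((m : ℝ) * (1 - ε))) atTop atTop :=
  (tendsto_rpow_atTop_of_base_gt_one 2 one_lt_two).comp
    (tendsto_natCast_atTop_atTop.atTop_mul_const (sub_pos.mpr hε1))

theorem tendsto_log_farLevel_div {ε : ℝ} (hε1 : ε < 1) :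
    Tendsto (fun m : ℕ => Real.log (farLevel ε m) / m) atTop (nhds ((1 - ε) * Real.log 2)) := by
  have hy := tendsto_two_rpow_mul_atTop hε1
  have hfloor : Tendsto (fun m : ℕ => Real.log
      (farLevel ε m / (2 : ℝ) ^ ((m : ℝ) * (1 - ε))) / m) atTop (nhds 0) :=
    ((tendsto_nat_floor_div_atTop.comp hy).log one_ne_zero).div_atTop tendsto_natCast_atTop_atTop
  have hsum := hfloor.add_const ((1 - ε) * Real.log 2)
  rw [zero_add] at hsum
  refine hsum.congr' ?_
  filter_upwards [hy.eventually_ge_atTop 1, eventually_gt_atTop 0] with m hm hm0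
  have hm0' : (m : ℝ) ≠ 0 := Nat.cast_ne_zero.mpr hm0.ne'
  have hlevel : (farLevel ε m : ℝ) ≠ 0 :=
    Nat.cast_ne_zero.mpr (Nat.one_le_iff_ne_zero.mp ((Nat.one_le_floor_iff _).mpr hm))
  rw [Real.log_div hlevel (by positivity), Real.log_rpow two_pos]
  field_simp
  ring

theorem tendsto_sum_inv_totient_farLevel_div {ε : ℝ} (hε1 : ε < 1) :
    Tendsto (fun m : ℕ => (∑ d ∈ Icc 1 (farLevel ε m), (d.totient : ℝ)⁻¹) / m) atTop
      (nhds (totientConstant * ((1 - ε) * Real.log 2))) := by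
  have hlevel : Tendsto (farLevel ε) atTop atTop :=
    tendsto_nat_floor_atTop.comp (tendsto_two_rpow_mul_atTop hε1)
  refine ((tendsto_sum_inv_totient_div_log.comp hlevel).mul
    (tendsto_log_farLevel_div hε1)).congr' ?_
  filter_upwards [hlevel.eventually_ge_atTop 2] with m hm
  have hlog : Real.log (farLevel ε m) ≠ 0 := (Real.log_pos (by exact_mod_cast hm)).ne'
  exact div_mul_div_cancel₀ hlog

theorem modelSum_eq (ε : ℝ) (J d : ℕ) :
    modelSum ε J d =
      (∑ j ∈ range J, if d ≤ farLevel ε j then blockWeight j else 0) / d.totient := by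
  rw [modelSum, sum_filter, sum_div]
  refine sum_congr rfl fun j _ => ?_
  rcases Nat.eq_zero_or_pos j with rfl | hj
  · simp [blockWeight_zero]
  · simp only [isFarBlock_iff_le_farLevel, Nat.one_le_iff_ne_zero.mpr hj.ne', true_and, ite_div,
      zero_div]

theorem totient_mul_modelSum_sq_eq {ε : ℝ} (hε1 : ε ≤ 1) (J : ℕ) {d : ℕ} (hd : 0 < d) :
    (d.totient : ℝ) * modelSum ε J d ^ 2 = ∑ i ∈ range J, ∑ j ∈ range J,
      if d ≤ farLevel ε (min i j) then blockWeight i * blockWeight j * (d.totient : ℝ)⁻¹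
      else 0 := by
  have hφ : (d.totient : ℝ) ≠ 0 := Nat.cast_ne_zero.mpr (Nat.totient_pos.mpr hd).ne'
  set w : ℕ → ℝ := fun j => if d ≤ farLevel ε j then blockWeight j else 0 with hw
  calc (d.totient : ℝ) * modelSum ε J d ^ 2 = (∑ j ∈ range J, w j) ^ 2 * (d.totient : ℝ)⁻¹ := by
        rw [modelSum_eq, div_pow]
        change _ * ((∑ j ∈ range J, w j) ^ 2 / _) = _
        field_simp
    _ = ∑ i ∈ range J, ∑ j ∈ range J, w i * w j * (d.totient : ℝ)⁻¹ := by
        rw [sq, sum_mul_sum]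
        simp only [sum_mul]
    _ = _ := by
        refine sum_congr rfl fun i _ => sum_congr rfl fun j _ => ?_
        by_cases hi : d ≤ farLevel ε i <;> by_cases hj : d ≤ farLevel ε j <;>
          simp [hw, (farLevel_mono hε1).map_min, hi, hj]

theorem sum_totient_mul_modelSum_sq_eq {ε : ℝ} (hε : 0 ≤ ε) (hε1 : ε ≤ 1) (J : ℕ) :
    ∑ d ∈ Icc 1 (2 ^ J), (d.totient : ℝ) * modelSum ε J d ^ 2 =
      ∑ i ∈ range J, ∑ j ∈ range J, blockWeight i * blockWeight j *
        ∑ d ∈ Icc 1 (farLevel ε (min i j)), (d.totient : ℝ)⁻¹ := by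
  have hfilter : ∀ i ∈ range J, ∀ j,
      {d ∈ Icc 1 (2 ^ J) | d ≤ farLevel ε (min i j)} = Icc 1 (farLevel ε (min i j)) := by
    intro i hi j
    have hlevel : farLevel ε (min i j) ≤ 2 ^ J :=
      (farLevel_le_two_pow hε _).trans (Nat.pow_le_pow_right two_pos
        ((min_le_left i j).trans (mem_range.mp hi).le))
    ext d
    simp only [mem_filter, mem_Icc]
    exact ⟨fun h => ⟨h.1.1, h.2⟩, fun h => ⟨⟨h.1, h.2.trans hlevel⟩, h.2⟩⟩
  calc _ = ∑ d ∈ Icc 1 (2 ^ J), ∑ i ∈ range J, ∑ j ∈ range J,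
        if d ≤ farLevel ε (min i j) then blockWeight i * blockWeight j * (d.totient : ℝ)⁻¹
        else 0 :=
        sum_congr rfl fun d hd => totient_mul_modelSum_sq_eq hε1 J (mem_Icc.mp hd).1
    _ = ∑ i ∈ range J, ∑ j ∈ range J, ∑ d ∈ Icc 1 (2 ^ J),
        if d ≤ farLevel ε (min i j) then blockWeight i * blockWeight j * (d.totient : ℝ)⁻¹
        else 0 := by
        rw [sum_comm]
        exact sum_congr rfl fun i _ => sum_comm
    _ = _ := by
        refine sum_congr rfl fun i hi => sum_congr rfl fun j _ => ?_
        rw [← sum_filter, hfilter i hi j, mul_sum]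

theorem tendsto_sum_totient_mul_modelSum_sq {ε : ℝ} (hε : 0 ≤ ε) (hε1 : ε < 1) :
    Tendsto (fun J : ℕ => (∑ d ∈ Icc 1 (2 ^ J), (d.totient : ℝ) * modelSum ε J d ^ 2) / J) atTop
      (nhds (2 * (totientConstant * ((1 - ε) * Real.log 2)))) := by
  simp only [sum_totient_mul_modelSum_sq_eq hε hε1.le]
  exact tendsto_sum_sum_blockWeight_div
    (G := fun m => ∑ d ∈ Icc 1 (farLevel ε m), (d.totient : ℝ)⁻¹)
    (tendsto_sum_inv_totient_farLevel_div hε1)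

end ModelMeanSquare

section MainAsymptotic

open Finset

theorem inv_lcm_eq_sum_totient {a b N : ℕ} (ha : 0 < a) (hb : 0 < b) (haN : a ≤ N) :
    (Nat.lcm a b : ℝ)⁻¹ = ∑ d ∈ Icc 1 N, (d.totient : ℝ) *
      ((if d ∣ a then (a : ℝ)⁻¹ else 0) * (if d ∣ b then (b : ℝ)⁻¹ else 0)) := by
  have hgcd : (Nat.gcd a b : ℝ) = ∑ d ∈ Icc 1 N with d ∣ a ∧ d ∣ b, (d.totient : ℝ) := by
    have hdivisors : (Nat.gcd a b).divisors = {d ∈ Icc 1 N | d ∣ a ∧ d ∣ b} := by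
      ext d
      simp only [Nat.mem_divisors, mem_filter, mem_Icc, Nat.dvd_gcd_iff]
      exact ⟨fun h => ⟨⟨Nat.pos_of_dvd_of_pos h.1.1 ha, (Nat.le_of_dvd ha h.1.1).trans haN⟩, h.1⟩,
        fun h => ⟨h.2, (Nat.gcd_pos_of_pos_left b ha).ne'⟩⟩
    rw [← hdivisors]
    exact_mod_cast (Nat.sum_totient (Nat.gcd a b)).symm
  have hlcm : (Nat.lcm a b : ℝ)⁻¹ = Nat.gcd a b * ((a : ℝ)⁻¹ * (b : ℝ)⁻¹) := by
    have hmul : (Nat.gcd a b : ℝ) * Nat.lcm a b = a * b := by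
      exact_mod_cast Nat.gcd_mul_lcm a b
    have hlcm0 : (Nat.lcm a b : ℝ) ≠ 0 := Nat.cast_ne_zero.mpr (Nat.lcm_pos ha hb).ne'
    rw [← mul_inv, ← hmul]
    field_simp
  rw [hlcm, hgcd, sum_filter, sum_mul]
  refine sum_congr rfl fun d _ => ?_
  by_cases hda : d ∣ a <;> by_cases hdb : d ∣ b <;> simp [hda, hdb]

theorem primesLE_two_pow_eq_biUnion (J : ℕ) :
    Nat.primesLE (2 ^ J) =
      (range J).biUnion fun j => {p ∈ Ioc (2 ^ j) (2 ^ (j + 1)) | p.Prime} := by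
  ext p
  simp only [Nat.mem_primesLE, mem_biUnion, mem_range, mem_filter, mem_Ioc]
  constructor
  · rintro ⟨hpJ, hp⟩
    have hp2 := hp.two_le
    have hlow := Nat.pow_log_le_self 2 (show p - 1 ≠ 0 by omega)
    have hhigh := Nat.lt_pow_succ_log_self one_lt_two (p - 1)
    refine ⟨Nat.log 2 (p - 1), ?_, ⟨by omega, by omega⟩, hp⟩
    exact (Nat.pow_lt_pow_iff_right one_lt_two).mp (by omega)
  · rintro ⟨j, hj, ⟨-, hpj⟩, hp⟩
    exact ⟨hpj.trans (Nat.pow_le_pow_right two_pos hj), hp⟩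

theorem sum_range_blockSum (J d : ℕ) :
    ∑ j ∈ range J, blockSum j d =
      ∑ p ∈ Nat.primesLE (2 ^ J), if d ∣ p - 1 then ((p - 1 : ℕ) : ℝ)⁻¹ else 0 := by
  have hdisjoint : (range J : Set ℕ).PairwiseDisjoint
      fun j => {p ∈ Ioc (2 ^ j) (2 ^ (j + 1)) | p.Prime} :=
    (pairwiseDisjoint_Ioc_two_pow _).mono fun _ => filter_subset _ _
  rw [primesLE_two_pow_eq_biUnion, sum_biUnion hdisjoint]
  refine sum_congr rfl fun j _ => ?_
  rw [blockSum, ← filter_filter, sum_filter (fun p => d ∣ p - 1)]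
  exact sum_congr rfl fun p hp => by rw [Nat.cast_pred (mem_filter.mp hp).2.pos]

theorem lcmSum_two_pow (J : ℕ) :
    lcmSum (2 ^ J) = ∑ d ∈ Icc 1 (2 ^ J), (d.totient : ℝ) * (∑ j ∈ range J, blockSum j d) ^ 2 := by
  have hfloor : ⌊(2 : ℝ) ^ J⌋₊ = 2 ^ J := by
    exact_mod_cast Nat.floor_natCast (R := ℝ) (2 ^ J)
  simp only [lcmSum, hfloor, sum_range_blockSum, sq, sum_mul_sum]
  simp only [mul_sum]
  rw [sum_comm (s := Icc 1 (2 ^ J))]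
  refine sum_congr rfl fun p hp => ?_
  rw [sum_comm (s := Icc 1 (2 ^ J))]
  refine sum_congr rfl fun q hq => ?_
  rw [one_div]
  exact inv_lcm_eq_sum_totient (Nat.sub_pos_of_lt (Nat.one_lt_of_mem_primesLE hp))
    (Nat.sub_pos_of_lt (Nat.one_lt_of_mem_primesLE hq))
    ((Nat.sub_le _ _).trans (Nat.le_of_mem_primesLE hp))

theorem exists_sum_totient_mul_sub_modelSum_sq_le (hEH : ElliottHalberstam) :
    ∃ C : ℝ, ∀ ε : ℝ, 0 < ε → ε ≤ 1 / 4 → ∃ B : ℝ, ∀ J : ℕ, ∑ d ∈ Icc 1 (2 ^ J),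
      (d.totient : ℝ) * (∑ j ∈ range J, blockSum j d - modelSum ε J d) ^ 2 ≤ C * ε * J + B := by
  obtain ⟨C, hnear⟩ := exists_sum_totient_mul_nearSum_sq_le
  refine ⟨2 * C, fun ε hε hε4 => ?_⟩
  obtain ⟨B₁, hB₁⟩ := hnear ε hε hε4
  obtain ⟨B₂, hB₂⟩ := exists_sum_totient_mul_farSum_sub_sq_le hEH hε (by linarith)
  refine ⟨2 * (B₁ + B₂), fun J => ?_⟩
  calc _ ≤ ∑ d ∈ Icc 1 (2 ^ J), 2 * ((d.totient : ℝ) * nearSum ε J d ^ 2 +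
        d.totient * (farSum ε J d - modelSum ε J d) ^ 2) := by
        refine sum_le_sum fun d _ => ?_
        rw [← nearSum_add_farSum ε, add_sub_assoc, ← mul_add, mul_left_comm]
        exact mul_le_mul_of_nonneg_left add_sq_le (Nat.cast_nonneg _)
    _ ≤ _ := by
        rw [← mul_sum, sum_add_distrib]
        linarith [hB₁ J, hB₂ J]

theorem abs_sqrt_sum_mul_sq_sub_le {ι : Type*} (s : Finset ι) {w : ι → ℝ} (hw : ∀ i, 0 ≤ w i)
    (f g : ι → ℝ) :
    |√(∑ i ∈ s, w i * f i ^ 2) - √(∑ i ∈ s, w i * g i ^ 2)| ≤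
      √(∑ i ∈ s, w i * (f i - g i) ^ 2) := by
  let v (h : ι → ℝ) : EuclideanSpace ℝ s := WithLp.toLp 2 fun i => √(w i) * h i
  have hnorm (h : ι → ℝ) : ‖v h‖ = √(∑ i ∈ s, w i * h i ^ 2) := by
    simp only [v, EuclideanSpace.norm_eq, Real.norm_eq_abs, sq_abs, mul_pow, Real.sq_sqrt (hw _)]
    rw [sum_coe_sort s fun i => w i * h i ^ 2]
  have hsub : v f - v g = v (fun i => f i - g i) := by
    ext i
    simp only [v, PiLp.sub_apply, mul_sub]
  rw [← hnorm, ← hnorm, ← hnorm, ← hsub]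
  exact abs_norm_sub_norm_le _ _

theorem abs_sqrt_lcmSum_div_sub_le (ε : ℝ) (J : ℕ) :
    |√(lcmSum (2 ^ J) / J) -
        √((∑ d ∈ Icc 1 (2 ^ J), (d.totient : ℝ) * modelSum ε J d ^ 2) / J)| ≤
      √((∑ d ∈ Icc 1 (2 ^ J),
        (d.totient : ℝ) * (∑ j ∈ range J, blockSum j d - modelSum ε J d) ^ 2) / J) := by
  rw [lcmSum_two_pow, Real.sqrt_div' _ J.cast_nonneg, Real.sqrt_div' _ J.cast_nonneg,
    Real.sqrt_div' _ J.cast_nonneg, ← sub_div, abs_div, abs_of_nonneg (Real.sqrt_nonneg J)]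
  gcongr
  exact abs_sqrt_sum_mul_sq_sub_le _ (fun _ => Nat.cast_nonneg _) _ _

theorem lcmSum_nonneg (x : ℝ) : 0 ≤ lcmSum x :=
  sum_nonneg fun _ _ => sum_nonneg fun _ _ => by positivity

theorem tendsto_lcmSum_two_pow_div (hEH : ElliottHalberstam) :
    Tendsto (fun J : ℕ => lcmSum (2 ^ J) / J) atTop
      (nhds (2 * (totientConstant * Real.log 2))) := by
  set M : ℝ → ℕ → ℝ := fun ε J => (∑ d ∈ Icc 1 (2 ^ J), (d.totient : ℝ) * modelSum ε J d ^ 2) / J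
  set m : ℝ → ℝ := fun ε => 2 * (totientConstant * ((1 - ε) * Real.log 2))
  obtain ⟨C, hC⟩ := exists_sum_totient_mul_sub_modelSum_sq_le hEH
  suffices hsqrt : Tendsto (fun J : ℕ => √(lcmSum (2 ^ J) / J)) atTop (nhds √(m 0)) by
    have hm0 : 0 ≤ m 0 := by
      have := totientConstant_pos
      simp only [m]
      positivity
    have hsq := hsqrt.pow 2
    rw [Real.sq_sqrt hm0] at hsq
    simpa only [m, sub_zero, one_mul, Real.sq_sqrt (div_nonneg (lcmSum_nonneg _)
      (Nat.cast_nonneg _))] using hsq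
  refine Metric.tendsto_nhds.mpr fun δ hδ => ?_
  have herror : ∀ᶠ ε in nhdsWithin 0 (Set.Ioi 0), √(C * ε) + |√(m ε) - √(m 0)| < δ := by
    have hcont : Continuous fun ε => √(C * ε) + |√(m ε) - √(m 0)| := by fun_prop
    refine (hcont.tendsto 0).mono_left nhdsWithin_le_nhds |>.eventually_lt_const ?_
    simpa using hδ
  obtain ⟨ε, hεδ, hε, hε4⟩ := (herror.and (Ioc_mem_nhdsGT (show (0 : ℝ) < 1 / 4 by simp))).exists
  obtain ⟨B, hB⟩ := hC ε hε hε4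
  have hlim : Tendsto (fun J : ℕ => √(C * ε + B * (J : ℝ)⁻¹) + |√(M ε J) - √(m 0)|) atTop
      (nhds (√(C * ε) + |√(m ε) - √(m 0)|)) := by
    have hM := (tendsto_sum_totient_mul_modelSum_sq hε.le (show ε < 1 by linarith)).sqrt
    have hB0 := ((tendsto_inv_atTop_nhds_zero_nat (𝕜 := ℝ)).const_mul B).const_add (C * ε)
    rw [mul_zero, add_zero] at hB0
    exact hB0.sqrt.add (hM.sub_const _).abs
  filter_upwards [hlim.eventually_lt_const hεδ, eventually_gt_atTop 0] with J hJδ hJ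
  refine ((abs_sub_le _ (√(M ε J)) _).trans (add_le_add_left ?_ _)).trans_lt hJδ
  refine (abs_sqrt_lcmSum_div_sub_le ε J).trans (Real.sqrt_le_sqrt ?_)
  have hJ0 : (J : ℝ) ≠ 0 := Nat.cast_ne_zero.mpr hJ.ne'
  calc _ ≤ (C * ε * J + B) / J := div_le_div_of_nonneg_right (hB J) J.cast_nonneg
    _ = C * ε + B * (J : ℝ)⁻¹ := by rw [add_div, mul_div_cancel_right₀ _ hJ0, div_eq_mul_inv]

theorem monotone_lcmSum : Monotone lcmSum := fun x y hxy => by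
  have hsub := Nat.primesLE_mono (Nat.floor_mono hxy)
  calc lcmSum x ≤ ∑ p ∈ Nat.primesLE ⌊x⌋₊, ∑ q ∈ Nat.primesLE ⌊y⌋₊,
        1 / (Nat.lcm (p - 1) (q - 1) : ℝ) :=
        sum_le_sum fun p _ => sum_le_sum_of_subset_of_nonneg hsub fun _ _ _ => by positivity
    _ ≤ lcmSum y :=
        sum_le_sum_of_subset_of_nonneg hsub fun _ _ _ => sum_nonneg fun _ _ => by positivity

theorem tendsto_div_of_tendsto_natCast_div {g : ℝ → ℝ} (hg : Monotone g) {c : ℝ}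
    (h : Tendsto (fun n : ℕ => g n / n) atTop (nhds c)) :
    Tendsto (fun t => g t / t) atTop (nhds c) := by
  have hfloor := (h.comp tendsto_nat_floor_atTop).mul (tendsto_nat_floor_div_atTop (R := ℝ))
  have hceil := (h.comp tendsto_nat_ceil_atTop).mul (tendsto_nat_ceil_div_atTop (R := ℝ))
  rw [mul_one] at hfloor hceil
  refine tendsto_of_tendsto_of_tendsto_of_le_of_le' hfloor hceil ?_ ?_ <;>
    filter_upwards [eventually_ge_atTop 1] with t ht
  · have hpos : (⌊t⌋₊ : ℝ) ≠ 0 := Nat.cast_ne_zero.mpr (Nat.floor_pos.mpr ht).ne'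
    rw [Function.comp_apply, div_mul_div_cancel₀ hpos]
    gcongr
    exact hg (Nat.floor_le (by linarith))
  · have hpos : (⌈t⌉₊ : ℝ) ≠ 0 := Nat.cast_ne_zero.mpr (Nat.ceil_pos.mpr (by linarith)).ne'
    rw [Function.comp_apply, div_mul_div_cancel₀ hpos]
    gcongr
    exact hg (Nat.le_ceil t)

theorem tendsto_lcmSum_div_log (hEH : ElliottHalberstam) :
    Tendsto (fun x : ℝ => lcmSum x / Real.log x) atTop (nhds (2 * totientConstant)) := by
  have hlog2 : 0 < Real.log 2 := Real.log_pos one_lt_two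
  have hmono : Monotone fun t : ℝ => lcmSum (2 ^ t) :=
    monotone_lcmSum.comp (Real.monotone_rpow_of_base_ge_one one_le_two)
  have hnat : Tendsto (fun n : ℕ => lcmSum ((2 : ℝ) ^ (n : ℝ)) / n) atTop
      (nhds (2 * (totientConstant * Real.log 2))) := by
    simpa only [Real.rpow_natCast] using tendsto_lcmSum_two_pow_div hEH
  have hlogb := ((tendsto_div_of_tendsto_natCast_div hmono hnat).comp
    (Real.tendsto_logb_atTop one_lt_two)).div_const (Real.log 2)
  rw [← mul_assoc, mul_div_cancel_right₀ _ hlog2.ne'] at hlogb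
  refine hlogb.congr' ?_
  filter_upwards [eventually_gt_atTop 0] with x hx
  rw [Function.comp_apply, Real.rpow_logb two_pos one_lt_two.ne' hx, div_div, Real.logb,
    div_mul_cancel₀ _ hlog2.ne']

end MainAsymptotic

theorem mainTheorem2 (hEH : ElliottHalberstam) :
    lcmSum ~[atTop] fun x : ℝ =>
      2 * ((riemannZeta 2).re * (riemannZeta 3).re / (riemannZeta 6).re) * Real.log x := by
  rw [← totientConstant_eq]
  have hc : 2 * totientConstant ≠ 0 := (mul_pos two_pos totientConstant_pos).ne'
  have hratio := (tendsto_lcmSum_div_log hEH).div_const (2 * totientConstant)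
  rw [div_self hc] at hratio
  refine isEquivalent_of_tendsto_one (hratio.congr fun x => ?_)
  rw [Pi.div_apply, div_div, mul_comm (Real.log x)]
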